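/- Let $\beta>0$ and $X=(0,\infty)$. Let $$\varphi_n(x)=\Big(\tfrac{2\,n!}{\Gamma(n+\beta+1/2)}\Big)^{1/2}L_n^{\beta-1/2}(x^2)\,x^{\beta}e^{-x^2/2},\qquad \lambda_n=4n+2\beta+1,\qquad n=0,1,2,\dots,$$ where $L_n^{\alpha}$ are the Laguerre polynomials; the $\varphi_n$ form an orthonormal basis of $L^2(X)$ consisting of eigenfunctions, with eigenvalues $\lambda_n$, of $$-\frac{d^2}{dx^2}+x^2+\frac{\beta^2-\beta}{x^2}.$$ Let $L$ be the Laguerre operator, i.e. the corresponding self-adjoint operator $Lf=\sum_n\lambda_n\langle f,\varphi_n\rangle\varphi_n$ on $L^2(X)$, and let $$T_t(x,y)=\sum_{n=0}^\infty e^{-t\lambda_n}\varphi_n(x)\varphi_n(y),\qquad x,y\in X,\ t>0.$$ Then this series converges, $T_t(x,y)$ is differentiable in $x$, and $T_t(x,y)$ is an integral kernel of the heat semigroup: for all $t>0$, $f\in L^2(X)$ and $x\in X$, $\sum_n e^{-t\lambda_n}\langle f,\varphi_n\rangle\varphi_n(x)=\int_X T_t(x,y)f(y)\,dy$, where the series converges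 and the integral converges absolutely. Let $H_t(x-y)=(4\pi t)^{-1/2}e^{-|x-y|^2/(4t)}$ and let $\mathcal Q_L$ be the covering of $X$ by the intervals $$[2^n+(k-1)2^{-n},\,2^n+k2^{-n}]\ \ (n=0,1,2,\dots;\ k=1,\dots,2^{2n}),\qquad [2^{-n},2^{-n+1}]\ \ (n=1,2,\dots).$$ For an interval $Q=\{x:|x-z|\le r\}$ put $d_Q=2r$; for $\kappa>1$ let $Q^{*},Q^{**},Q^{***}$ be the sets $\{x\in X:|x-z|\le\kappa^j r\}$ with $j=1,2,3$. Let $\kappa>1$ be any number such that, for all $Q_1,Q_2\in\mathcal Q_L$, $Q_1^{***}\cap Q_2^{***}\ne\emptyset$ if and only if $Q_1\cap Q_2\neq\emptyset$, and such that $\mathrm{dist}(Q^{***},\mathbb R\setminus X)>0$ for all $Q\in\mathcal Q_L$. Then there is a finite constant $C$, depending only on $\beta$ and $\kappa$, such that $$(A_3)\quad \sup_{y\in Q^{**}}\int_{X\setminus Q^{***}}\int_0^{d_Q^2}|\partial_xT_t(x,y)|\,\frac{dt}{\sqrt t}\,dx\le C\quad\text{for all }Q\in\mathcal Q_L,$$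 $$(A_4)\quad \sup_{y\in Q^{**}}\int_X\int_{d_Q^2}^\infty|\partial_xT_t(x,y)|\,\frac{dt}{\sqrt t}\,dx\le C\quad\text{for all }Q\in\mathcal Q_L,$$ $$(A_5)\quad \sup_{y\in Q^{**}}\int_{Q^{***}}\int_0^{d_Q^2}\big|\partial_x\big(T_t(x,y)-H_t(x-y)\big)\big|\,\frac{dt}{\sqrt t}\,dx\le C\quad\text{for all }Q\in\mathcal Q_L,$$ $$(A_6)\quad \sup_{y\in X}\int_X\int_0^\infty|V(x)|\,|T_t(x,y)|\,\frac{dt}{\sqrt t}\,dx\le C,\qquad V(x)=x-\frac{\beta}{x}.$$ -/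

import Mathlib

open MeasureTheory Set
open scoped ENNReal NNReal

noncomputable section

/-! ### Families of intervals in a one-dimensional space `X ⊆ ℝ`, and enlargements

A closed interval with end points `a < b` is coded by the pair `(a, b)`; it is the cuboid
`Q(z, r) = {x ∈ X : |x - z| ≤ r}` with centre `z = (a + b) / 2` and radius `r = (b - a) / 2`. -/

/-- The diameter `d_Q`. -/
def diamI (Q : ℝ × ℝ) : ℝ := Q.2 - Q.1

/-- `Q(z, κ r)`: the interval `Q` enlarged by the factor `κ` about its centre, inside `X`.
Thus `Q = enlarge X 1 Q`, and `Q^*`, `Q^{**}`, `Q^{***}` are the enlargements of `Q` by the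
factors `κ`, `κ ^ 2`, `κ ^ 3`. -/
def enlarge (X : Set ℝ) (κ : ℝ) (Q : ℝ × ℝ) : Set ℝ :=
  {x | x ∈ X ∧ |x - (Q.1 + Q.2) / 2| ≤ κ * ((Q.2 - Q.1) / 2)}

/-- `κ > 1` is a permitted enlargement factor for the family `𝒬` of intervals in `X`:
triple enlargements meet only if the intervals themselves meet, and each triple enlargement has
positive distance from the complement of `X`. -/
structure IsEnlargementFactor (X : Set ℝ) (𝒬 : Set (ℝ × ℝ)) (κ : ℝ) : Prop where
  one_lt : 1 < κ
  neighbours : ∀ Q₁ ∈ 𝒬, ∀ Q₂ ∈ 𝒬,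
    ((enlarge X (κ ^ 3) Q₁ ∩ enlarge X (κ ^ 3) Q₂).Nonempty ↔
      (enlarge X 1 Q₁ ∩ enlarge X 1 Q₂).Nonempty)
  dist_pos : ∀ Q ∈ 𝒬, ∃ ε > 0, ∀ x ∈ enlarge X (κ ^ 3) Q, ∀ z ∉ X, ε ≤ |x - z|

/-! ### The conditions `(A₃)`–`(A₆)` in dimension one

`T t x y` is a heat kernel on `X`, `V` is the potential in the derivative `∂ₓ + V`. All integrals
are integrals of nonnegative functions with values in `[0, ∞]`. -/

/-- The classical heat kernel `H_t(x - y)` on `ℝ`. -/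
def gaussKernel (t x y : ℝ) : ℝ :=
  (4 * Real.pi * t) ^ (-(1 / 2) : ℝ) * Real.exp (-(x - y) ^ 2 / (4 * t))

/-- `sup_{y ∈ Q^{**}} ∫_{X \ Q^{***}} ∫_0^{d_Q²} |∂ₓ T_t(x,y)| dt/√t dx ≤ C` for `Q ∈ 𝒬`. -/
def CondA3 (X : Set ℝ) (T : ℝ → ℝ → ℝ → ℝ) (𝒬 : Set (ℝ × ℝ)) (κ : ℝ) (C : ℝ≥0) : Prop :=
  ∀ Q ∈ 𝒬, ∀ y ∈ enlarge X (κ ^ 2) Q,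
    ∫⁻ x in X \ enlarge X (κ ^ 3) Q, ∫⁻ t in Ioc 0 (diamI Q ^ 2),
      ENNReal.ofReal (|deriv (fun x' => T t x' y) x| / √t) ≤ C

/-- `sup_{y ∈ Q^{**}} ∫_X ∫_{d_Q²}^∞ |∂ₓ T_t(x,y)| dt/√t dx ≤ C` for `Q ∈ 𝒬`. -/
def CondA4 (X : Set ℝ) (T : ℝ → ℝ → ℝ → ℝ) (𝒬 : Set (ℝ × ℝ)) (κ : ℝ) (C : ℝ≥0) : Prop :=
  ∀ Q ∈ 𝒬, ∀ y ∈ enlarge X (κ ^ 2) Q,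
    ∫⁻ x in X, ∫⁻ t in Ioi (diamI Q ^ 2),
      ENNReal.ofReal (|deriv (fun x' => T t x' y) x| / √t) ≤ C

/-- `sup_{y ∈ Q^{**}} ∫_{Q^{***}} ∫_0^{d_Q²} |∂ₓ (T_t(x,y) - H_t(x-y))| dt/√t dx ≤ C`
for `Q ∈ 𝒬`. -/
def CondA5 (X : Set ℝ) (T : ℝ → ℝ → ℝ → ℝ) (𝒬 : Set (ℝ × ℝ)) (κ : ℝ) (C : ℝ≥0) : Prop :=
  ∀ Q ∈ 𝒬, ∀ y ∈ enlarge X (κ ^ 2) Q,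
    ∫⁻ x in enlarge X (κ ^ 3) Q, ∫⁻ t in Ioc 0 (diamI Q ^ 2),
      ENNReal.ofReal (|deriv (fun x' => T t x' y - gaussKernel t x' y) x| / √t) ≤ C

/-- `sup_{y ∈ X} ∫_X ∫_0^∞ |V(x)| T_t(x,y) dt/√t dx ≤ C`. The absolute value around `T` changes
nothing for a nonnegative kernel. -/
def CondA6 (X : Set ℝ) (T : ℝ → ℝ → ℝ → ℝ) (V : ℝ → ℝ) (C : ℝ≥0) : Prop :=
  ∀ y ∈ X, ∫⁻ x in X, ∫⁻ t in Ioi (0 : ℝ), ENNReal.ofReal (|V x| * |T t x y| / √t) ≤ C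

/-! ### The Laguerre operator on `(0, ∞)` and its heat kernel -/

/-- The Laguerre differential expression `-u'' + x² u + (β² - β) / x² · u`. -/
def laguerreExpr (β : ℝ) (u : ℝ → ℝ) (x : ℝ) : ℝ :=
  -deriv (deriv u) x + (x ^ 2 + (β ^ 2 - β) / x ^ 2) * u x

/-- The Laguerre polynomial `L_n^α(s) = ∑_{j ≤ n} (-1)^j Γ(n+α+1) / ((n-j)! Γ(j+α+1) j!) s^j`,
for `α > -1`. -/
def laguerrePoly (α : ℝ) (n : ℕ) (s : ℝ) : ℝ :=
  ∑ j ∈ Finset.range (n + 1),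
    (-1) ^ j * Real.Gamma (n + α + 1) /
      ((n - j).factorial * Real.Gamma (j + α + 1) * j.factorial) * s ^ j

/-- The Laguerre functions
`φ_n(x) = (2 n! / Γ(n+β+1/2))^{1/2} L_n^{β-1/2}(x²) x^β e^{-x²/2}`, `n = 0, 1, 2, …`,
an orthonormal basis of `L²(0, ∞)`. -/
def laguerreFun (β : ℝ) (n : ℕ) (x : ℝ) : ℝ :=
  √(2 * n.factorial / Real.Gamma (n + β + 1 / 2)) * laguerrePoly (β - 1 / 2) n (x ^ 2) *
    x ^ β * Real.exp (-x ^ 2 / 2)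

/-- The eigenvalue `4 n + 2 β + 1` of the Laguerre operator on `φ_n`. -/
def laguerreEigenvalue (β : ℝ) (n : ℕ) : ℝ := 4 * n + 2 * β + 1

/-- The Laguerre polynomial solves `s P'' + (α + 1 - s) P' + n P = 0`. -/
theorem laguerrePoly_ode {α : ℝ} (hα : -1 < α) (n : ℕ) (s : ℝ) :
    ∃ P' P'' : ℝ → ℝ, (∀ u, HasDerivAt (laguerrePoly α n) (P' u) u) ∧
      (∀ u, HasDerivAt P' (P'' u) u) ∧
      s * P'' s + (α + 1 - s) * P' s + n * laguerrePoly α n s = 0 := by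
  set a : ℕ → ℝ := fun j => (-1) ^ j * Real.Gamma (n + α + 1) /
      ((n - j).factorial * Real.Gamma (j + α + 1) * j.factorial) with ha
  have hP : ∀ u, laguerrePoly α n u = ∑ j ∈ Finset.range (n + 1), a j * u ^ j := fun u => rfl
  have hrec : ∀ j < n, ((j : ℝ) + 1) * (j + 1 + α) * a (j + 1) = -((n : ℝ) - j) * a j := by
    intro j hj
    have hG : Real.Gamma ((j + 1 : ℕ) + α + 1) = (j + α + 1) * Real.Gamma (j + α + 1) := by
      rw [← Real.Gamma_add_one (by have : (0 : ℝ) ≤ j := j.cast_nonneg; linarith)]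
      congr 1; push_cast; ring
    have hGpos : 0 < Real.Gamma (j + α + 1) :=
      Real.Gamma_pos_of_pos (by have : (0 : ℝ) ≤ j := j.cast_nonneg; linarith)
    have hjpos : (0 : ℝ) < j + α + 1 := by have : (0 : ℝ) ≤ j := j.cast_nonneg; linarith
    obtain ⟨m, rfl⟩ : ∃ m, n = j + m + 1 := ⟨n - j - 1, by omega⟩
    have e1 : j + m + 1 - j = m + 1 := by omega
    have e2 : j + m + 1 - (j + 1) = m := by omega
    simp only [ha]
    rw [hG, e1, e2, Nat.factorial_succ, Nat.factorial_succ, pow_succ]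
    have h1 : (m.factorial : ℝ) ≠ 0 := by exact_mod_cast m.factorial_ne_zero
    have h2 : (j.factorial : ℝ) ≠ 0 := by exact_mod_cast j.factorial_ne_zero
    have h3 : (m : ℝ) + 1 ≠ 0 := by positivity
    have h4 : (j : ℝ) + 1 ≠ 0 := by positivity
    have h5 := hjpos.ne'
    have h6 := hGpos.ne'
    push_cast
    field_simp
    ring
  refine ⟨fun u => ∑ j ∈ Finset.range (n + 1), a j * (j * u ^ (j - 1)),
    fun u => ∑ j ∈ Finset.range (n + 1), a j * (j * ((j - 1 : ℕ) * u ^ (j - 1 - 1))), ?_, ?_, ?_⟩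
  · intro u
    have : laguerrePoly α n = fun u => ∑ j ∈ Finset.range (n + 1), a j * u ^ j := funext hP
    rw [this]
    exact HasDerivAt.fun_sum fun j _ => (hasDerivAt_pow j u).const_mul (a j)
  · intro u
    exact HasDerivAt.fun_sum fun j _ =>
      ((hasDerivAt_pow (j - 1) u).const_mul (j : ℝ)).const_mul (a j)
  · rw [hP]
    have key : ∀ j ∈ Finset.range (n + 1),
        s * (a j * (j * ((j - 1 : ℕ) * s ^ (j - 1 - 1)))) + (α + 1 - s) * (a j * (j * s ^ (j - 1)))
          + n * (a j * s ^ j) =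
        (j * (j + α) * a j * s ^ (j - 1)) + ((n : ℝ) - j) * a j * s ^ j := by
      intro j _
      rcases j with _ | _ | j
      · simp
      · simp; ring
      · simp only [Nat.add_sub_cancel]
        push_cast
        ring
    simp only [Finset.mul_sum]
    rw [← Finset.sum_add_distrib, ← Finset.sum_add_distrib, Finset.sum_congr rfl key,
      Finset.sum_add_distrib, Finset.sum_range_succ', Finset.sum_range_succ (fun j : ℕ =>
        ((n : ℝ) - j) * a j * s ^ j)]
    simp only [Nat.cast_zero, zero_mul, add_zero, sub_self]
    rw [← Finset.sum_add_distrib]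
    refine Finset.sum_eq_zero fun j hj => ?_
    have := hrec j (Finset.mem_range.1 hj)
    simp only [Nat.add_sub_cancel]
    push_cast
    linear_combination s ^ j * this

/-- `φ_n` is an eigenfunction of the Laguerre differential expression. -/
theorem laguerreExpr_laguerreFun {β : ℝ} (hβ : 0 < β) (n : ℕ) {x : ℝ} (hx : 0 < x) :
    laguerreExpr β (laguerreFun β n) x = laguerreEigenvalue β n * laguerreFun β n x := by
  obtain ⟨P', P'', h1, h2, h3⟩ := laguerrePoly_ode (α := β - 1 / 2) (by linarith) n (x ^ 2)
  set c : ℝ := √(2 * n.factorial / Real.Gamma (n + β + 1 / 2)) with hc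
  set P := laguerrePoly (β - 1 / 2) n with hP
  set D : ℝ → ℝ := fun u =>
    c * (P' (u ^ 2) * (2 * u) + P (u ^ 2) * (β / u - u)) * u ^ β * Real.exp (-u ^ 2 / 2) with hD
  have hsq : ∀ u : ℝ, HasDerivAt (fun u : ℝ => u ^ 2) (2 * u) u := fun u => by
    simpa using hasDerivAt_pow 2 u
  have hexp : ∀ u : ℝ, HasDerivAt (fun u : ℝ => Real.exp (-u ^ 2 / 2))
      (Real.exp (-u ^ 2 / 2) * -u) u := fun u => by
    have h := (((hsq u).fun_neg).div_const 2).exp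
    convert h using 1
    ring
  have hrp : ∀ u : ℝ, 0 < u → HasDerivAt (fun u : ℝ => u ^ β) (β / u * u ^ β) u := fun u hu => by
    have h := Real.hasDerivAt_rpow_const (p := β) (Or.inl hu.ne')
    rw [Real.rpow_sub_one hu.ne'] at h
    convert h using 1
    ring
  have hg1 : ∀ u : ℝ, 0 < u → HasDerivAt (laguerreFun β n) (D u) u := fun u hu => by
    have h := ((((h1 (u ^ 2)).comp u (hsq u)).const_mul c).mul (hrp u hu)).mul (hexp u)
    refine (h.congr_deriv ?_)
    simp only [hD, Function.comp, Pi.mul_apply]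
    ring
  have hg2 : HasDerivAt D (c * ((P'' (x ^ 2) * (2 * x) * (2 * x) + P' (x ^ 2) * 2) +
      (P' (x ^ 2) * (2 * x) * (β / x - x) + P (x ^ 2) * (-β / x ^ 2 - 1)) +
      (P' (x ^ 2) * (2 * x) + P (x ^ 2) * (β / x - x)) * (β / x - x)) * x ^ β *
        Real.exp (-x ^ 2 / 2)) x := by
    have ha := ((h2 (x ^ 2)).comp x (hsq x)).mul ((hasDerivAt_id x).const_mul 2)
    have hq : HasDerivAt (fun u : ℝ => β / u - u) (-β / x ^ 2 - 1) x := by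
      have h := ((hasDerivAt_inv hx.ne').const_mul β).sub (hasDerivAt_id x)
      refine (h.congr_deriv ?_).congr_of_eventuallyEq ?_
      · field_simp
      · exact Filter.Eventually.of_forall fun u => by simp [div_eq_mul_inv]
    have hb := ((h1 (x ^ 2)).comp x (hsq x)).mul hq
    have h := (((ha.add hb).const_mul c).mul (hrp x hx)).mul (hexp x)
    refine (h.congr_deriv ?_).congr_of_eventuallyEq ?_
    · simp only [Function.comp, Pi.mul_apply, Pi.add_apply, id]
      ring
    · exact Filter.Eventually.of_forall fun u => by simp [hD]
  have hd : deriv (deriv (laguerreFun β n)) x = _ :=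
    (hg2.congr_of_eventuallyEq (by
      filter_upwards [lt_mem_nhds hx] with u hu using (hg1 u hu).deriv)).deriv
  have hφ : laguerreFun β n x = c * P (x ^ 2) * x ^ β * Real.exp (-x ^ 2 / 2) := rfl
  rw [laguerreExpr, hd, hφ, laguerreEigenvalue]
  have hx' := hx.ne'
  have e : (-(c * ((P'' (x ^ 2) * (2 * x) * (2 * x) + P' (x ^ 2) * 2) +
      (P' (x ^ 2) * (2 * x) * (β / x - x) + P (x ^ 2) * (-β / x ^ 2 - 1)) +
      (P' (x ^ 2) * (2 * x) + P (x ^ 2) * (β / x - x)) * (β / x - x))) +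
      (x ^ 2 + (β ^ 2 - β) / x ^ 2) * (c * P (x ^ 2))) =
      (4 * n + 2 * β + 1) * (c * P (x ^ 2)) := by
    field_simp
    linear_combination (-4 * c * x ^ 2) * h3
  linear_combination (x ^ β * Real.exp (-x ^ 2 / 2)) * e

/-- The heat kernel `T_t(x, y) = ∑ e^{-t λ_n} φ_n(x) φ_n(y)` of the Laguerre operator. -/
def laguerreHeatKernel (β t x y : ℝ) : ℝ :=
  ∑' n, Real.exp (-t * laguerreEigenvalue β n) * laguerreFun β n x * laguerreFun β n y

/-- `T` is an integral kernel of the heat semigroup `e^{-tL}` on `L²(0, ∞)`. Here `L` is the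
self-adjoint Laguerre operator `L f = ∑ λ_n ⟨f, φ_n⟩ φ_n` with domain
`{f ∈ L²(0, ∞) : ∑ λ_n² ⟨f, φ_n⟩² < ∞}`, so that `e^{-tL} f = ∑ e^{-t λ_n} ⟨f, φ_n⟩ φ_n`. -/
def IsLaguerreSemigroupKernel (β : ℝ) (T : ℝ → ℝ → ℝ → ℝ) : Prop :=
  ∀ t > 0, ∀ f : ℝ → ℝ, MemLp f 2 (volume.restrict (Ioi 0)) → ∀ x > 0,
    IntegrableOn (fun y => T t x y * f y) (Ioi 0) ∧
    HasSum (fun n : ℕ => Real.exp (-t * laguerreEigenvalue β n) *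
        (∫ y in Ioi 0, f y * laguerreFun β n y) * laguerreFun β n x)
      (∫ y in Ioi 0, T t x y * f y)

/-- The function `V(x) = x - β / x` in the derivative `∂ₓ + x - β / x` that belongs to the Riesz
transform of the Laguerre operator. -/
def laguerreV (β x : ℝ) : ℝ := x - β / x

/-- The covering of `(0, ∞)` by the intervals `[2^n + (k-1) 2^{-n}, 2^n + k 2^{-n}]`,
`n ≥ 0`, `1 ≤ k ≤ 2^{2n}`, and `[2^{-n}, 2^{-n+1}]`, `n ≥ 1`. -/
def laguerreCovering : Set (ℝ × ℝ) :=
  {Q | ∃ n k : ℕ, 1 ≤ k ∧ k ≤ 2 ^ (2 * n) ∧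
      Q = (2 ^ n + ((k : ℝ) - 1) * (2 ^ n)⁻¹, 2 ^ n + (k : ℝ) * (2 ^ n)⁻¹)} ∪
  {Q | ∃ n : ℕ, 1 ≤ n ∧ Q = ((2 ^ n)⁻¹, 2 * (2 ^ n)⁻¹)}

end

/-! The heat kernel has a closed form. The Hille–Hardy formula sums the series for `T_t(x, y)` to
`(sinh 2t)^(-1/2) exp(E) F(z)` with `z = xy / sinh 2t`. Here `E = -(x - y)² / (2 sinh 2t) - (x² +
y²) tanh t / 2` is Mehler's exponent and `F(z) = √z e^(-z) I_{β-1/2}(z)` is the scaled Bessel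
function. Hille–Hardy itself is an interchange of summations: a product of two Laguerre polynomials
is a finite combination of `L_m^(α+2k)(x + y)`, the sum over `m` is the generating function, and the
sum over `k` is the Bessel series.

Everything needed about `F` comes from Poisson's integral, which writes `F(z)` as a constant times
`z^β ∫₀¹ (e^(-zu) + e^(-z(2-u))) (u(2-u))^(β-1) du`. It yields `F(z), |z F'(z)| ≤ C min(1, z^β)` and
`|F(z) - 1/√(2π)| ≤ C / z`. The first bound controls `T_t` by the majorant `K = (sinh 2t)^(-1/2) e^E
min(1, z^β)`, and `∂ₓ T_t` by `K (|x - y| / sinh 2t + x + 1/x)`. The limit `1/√(2π)` is the constant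
that makes the leading term of `T_t` the Gauss kernel.

The central estimate is that `K (x + 1/x) / √t` has integral over all `x, t > 0` bounded uniformly
in `y` (`exists_lintegral_heatMajorant_le`). The factor `exp(-(x² + y²) tanh t / 2)` pays for `x`,
the factor `z^β` pays for `1/x` near the origin, and scaling removes `y`. Since `|V| ≤ (1 + β)(x +
1/x)`, this is the bound on the potential term, and it disposes of the `x + 1/x` part of the
derivative in the other three conditions.

What remains is the singular part `K |x - y| / sinh 2t`, which is critical in `t` and uses the
covering. An interval `Q` with centre `z_Q` has `d_Q` comparable to `min(z_Q, 1/z_Q)`. In `(A₃)` the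
points are a multiple of `d_Q` apart, so the Gaussian beats every power of `t`
(`heatMajorant_mul_abs_sub_le`). In `(A₄)` the time exceeds `d_Q²`, and either the decay `e^(-c y²
t)` or the factor `(xy/t)^β` supplies the missing negative power of `t`
(`exists_lintegral_heatMajorant_mul_abs_sub_le`). In `(A₅)` subtracting the Gauss kernel cancels the
singular part, leaving an error `O(1 + x² + y²)` and another multiple of `K (x + 1/x)`
(`exists_abs_deriv_sub_gaussKernel_le`). -/

noncomputable section

/-! ### The Hille–Hardy formula -/

/-- Summation over the diagonals of `ℕ × ℕ`, under domination by a family with iterated sums. -/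
theorem hasSum_antidiagonal_of_dominated {f b : ℕ → ℕ → ℝ} {g g' : ℕ → ℝ} {s : ℝ}
    (hf : ∀ j, HasSum (f j) (g j)) (hb : ∀ j, HasSum (b j) (g' j))
    (hfb : ∀ j l, |f j l| ≤ b j l) (hg : HasSum g s) (hg' : Summable g') :
    HasSum (fun n => ∑ p ∈ Finset.HasAntidiagonal.antidiagonal n, f p.1 p.2) s := by
  have hb0 : ∀ j l, 0 ≤ b j l := fun j l => (abs_nonneg _).trans (hfb j l)
  -- For the nonnegative family `b` iterated summability is joint summability; domination passes it
  -- to `f`, whose sum may then be regrouped at will.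
  have hbs : Summable fun p : ℕ × ℕ => b p.1 p.2 := by
    rw [summable_prod_of_nonneg fun p => hb0 p.1 p.2]
    exact ⟨fun j => (hb j).summable, by simpa only [(hb _).tsum_eq] using hg'⟩
  have hfs : Summable fun p : ℕ × ℕ => f p.1 p.2 :=
    Summable.of_norm_bounded hbs fun p => hfb p.1 p.2
  have hs : HasSum (fun p : ℕ × ℕ => f p.1 p.2) s := by
    have h := hfs.hasSum
    rwa [(h.prod_fiberwise hf).unique hg] at h
  have h2 := (Finset.HasAntidiagonal.sigmaAntidiagonalEquivProd (A := ℕ)).hasSum_iff.2 hs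
  refine h2.sigma fun n => ?_
  have h3 := hasSum_fintype
    (fun p : Finset.HasAntidiagonal.antidiagonal n => f p.1.1 p.1.2)
  rw [Finset.sum_coe_sort (Finset.HasAntidiagonal.antidiagonal n) fun p => f p.1 p.2] at h3
  exact h3

/-- The binomial series in terms of the Gamma function. -/
theorem hasSum_Gamma_mul_pow {s r : ℝ} (hs : 0 < s) (hr0 : 0 ≤ r) (hr : r < 1) :
    HasSum (fun m : ℕ => Real.Gamma (m + s) / m.factorial * r ^ m)
      (Real.Gamma s * (1 - r) ^ (-s)) := by
  have h := (Real.one_div_one_sub_rpow_hasFPowerSeriesOnBall_zero s).hasSum (y := r)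
    (by simp [enorm_eq_nnnorm, ← NNReal.coe_lt_coe, abs_of_nonneg hr0, hr])
  have h2 := h.mul_left (Real.Gamma s)
  rw [zero_add, one_div, ← Real.rpow_neg (by linarith)] at h2
  -- The generalized binomial coefficient is a rising factorial over `m!`, and the rising factorial
  -- is `Γ(m + s) / Γ(s)`.
  have hasc : ∀ m : ℕ, (m.factorial : ℝ) * Ring.choose (s + m - 1) m =
      (ascPochhammer ℝ m).eval s := fun m => by
    rw [← Ring.multichoose_eq, ← nsmul_eq_mul, Ring.factorial_nsmul_multichoose_eq_ascPochhammer,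
      ← Polynomial.ascPochhammer_smeval_cast ℝ, Polynomial.eval_eq_smeval]
  have hG : ∀ m : ℕ, Real.Gamma (m + s) = Real.Gamma s * (ascPochhammer ℝ m).eval s := by
    intro m
    induction m with
    | zero => simp
    | succ m ih =>
      have : ((m + 1 : ℕ) : ℝ) + s = (m + s) + 1 := by push_cast; ring
      rw [this, Real.Gamma_add_one (by positivity), ih, ascPochhammer_succ_eval]
      ring
  refine h2.congr_fun fun m => ?_
  rw [hG m, ← hasc]
  have : (m.factorial : ℝ) ≠ 0 := by exact_mod_cast m.factorial_ne_zero
  simp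
  field_simp

theorem laguerrePoly_eq_sum_antidiagonal (a : ℝ) (m : ℕ) (x : ℝ) :
    laguerrePoly a m x = ∑ p ∈ Finset.HasAntidiagonal.antidiagonal m,
      (-x) ^ p.1 * Real.Gamma (m + a + 1) /
        (p.2.factorial * Real.Gamma (p.1 + a + 1) * p.1.factorial) := by
  rw [Finset.Nat.sum_antidiagonal_eq_sum_range_succ
    (fun i j => (-x) ^ i * Real.Gamma (m + a + 1) /
        (j.factorial * Real.Gamma (i + a + 1) * i.factorial)) m, laguerrePoly]
  refine Finset.sum_congr rfl fun j _ => ?_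
  rw [neg_pow x]
  ring

/-- The generating function of the Laguerre polynomials. -/
theorem hasSum_pow_mul_laguerrePoly {a r : ℝ} (ha : -1 < a) (hr0 : 0 ≤ r) (hr : r < 1) (x : ℝ) :
    HasSum (fun m : ℕ => r ^ m * laguerrePoly a m x)
      ((1 - r) ^ (-(a + 1)) * Real.exp (-(x * (r / (1 - r))))) := by
  have h1r : 0 < 1 - r := by linarith
  have hpos : ∀ j : ℕ, 0 < (j : ℝ) + a + 1 := fun j => by
    have : (0 : ℝ) ≤ j := j.cast_nonneg
    linarith
  have hG : ∀ j : ℕ, 0 < Real.Gamma (j + a + 1) := fun j => Real.Gamma_pos_of_pos (hpos j)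
  -- With the power `j` of `x` fixed, the sum over the other index is the binomial series with
  -- exponent `j + a + 1`; what is left is the `j`-th term of an exponential series.
  have key : ∀ (x : ℝ) (j : ℕ), HasSum
      (fun l : ℕ => ((-x) ^ j * r ^ j / (j.factorial * Real.Gamma (j + a + 1))) *
        (Real.Gamma (l + (j + a + 1)) / l.factorial * r ^ l))
      ((1 - r) ^ (-(a + 1)) * ((-(x * (r / (1 - r)))) ^ j / j.factorial)) := by
    intro x j
    have h := (hasSum_Gamma_mul_pow (hpos j) hr0 hr).mul_left
      ((-x) ^ j * r ^ j / (j.factorial * Real.Gamma (j + a + 1)))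
    have e : (1 - r) ^ (-((j : ℝ) + a + 1)) = (1 - r) ^ (-(a + 1)) / (1 - r) ^ j := by
      rw [← Real.rpow_natCast, ← Real.rpow_sub h1r]
      congr 1
      ring
    have h1 := (hG j).ne'
    have h2 : (j.factorial : ℝ) ≠ 0 := by exact_mod_cast j.factorial_ne_zero
    have e2 : (-(x * (r / (1 - r)))) ^ j = (-x) ^ j * r ^ j / (1 - r) ^ j := by
      rw [← neg_mul, mul_pow, div_pow, mul_div_assoc]
    have e3 : (1 - r) ^ (-(a + 1)) * ((-(x * (r / (1 - r)))) ^ j / j.factorial) =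
        ((-x) ^ j * r ^ j / (j.factorial * Real.Gamma (j + a + 1))) *
          (Real.Gamma (j + a + 1) * (1 - r) ^ (-((j : ℝ) + a + 1))) := by
      rw [e, e2]
      field_simp
    rwa [e3]
  have hexp : ∀ x : ℝ, HasSum
      (fun j : ℕ => (1 - r) ^ (-(a + 1)) * ((-(x * (r / (1 - r)))) ^ j / j.factorial))
      ((1 - r) ^ (-(a + 1)) * Real.exp (-(x * (r / (1 - r))))) := fun x => by
    have h := NormedSpace.expSeries_div_hasSum_exp (-(x * (r / (1 - r))))
    rw [← Real.exp_eq_exp_ℝ] at h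
    exact h.mul_left _
  -- The dominating family is the same one at `-|x|`, where the alternating signs disappear.
  have hdom := hasSum_antidiagonal_of_dominated (key x) (key (-|x|)) (fun j l => ?_) (hexp x)
    (hexp (-|x|)).summable
  swap
  · have h1 : 0 ≤ Real.Gamma (l + (j + a + 1)) :=
      (Real.Gamma_pos_of_pos (by have := hpos j; positivity)).le
    rw [abs_mul, abs_div, abs_mul, abs_pow, abs_neg, neg_neg, abs_of_nonneg (pow_nonneg hr0 j),
      abs_of_nonneg (mul_nonneg (Nat.cast_nonneg _) (hG j).le),
      abs_of_nonneg (mul_nonneg (div_nonneg h1 (Nat.cast_nonneg _)) (pow_nonneg hr0 l))]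
  · refine hdom.congr_fun fun m => ?_
    rw [laguerrePoly_eq_sum_antidiagonal, Finset.mul_sum]
    refine Finset.sum_congr rfl fun p hp => ?_
    have hp : p.1 + p.2 = m := by simpa using hp
    subst hp
    rw [pow_add]
    have e : ((p.1 + p.2 : ℕ) : ℝ) + a + 1 = p.2 + (p.1 + a + 1) := by push_cast; ring
    rw [e]
    ring

/-- The coefficients alternate in sign, so evaluation at a nonpositive point adds up the absolute
values. This provides the dominating family in the Hille–Hardy formula. -/
theorem abs_laguerrePoly_le {a : ℝ} (ha : -1 < a) (m : ℕ) {x : ℝ} (hx : 0 ≤ x) :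
    |laguerrePoly a m x| ≤ laguerrePoly a m (-x) := by
  have hG : ∀ j : ℕ, 0 < Real.Gamma (j + a + 1) := fun j => Real.Gamma_pos_of_pos (by
    have : (0 : ℝ) ≤ j := j.cast_nonneg
    linarith)
  rw [laguerrePoly_eq_sum_antidiagonal, laguerrePoly_eq_sum_antidiagonal]
  refine (Finset.abs_sum_le_sum_abs _ _).trans (Finset.sum_le_sum fun p _ => ?_)
  rw [abs_div, abs_mul, abs_pow, abs_neg, neg_neg, abs_of_nonneg hx, abs_of_pos (hG m),
    abs_of_nonneg (mul_nonneg (mul_nonneg (Nat.cast_nonneg _) (hG _).le) (Nat.cast_nonneg _))]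

/-- A terminating summation formula for products of falling factorials, for a sequence `G` with
`G (n + 1) = (n + α + 1) G n` such as `G n = Γ(n + α + 1)`. -/
theorem descFactorial_mul_descFactorial_eq_sum {α : ℝ} (hα : -1 < α) {G : ℕ → ℝ}
    (hG0 : ∀ n, G n ≠ 0) (hG : ∀ n : ℕ, G (n + 1) = (n + α + 1) * G n) (n i j : ℕ) :
    (n.descFactorial i : ℝ) * n.descFactorial j * (G n / n.factorial) =
      ∑ k ∈ Finset.range (j + 1), (i.choose k * j.choose k * k.factorial * (G i * G j) /
        (G k * G (i + j))) * (G (n + k) / (n + k).factorial * (n + k).descFactorial (i + j)) := by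
  induction i with
  | zero =>
    rw [Finset.sum_range_succ', Finset.sum_eq_zero]
    · have h0 := hG0 0
      have hj := hG0 j
      simp
      field_simp
    · intro k _
      simp
  | succ i ih =>
    have hpos : ∀ m : ℕ, (0 : ℝ) < m + α + 1 := fun m => by
      have : (0 : ℝ) ≤ m := m.cast_nonneg
      linarith
    have hD : ∀ m l : ℕ, (m.descFactorial (l + 1) : ℝ) = ((m : ℝ) - l) * m.descFactorial l := by
      intro m l
      rw [Nat.descFactorial_succ]
      rcases le_or_gt l m with h | h
      · push_cast [h]; ring
      · rw [Nat.descFactorial_of_lt h]; simp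
    set c : ℕ → ℝ := fun k => i.choose k * j.choose k * k.factorial * (G i * G j) /
        (G k * G (i + j)) with hc
    set u : ℕ → ℝ := fun k => G (n + k) / (n + k).factorial * (n + k).descFactorial (i + j)
      with hu
    set U : ℕ → ℝ := fun k => G (n + k) / (n + k).factorial * (n + k).descFactorial (i + 1 + j)
      with hU
    have hden : ((i : ℝ) + j + α + 1) ≠ 0 := by
      have := (hpos (i + j)).ne'
      push_cast at this
      exact this
    have hU0 : ∀ k, U k = ((n : ℝ) + k - i - j) * u k := by
      intro k
      simp only [hU, hu]
      rw [show i + 1 + j = i + j + 1 by ring, hD]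
      push_cast
      ring
    have hU1 : ∀ k, U (k + 1) = ((n : ℝ) + k + α + 1) * u k := by
      intro k
      simp only [hU, hu]
      rw [show i + 1 + j = i + j + 1 by ring, ← add_assoc n k 1, Nat.succ_descFactorial_succ,
        Nat.factorial_succ, hG]
      have : ((n + k).factorial : ℝ) ≠ 0 := by exact_mod_cast (n + k).factorial_ne_zero
      have : ((n + k : ℕ) : ℝ) + 1 ≠ 0 := by positivity
      push_cast at this ⊢
      field_simp
    -- Raising `i` multiplies the left side by `n - i`. Since `U k` and `U (k + 1)` are `n + k - i -
    -- j` and `n + k + α + 1` times `u k`, the identity `(n - i)(i + j + α + 1) = (i + k + α + 1)(n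
    -- + k - i - j) + (j - k)(n + k + α + 1)` rewrites each term in the new basis.
    have hstep : ∀ k : ℕ, ((n : ℝ) - i) * (c k * u k) =
        c k * ((i + k + α + 1) / (i + j + α + 1)) * U k +
          c k * ((j - k) / (i + j + α + 1)) * U (k + 1) := by
      intro k
      rw [hU0, hU1]
      field_simp
      ring
    have hGij : G (i + 1 + j) = (i + j + α + 1) * G (i + j) := by
      rw [show i + 1 + j = i + j + 1 by ring, hG]
      push_cast
      ring
    have hL : ((n.descFactorial (i + 1) : ℕ) : ℝ) * n.descFactorial j * (G n / n.factorial) =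
        ((n : ℝ) - i) * ∑ k ∈ Finset.range (j + 1), c k * u k := by
      rw [← ih, hD]
      ring
    -- The shifted sum does not leave the range: its top term `k = j` carries the factor `j - k =
    -- 0`.
    rw [hL, Finset.mul_sum, Finset.sum_congr rfl fun k _ => hstep k, Finset.sum_add_distrib,
      Finset.sum_range_succ', Finset.sum_range_succ (fun k : ℕ =>
        c k * (((j : ℝ) - k) / (i + j + α + 1)) * U (k + 1)), Finset.sum_range_succ', sub_self]
    have h0 : c 0 * ((i + (0 : ℕ) + α + 1) / (i + j + α + 1)) =
        (i + 1).choose 0 * j.choose 0 * Nat.factorial 0 * (G (i + 1) * G j) /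
        (G 0 * G (i + 1 + j)) := by
      have h1 := hG0 0
      have h2 := hG0 (i + j)
      rw [hGij, hG i]
      simp [hc]
      field_simp
    -- Pascal-type recurrence: the two contributions to `U (k + 1)` add up to the coefficient for `i
    -- + 1`.
    have h1 : ∀ k : ℕ, c (k + 1) * ((i + (k + 1 : ℕ) + α + 1) / (i + j + α + 1)) +
        c k * (((j : ℝ) - k) / (i + j + α + 1)) =
        (i + 1).choose (k + 1) * j.choose (k + 1) * (k + 1).factorial * (G (i + 1) * G j) /
        (G (k + 1) * G (i + 1 + j)) := by
      intro k
      have hch : ∀ m : ℕ, (m.choose (k + 1) : ℝ) * (k + 1) = m.choose k * ((m : ℝ) - k) := by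
        intro m
        rcases le_or_gt k m with h | h
        · have := Nat.choose_succ_right_eq m k
          rw [← Nat.cast_sub h]
          exact_mod_cast this
        · rw [Nat.choose_eq_zero_of_lt h, Nat.choose_eq_zero_of_lt (h.trans k.lt_succ_self)]
          simp
      have hi := hch i
      have hj := hch j
      have h2 := hG0 (i + j)
      have h3 := hG0 k
      have h4 := (hpos k).ne'
      simp only [hc]
      rw [hGij, hG i, hG k, Nat.factorial_succ, Nat.choose_succ_succ]
      push_cast
      field_simp
      linear_combination (G i * G j) * (((k : ℝ) + 1) * j.choose (k + 1) * hi -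
        i.choose k * (k + α + 1) * hj)
    have hfin : ∑ k ∈ Finset.range j, ((i + 1).choose (k + 1) * j.choose (k + 1) *
        (k + 1).factorial * (G (i + 1) * G j) / (G (k + 1) * G (i + 1 + j))) * U (k + 1) =
        ∑ k ∈ Finset.range j, c (k + 1) * ((i + (k + 1 : ℕ) + α + 1) / (i + j + α + 1)) *
          U (k + 1) +
        ∑ k ∈ Finset.range j, c k * (((j : ℝ) - k) / (i + j + α + 1)) * U (k + 1) := by
      rw [← Finset.sum_add_distrib]
      refine Finset.sum_congr rfl fun k _ => ?_
      rw [← h1 k]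
      ring
    rw [← h0]
    refine Eq.trans ?_ (congrArg₂ (· + ·) hfin.symm rfl)
    rw [zero_div]
    ring

/-- The product formula for Laguerre polynomials with the same parameter. -/
theorem laguerrePoly_mul_laguerrePoly {α : ℝ} (hα : -1 < α) (n : ℕ) (x y : ℝ) :
    n.factorial / Real.Gamma (n + α + 1) * (laguerrePoly α n x * laguerrePoly α n y) =
      ∑ p ∈ Finset.HasAntidiagonal.antidiagonal n,
        (x * y) ^ p.1 / (p.1.factorial * Real.Gamma (p.1 + α + 1)) *
          laguerrePoly (α + 2 * p.1) p.2 (x + y) := by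
  obtain ⟨G, hGdef⟩ : ∃ G : ℕ → ℝ, ∀ n : ℕ, G n = Real.Gamma (n + α + 1) := ⟨_, fun _ => rfl⟩
  have hpos : ∀ m : ℕ, (0 : ℝ) < m + α + 1 := fun m => by
    have : (0 : ℝ) ≤ m := m.cast_nonneg
    linarith
  have hG0 : ∀ n, G n ≠ 0 := fun n => by
    rw [hGdef]
    exact (Real.Gamma_pos_of_pos (hpos n)).ne'
  have hG : ∀ n : ℕ, G (n + 1) = (n + α + 1) * G n := fun n => by
    rw [hGdef, hGdef, ← Real.Gamma_add_one (hpos n).ne']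
    congr 1
    push_cast
    ring
  have hfac : ∀ m : ℕ, (m.factorial : ℝ) ≠ 0 := fun m => by exact_mod_cast m.factorial_ne_zero
  have hinv : ∀ m j : ℕ, j ≤ m → ((m - j).factorial : ℝ)⁻¹ =
      m.descFactorial j / m.factorial := fun m j h => by
    rw [← Nat.factorial_mul_descFactorial h]
    have h1 := hfac (m - j)
    have h2 : (m.descFactorial j : ℝ) ≠ 0 := by
      exact_mod_cast (Nat.descFactorial_pos.2 h).ne'
    push_cast
    field_simp
  have hLx : ∀ x : ℝ, laguerrePoly α n x = ∑ i ∈ Finset.range (n + 1),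
      (-x) ^ i / (G i * i.factorial) * n.descFactorial i * (G n / n.factorial) := by
    intro x
    rw [laguerrePoly]
    refine Finset.sum_congr rfl fun i hi => ?_
    have h := hinv n i (Nat.lt_succ_iff.1 (Finset.mem_range.1 hi))
    rw [neg_pow x, div_mul_eq_mul_div, mul_assoc ((n - i).factorial : ℝ), div_mul_eq_div_div,
      div_eq_mul_inv _ ((n - i).factorial : ℝ), h]
    simp only [hGdef]
    ring
  -- The factorial identity linearizes the product of the falling factorials of the two expansions.
  -- The range of `k` is extended to `n`, which is harmless as `choose` vanishes beyond `j`.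
  have hLHS : n.factorial / Real.Gamma (n + α + 1) * (laguerrePoly α n x * laguerrePoly α n y) =
      ∑ k ∈ Finset.range (n + 1), ∑ i ∈ Finset.range (n + 1), ∑ j ∈ Finset.range (n + 1),
        ((-x) ^ i / i.factorial * i.choose k) * ((-y) ^ j / j.factorial * j.choose k) *
          (k.factorial / (G k * G (i + j)) *
            (G (n + k) / (n + k).factorial * (n + k).descFactorial (i + j))) := by
    have hk : ∀ i, ∀ j ∈ Finset.range (n + 1),
        (n.descFactorial i : ℝ) * n.descFactorial j * (G n / n.factorial) =
        ∑ k ∈ Finset.range (n + 1), (i.choose k * j.choose k * k.factorial * (G i * G j) /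
        (G k * G (i + j))) * (G (n + k) / (n + k).factorial * (n + k).descFactorial (i + j)) := by
      intro i j hj
      rw [descFactorial_mul_descFactorial_eq_sum hα hG0 hG n i j]
      refine Finset.sum_subset (Finset.range_mono (Finset.mem_range.1 hj)) fun k _ hk => ?_
      rw [Nat.choose_eq_zero_of_lt (n := j) (by simpa using hk)]
      simp
    rw [hLx, hLx, Finset.sum_mul_sum, Finset.mul_sum]
    trans ∑ i ∈ Finset.range (n + 1), ∑ j ∈ Finset.range (n + 1), ∑ k ∈ Finset.range (n + 1),
        ((-x) ^ i / i.factorial * i.choose k) * ((-y) ^ j / j.factorial * j.choose k) *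
          (k.factorial / (G k * G (i + j)) *
            (G (n + k) / (n + k).factorial * (n + k).descFactorial (i + j)))
    · refine Finset.sum_congr rfl fun i _ => ?_
      rw [Finset.mul_sum]
      refine Finset.sum_congr rfl fun j hj => ?_
      trans (-x) ^ i / (G i * i.factorial) * ((-y) ^ j / (G j * j.factorial)) *
        ((n.descFactorial i : ℝ) * n.descFactorial j * (G n / n.factorial))
      · have h1 : (n.factorial : ℝ) / G n * (G n / n.factorial) = 1 := by
          rw [div_mul_div_cancel₀ (hG0 n), div_self (hfac n)]
        rw [← hGdef]
        linear_combination ((-x) ^ i / (G i * i.factorial) * ((-y) ^ j / (G j * j.factorial)) *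
          ((n.descFactorial i : ℝ) * n.descFactorial j * (G n / n.factorial))) * h1
      · rw [hk i j hj, Finset.mul_sum]
        refine Finset.sum_congr rfl fun k _ => ?_
        have h1 : G i * (G i)⁻¹ = 1 := mul_inv_cancel₀ (hG0 i)
        have h2 : G j * (G j)⁻¹ = 1 := mul_inv_cancel₀ (hG0 j)
        simp only [div_eq_mul_inv, mul_inv]
        generalize (G (n + k) * _ * _ : ℝ) = w
        linear_combination ((-x) ^ i * (i.factorial : ℝ)⁻¹ * i.choose k *
          ((-y) ^ j * (j.factorial : ℝ)⁻¹ * j.choose k) * (k.factorial *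
            ((G k)⁻¹ * (G (i + j))⁻¹) * w)) * (G j * (G j)⁻¹ * h1 + h2)
    · rw [Finset.sum_congr rfl fun i _ => Finset.sum_comm, Finset.sum_comm]
  rw [hLHS, Finset.Nat.sum_antidiagonal_eq_sum_range_succ (fun k m =>
    (x * y) ^ k / (k.factorial * Real.Gamma (k + α + 1)) *
          laguerrePoly (α + 2 * k) m (x + y)) n]
  refine Finset.sum_congr rfl fun k hk => ?_
  rw [← hGdef]
  obtain ⟨M, rfl⟩ : ∃ M, n = k + M := ⟨n - k, by have := Finset.mem_range.1 hk; omega⟩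
  -- The binomial coefficients kill `i, j < k`, so the substitution `i = k + a`, `j = k + b` pulls
  -- the factor `(xy)^k` out.
  have hskip : ∀ f : ℕ → ℝ, (∀ i < k, f i = 0) →
      ∑ i ∈ Finset.range (k + M + 1), f i = ∑ a ∈ Finset.range (M + 1), f (k + a) := by
    intro f hf
    rw [add_assoc, Finset.sum_range_add, Finset.sum_eq_zero fun i hi => hf i (Finset.mem_range.1 hi),
      zero_add]
  have hch0 : ∀ i < k, ((i.choose k : ℕ) : ℝ) = 0 := fun i hi => by
    rw [Nat.choose_eq_zero_of_lt hi, Nat.cast_zero]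
  have hch : ∀ a : ℕ, ((k + a).choose k : ℝ) / (k + a).factorial =
      1 / (k.factorial * a.factorial) := fun a => by
    have h := Nat.choose_mul_factorial_mul_factorial (Nat.le_add_right k a)
    rw [Nat.add_sub_cancel_left] at h
    have h1 : (((k + a).choose k : ℕ) : ℝ) * k.factorial * a.factorial = (k + a).factorial := by
      exact_mod_cast h
    rw [div_eq_div_iff (hfac _) (mul_ne_zero (hfac _) (hfac _))]
    linarith
  -- Both sides are `1 / (M - N)!` for `N ≤ M`, and both are zero beyond.
  have hdesc : ∀ N : ℕ, ((k + M + k).descFactorial (k + k + N) : ℝ) / (k + M + k).factorial =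
      M.descFactorial N / M.factorial := by
    intro N
    rcases le_or_gt N M with h | h
    · rw [← hinv _ _ h, ← hinv _ _ (by omega)]
      congr 3
      omega
    · rw [Nat.descFactorial_of_lt h, Nat.descFactorial_of_lt (by omega)]
      simp
  rw [hskip _ fun i hi => by simp [hch0 i hi]]
  have hterm : ∀ a b : ℕ, ((-x) ^ (k + a) / (k + a).factorial * (k + a).choose k) *
      ((-y) ^ (k + b) / (k + b).factorial * (k + b).choose k) *
          (k.factorial / (G k * G (k + a + (k + b))) *
            (G (k + M + k) / (k + M + k).factorial *
              (k + M + k).descFactorial (k + a + (k + b)))) =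
      (x * y) ^ k / (k.factorial * G k) * ((-x) ^ a / a.factorial * ((-y) ^ b / b.factorial) *
        (G (k + M + k) / G (k + k + (a + b)) * (M.descFactorial (a + b) / M.factorial))) := by
    intro a b
    have e1 := hch a
    have e2 := hch b
    have e3 := hdesc (a + b)
    rw [show k + a + (k + b) = k + k + (a + b) by ring, pow_add, pow_add]
    have h3 : (x * y) ^ k = (-x) ^ k * (-y) ^ k := by rw [← mul_pow]; ring
    rw [h3, ← e3]
    trans (-x) ^ k * (-x) ^ a * ((-y) ^ k * (-y) ^ b) * (((k + a).choose k : ℝ) / (k + a).factorial)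
      * (((k + b).choose k : ℝ) / (k + b).factorial) * (k.factorial / (G k * G (k + k + (a + b))) *
            (G (k + M + k) / (k + M + k).factorial *
              (k + M + k).descFactorial (k + k + (a + b))))
    · ring
    rw [e1, e2]
    have aux : ∀ p q s t f fa fb g g₁ g₂ w v : ℝ, f ≠ 0 →
        p * q * (s * t) * (1 / (f * fa)) * (1 / (f * fb)) * (f / (g * g₁) * (g₂ / w * v)) =
        p * s / (f * g) * (q / fa * (t / fb) * (g₂ / g₁ * (v / w))) := by
      intro p q s t f fa fb g g₁ g₂ w v hf
      have h1 : f * f⁻¹ = 1 := mul_inv_cancel₀ hf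
      simp only [div_eq_mul_inv, mul_inv, one_mul]
      linear_combination (p * s * f⁻¹ * g⁻¹ * q * fa⁻¹ * t * fb⁻¹ * g₂ * g₁⁻¹ * v * w⁻¹) * h1
    exact aux _ _ _ _ _ _ _ _ _ _ _ _ (hfac k)
  rw [Finset.sum_congr rfl fun a _ => hskip _ fun j hj => by simp [hch0 j hj],
    Finset.sum_congr rfl fun a _ => Finset.sum_congr rfl fun b _ => hterm a b]
  simp only [← Finset.mul_sum]
  rw [Nat.add_sub_cancel_left]
  congr 1
  rw [laguerrePoly]
  trans ∑ a ∈ Finset.range (M + 1), ∑ b ∈ Finset.range (M + 1 - a),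
    (-x) ^ a / a.factorial * ((-y) ^ b / b.factorial) *
        (G (k + M + k) / G (k + k + (a + b)) * (M.descFactorial (a + b) / M.factorial))
  · refine Finset.sum_congr rfl fun a ha => ?_
    symm
    refine Finset.sum_subset (Finset.range_mono (Nat.sub_le _ _)) fun b _ hb => ?_
    rw [Nat.descFactorial_of_lt (by simp at hb; omega)]
    simp
  -- The remaining factor depends on `a + b` only; summing over `a + b = N` produces `(x + y)^N` by
  -- the binomial theorem.
  rw [← Finset.sum_range_diag_flip]
  refine Finset.sum_congr rfl fun N hN => ?_
  have hNM : N ≤ M := Nat.lt_succ_iff.1 (Finset.mem_range.1 hN)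
  have hadd : (-1) ^ N * (x + y) ^ N / N.factorial =
      ∑ a ∈ Finset.range (N + 1), (-x) ^ a / a.factorial * ((-y) ^ (N - a) / (N - a).factorial) := by
    rw [← mul_pow, show -1 * (x + y) = -x + -y by ring, add_pow, Finset.sum_div]
    refine Finset.sum_congr rfl fun a ha => ?_
    have h := Nat.choose_mul_factorial_mul_factorial (Nat.lt_succ_iff.1 (Finset.mem_range.1 ha))
    have h1 : ((N.choose a : ℕ) : ℝ) * a.factorial * (N - a).factorial = N.factorial := by
      exact_mod_cast h
    have h2 := hfac a
    have h3 := hfac (N - a)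
    rw [← h1]
    have h4 : ((N.choose a : ℕ) : ℝ) ≠ 0 := by
      intro h0
      rw [h0] at h1
      exact hfac N (by rw [← h1]; ring)
    field_simp
  trans (-1) ^ N * (x + y) ^ N / N.factorial *
    (G (k + M + k) / G (k + k + N) * (M.descFactorial N / M.factorial))
  · rw [hadd, Finset.sum_mul]
    refine Finset.sum_congr rfl fun a ha => ?_
    rw [Nat.add_sub_of_le (Nat.lt_succ_iff.1 (Finset.mem_range.1 ha))]
  · rw [← hinv _ _ hNM]
    have e1 : G (k + M + k) = Real.Gamma (M + (α + 2 * k) + 1) := by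
      rw [hGdef]
      congr 1
      push_cast
      ring
    have e2 : G (k + k + N) = Real.Gamma (N + (α + 2 * k) + 1) := by
      rw [hGdef]
      congr 1
      push_cast
      ring
    rw [e1, e2]
    have h1 := hfac (M - N)
    have h2 := hfac N
    rw [← e2]
    have h3 := hG0 (k + k + N)
    field_simp

/-- The Hille–Hardy formula, with the modified Bessel function given by its power series. -/
theorem hasSum_hilleHardy {α r x y b : ℝ} (hα : -1 < α) (hr0 : 0 < r) (hr : r < 1) (hx : 0 ≤ x)
    (hy : 0 ≤ y)
    (hb : HasSum (fun k : ℕ => (x * y * r / (1 - r) ^ 2) ^ k /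
      (k.factorial * Real.Gamma (k + α + 1))) b) :
    HasSum (fun n : ℕ => n.factorial / Real.Gamma (n + α + 1) * r ^ n *
        (laguerrePoly α n x * laguerrePoly α n y))
      ((1 - r) ^ (-(α + 1)) * Real.exp (-((x + y) * (r / (1 - r)))) * b) := by
  have h1r : 0 < 1 - r := by linarith
  have hk : ∀ k : ℕ, -1 < α + 2 * k := fun k => by
    have : (0 : ℝ) ≤ k := k.cast_nonneg
    linarith
  have hG : ∀ k : ℕ, 0 < Real.Gamma (k + α + 1) := fun k => Real.Gamma_pos_of_pos (by
    have : (0 : ℝ) ≤ k := k.cast_nonneg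
    linarith)
  -- The parameter `α + 2k` makes the generating function contribute `(1 - r)^(-2k)`, which is the
  -- denominator in the argument of the Bessel series.
  have hval : ∀ (k : ℕ) (e : ℝ), (r * (x * y)) ^ k / (k.factorial * Real.Gamma (k + α + 1)) *
      ((1 - r) ^ (-(α + 2 * k + 1)) * e) = (1 - r) ^ (-(α + 1)) * e *
        ((x * y * r / (1 - r) ^ 2) ^ k / (k.factorial * Real.Gamma (k + α + 1))) := by
    intro k e
    have e1 : (1 - r) ^ (-(α + 2 * k + 1)) = (1 - r) ^ (-(α + 1)) / ((1 - r) ^ 2) ^ k := by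
      rw [← pow_mul, ← Real.rpow_natCast, ← Real.rpow_sub h1r]
      congr 1
      push_cast
      ring
    rw [e1, div_pow, mul_comm r]
    ring
  -- The dominating family has `-(x + y)` in place of `x + y`; its iterated sums differ only in the
  -- exponential factor, so the same Bessel series makes it summable.
  have hdom := hasSum_antidiagonal_of_dominated
    (f := fun k m => (r * (x * y)) ^ k / (k.factorial * Real.Gamma (k + α + 1)) *
      (r ^ m * laguerrePoly (α + 2 * k) m (x + y)))
    (b := fun k m => (r * (x * y)) ^ k / (k.factorial * Real.Gamma (k + α + 1)) *
      (r ^ m * laguerrePoly (α + 2 * k) m (-(x + y))))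
    (fun k => by
      have h := (hasSum_pow_mul_laguerrePoly (hk k) hr0.le hr (x + y)).mul_left
        ((r * (x * y)) ^ k / (k.factorial * Real.Gamma (k + α + 1)))
      rwa [hval] at h)
    (fun k => by
      have h := (hasSum_pow_mul_laguerrePoly (hk k) hr0.le hr (-(x + y))).mul_left
        ((r * (x * y)) ^ k / (k.factorial * Real.Gamma (k + α + 1)))
      rwa [hval] at h)
    (fun k m => ?_) (hb.mul_left _) (hb.mul_left _).summable
  · refine hdom.congr_fun fun n => ?_
    rw [mul_right_comm, laguerrePoly_mul_laguerrePoly hα, Finset.sum_mul]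
    refine Finset.sum_congr rfl fun p hp => ?_
    have hp : p.1 + p.2 = n := by simpa using hp
    rw [← hp, pow_add, mul_pow r]
    ring
  · have h0 : 0 ≤ (r * (x * y)) ^ k / (k.factorial * Real.Gamma (k + α + 1)) :=
      div_nonneg (by positivity) (mul_nonneg (Nat.cast_nonneg _) (hG k).le)
    rw [abs_mul, abs_mul, abs_of_nonneg h0, abs_of_nonneg (pow_nonneg hr0.le m)]
    exact mul_le_mul_of_nonneg_left (mul_le_mul_of_nonneg_left
      (abs_laguerrePoly_le (hk k) m (add_nonneg hx hy)) (pow_nonneg hr0.le m)) h0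

/-! ### The Poisson integral of the modified Bessel function -/

theorem integrableOn_and_integral_beta {a b : ℝ} (ha : 0 < a) (hb : 0 < b) :
    IntegrableOn (fun p : ℝ => p ^ (a - 1) * (1 - p) ^ (b - 1)) (Ioo 0 1) ∧
    ∫ p in Ioo (0 : ℝ) 1, p ^ (a - 1) * (1 - p) ^ (b - 1) =
      Real.Gamma a * Real.Gamma b / Real.Gamma (a + b) := by
  have hB := ProbabilityTheory.beta_pos ha hb
  have h := ProbabilityTheory.lintegral_betaPDF (α := a) (β := b)
  rw [ProbabilityTheory.lintegral_betaPDF_eq_one ha hb] at h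
  have hm : Measurable fun p : ℝ => 1 / ProbabilityTheory.beta a b * p ^ (a - 1) *
      (1 - p) ^ (b - 1) := by fun_prop
  have hnn : 0 ≤ᵐ[volume.restrict (Ioo (0 : ℝ) 1)] fun p : ℝ =>
      1 / ProbabilityTheory.beta a b * p ^ (a - 1) * (1 - p) ^ (b - 1) := by
    filter_upwards [ae_restrict_mem measurableSet_Ioo] with p hp
    have := hp.1
    have := sub_pos.2 hp.2
    simp only [Pi.zero_apply]
    positivity
  have hi : IntegrableOn (fun p : ℝ => 1 / ProbabilityTheory.beta a b * p ^ (a - 1) *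
      (1 - p) ^ (b - 1)) (Ioo 0 1) := by
    refine ⟨hm.aestronglyMeasurable, ?_⟩
    rw [hasFiniteIntegral_iff_ofReal hnn, ← h]
    exact ENNReal.one_lt_top
  have hI : ∫ p in Ioo (0 : ℝ) 1, 1 / ProbabilityTheory.beta a b * p ^ (a - 1) *
      (1 - p) ^ (b - 1) = 1 := by
    rw [integral_eq_lintegral_of_nonneg_ae hnn hm.aestronglyMeasurable, ← h]
    simp
  have e : (fun p : ℝ => p ^ (a - 1) * (1 - p) ^ (b - 1)) = fun p : ℝ =>
      ProbabilityTheory.beta a b * (1 / ProbabilityTheory.beta a b * p ^ (a - 1) *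
      (1 - p) ^ (b - 1)) := by
    funext p
    field_simp
  rw [e]
  refine ⟨hi.const_mul _, ?_⟩
  rw [integral_const_mul, hI, mul_one, ProbabilityTheory.beta]

theorem image_one_sub_sq_Ioo : (fun u : ℝ => (1 - u) ^ 2) '' Ioo 0 1 = Ioo 0 1 := by
  ext p
  constructor
  · rintro ⟨u, ⟨h0, h1⟩, rfl⟩
    exact ⟨by simp only; nlinarith, by simp only; nlinarith⟩
  · rintro ⟨h0, h1⟩
    refine ⟨1 - √p, ⟨?_, ?_⟩, ?_⟩
    · rw [sub_pos, Real.sqrt_lt' one_pos]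
      simpa using h1
    · have := Real.sqrt_pos.2 h0
      linarith
    · simp only [sub_sub_cancel, Real.sq_sqrt h0.le]

/-- The even moments of the weight `(u (2 - u))^(β - 1)` about `1`. -/
theorem integrableOn_and_integral_moment {β : ℝ} (hβ : 0 < β) (k : ℕ) :
    IntegrableOn (fun u : ℝ => (1 - u) ^ (2 * k) * (u * (2 - u)) ^ (β - 1)) (Ioo 0 1) ∧
    ∫ u in Ioo (0 : ℝ) 1, (1 - u) ^ (2 * k) * (u * (2 - u)) ^ (β - 1) =
      Real.Gamma (k + 1 / 2) * Real.Gamma β / (2 * Real.Gamma (k + β + 1 / 2)) := by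
  have ha : (0 : ℝ) < k + 1 / 2 := by positivity
  obtain ⟨h1, h2⟩ := integrableOn_and_integral_beta ha hβ
  -- The substitution `p = (1 - u)²`, for which `1 - p = u (2 - u)`, turns the moment into a beta
  -- integral.
  have hd : ∀ u ∈ Ioo (0 : ℝ) 1, HasDerivWithinAt (fun u : ℝ => (1 - u) ^ 2) (-2 * (1 - u))
      (Ioo 0 1) u := fun u _ => by
    have h := ((hasDerivAt_id u).const_sub 1).fun_pow 2
    exact (h.congr_deriv (by simp)).hasDerivWithinAt
  have hinj : InjOn (fun u : ℝ => (1 - u) ^ 2) (Ioo 0 1) := by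
    intro u hu v hv h
    have h3 : 1 - u = 1 - v := by
      rwa [pow_left_inj₀ (by linarith [hu.2]) (by linarith [hv.2]) two_ne_zero] at h
    linarith
  have hcongr : ∀ u ∈ Ioo (0 : ℝ) 1, |(-2 * (1 - u))| •
      (((1 - u) ^ 2) ^ ((k : ℝ) + 1 / 2 - 1) * (1 - (1 - u) ^ 2) ^ (β - 1)) =
      2 * ((1 - u) ^ (2 * k) * (u * (2 - u)) ^ (β - 1)) := by
    intro u hu
    have hu1 : 0 < 1 - u := by linarith [hu.2]
    have e1 : ((1 - u) ^ 2) ^ ((k : ℝ) + 1 / 2 - 1) = (1 - u) ^ (2 * k) / (1 - u) := by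
      rw [← Real.rpow_natCast, ← Real.rpow_mul hu1.le, ← Real.rpow_natCast _ (2 * k),
        ← Real.rpow_sub_one hu1.ne']
      congr 1
      push_cast
      ring
    have e2 : 1 - (1 - u) ^ 2 = u * (2 - u) := by ring
    rw [e1, e2, abs_mul, abs_neg, abs_two, abs_of_pos hu1, smul_eq_mul]
    field_simp
  have hi := (integrableOn_image_iff_integrableOn_abs_deriv_smul measurableSet_Ioo hd hinj
    (fun p : ℝ => p ^ ((k : ℝ) + 1 / 2 - 1) * (1 - p) ^ (β - 1))).1
    (by rwa [image_one_sub_sq_Ioo])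
  have hI := integral_image_eq_integral_abs_deriv_smul measurableSet_Ioo hd hinj
    (fun p : ℝ => p ^ ((k : ℝ) + 1 / 2 - 1) * (1 - p) ^ (β - 1))
  rw [image_one_sub_sq_Ioo, h2, setIntegral_congr_fun measurableSet_Ioo hcongr,
    integral_const_mul] at hI
  have hi2 := (integrableOn_congr_fun hcongr measurableSet_Ioo).1 hi
  refine ⟨(hi2.const_mul (1 / 2)).congr (Filter.Eventually.of_forall fun u => by simp), ?_⟩
  have e : (k : ℝ) + β + 1 / 2 = k + 1 / 2 + β := by ring
  rw [e, div_mul_eq_div_div_swap, hI]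
  ring

/-- The integral `∫_0^1 (e^{-zu} + e^{-z(2-u)}) (u (2 - u))^(β - 1) du`, a multiple of
`z^{1/2-β} e^{-z} I_{β-1/2}(z)`. -/
def poissonIntegral (β z : ℝ) : ℝ :=
  ∫ u in Ioo (0 : ℝ) 1,
    (Real.exp (-(z * u)) + Real.exp (-(z * (2 - u)))) * (u * (2 - u)) ^ (β - 1)

theorem integrableOn_weight {β : ℝ} (hβ : 0 < β) :
    IntegrableOn (fun u : ℝ => (u * (2 - u)) ^ (β - 1)) (Ioo 0 1) := by
  simpa using (integrableOn_and_integral_moment hβ 0).1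

/-- Poisson's integral for the modified Bessel function. -/
theorem hasSum_poissonIntegral {β : ℝ} (hβ : 0 < β) (z : ℝ) :
    HasSum (fun k : ℕ => (z ^ 2 / 4) ^ k / (k.factorial * Real.Gamma (k + β + 1 / 2)))
      (Real.exp z * (1 / (√Real.pi * Real.Gamma β) * poissonIntegral β z)) := by
  have hGβ := Real.Gamma_pos_of_pos hβ
  have hpi : 0 < √Real.pi := Real.sqrt_pos.2 Real.pi_pos
  set F : ℕ → ℝ → ℝ := fun k u =>
    z ^ (2 * k) / (2 * k).factorial * ((1 - u) ^ (2 * k) * (u * (2 - u)) ^ (β - 1)) with hF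
  have hnorm : ∀ k u, u ∈ Ioo (0 : ℝ) 1 → ‖F k u‖ = F k u := by
    intro k u hu
    have h1 := hu.1
    have h2 : 0 < 2 - u := by linarith [hu.2]
    refine Real.norm_of_nonneg ?_
    have h3 : 0 ≤ z ^ (2 * k) := by rw [pow_mul]; positivity
    have h4 : 0 ≤ (1 - u) ^ (2 * k) := by rw [pow_mul]; positivity
    have h5 : 0 ≤ (u * (2 - u)) ^ (β - 1) := by positivity
    exact mul_nonneg (div_nonneg h3 (Nat.cast_nonneg _)) (mul_nonneg h4 h5)
  have hFi : ∀ k, Integrable (F k) (volume.restrict (Ioo 0 1)) := fun k =>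
    (integrableOn_and_integral_moment hβ k).1.const_mul _
  have hint : ∀ k, ∫ u in Ioo (0 : ℝ) 1, ‖F k u‖ = ∫ u in Ioo (0 : ℝ) 1, F k u := fun k =>
    setIntegral_congr_fun measurableSet_Ioo (hnorm k)
  -- Since `(1 - u)^(2k) ≤ 1`, the `k`-th norm is at most a term of the series of `cosh z` times the
  -- total mass of the weight.
  have hsum : Summable fun k => ∫ u in Ioo (0 : ℝ) 1, ‖F k u‖ := by
    refine Summable.of_nonneg_of_le (fun k => integral_nonneg fun u => norm_nonneg _) (fun k => ?_)
      ((Real.hasSum_cosh z).summable.mul_right (∫ u in Ioo (0 : ℝ) 1, (u * (2 - u)) ^ (β - 1)))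
    rw [hint, ← integral_const_mul]
    refine setIntegral_mono_on (hFi k) ((integrableOn_weight hβ).const_mul _) measurableSet_Ioo ?_
    intro u hu
    have h1 := hu.1
    have h2 : 0 < 2 - u := by linarith [hu.2]
    have h3 : 0 ≤ z ^ (2 * k) := by rw [pow_mul]; positivity
    refine mul_le_mul_of_nonneg_left ?_ (div_nonneg h3 (Nat.cast_nonneg _))
    refine mul_le_of_le_one_left (by positivity) (pow_le_one₀ ?_ ?_) <;> linarith [hu.2]
  have hs := hasSum_integral_of_summable_integral_norm hFi hsum
  -- The two exponentials of the Poisson integral combine to `2 e^(-z) cosh (z (1 - u))`.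
  have hval : ∫ u in Ioo (0 : ℝ) 1, ∑' k, F k u = Real.exp z * poissonIntegral β z / 2 := by
    rw [poissonIntegral, ← integral_const_mul, ← integral_div]
    refine setIntegral_congr_fun measurableSet_Ioo fun u _ => ?_
    have h := ((Real.hasSum_cosh (z * (1 - u))).mul_right ((u * (2 - u)) ^ (β - 1))).tsum_eq
    have e : ∀ k, F k u = (z * (1 - u)) ^ (2 * k) / (2 * k).factorial *
        (u * (2 - u)) ^ (β - 1) := fun k => by
      simp only [hF, mul_pow]
      ring
    simp only [e]
    rw [h, Real.cosh_eq, ← mul_assoc, mul_add, ← Real.exp_add, ← Real.exp_add,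
      show z + -(z * u) = z * (1 - u) by ring, show z + -(z * (2 - u)) = -(z * (1 - u)) by ring]
    ring
  rw [hval] at hs
  have hs2 := hs.mul_left (2 / (√Real.pi * Real.Gamma β))
  have e1 : 2 / (√Real.pi * Real.Gamma β) * (Real.exp z * poissonIntegral β z / 2) =
      Real.exp z * (1 / (√Real.pi * Real.Gamma β) * poissonIntegral β z) := by ring
  rw [e1] at hs2
  refine hs2.congr_fun fun k => ?_
  have hk : (0 : ℝ) ≤ k := k.cast_nonneg
  have hG : Real.Gamma (k + β + 1 / 2) ≠ 0 := (Real.Gamma_pos_of_pos (by linarith)).ne'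
  simp only [hF]
  rw [integral_const_mul, (integrableOn_and_integral_moment hβ k).2, Real.Gamma_nat_add_half]
  -- The double factorial cancels against the one in `Γ(k + 1/2)`, which leaves `4^k k!` in the
  -- denominator.
  have hdf : ((2 * k).factorial : ℝ) = 2 ^ k * k.factorial * ((2 * k - 1).doubleFactorial : ℕ) := by
    rcases k with _ | k
    · simp
    · have h := Nat.factorial_eq_mul_doubleFactorial (2 * k + 1)
      rw [show 2 * (k + 1) = 2 * k + 1 + 1 by ring, h,
        show 2 * k + 1 + 1 = 2 * (k + 1) by ring, Nat.doubleFactorial_two_mul]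
      push_cast
      rfl
  have h1 : ((2 * k - 1).doubleFactorial : ℝ) ≠ 0 := by
    exact_mod_cast (Nat.doubleFactorial_pos _).ne'
  have h2 : (k.factorial : ℝ) ≠ 0 := by exact_mod_cast k.factorial_ne_zero
  rw [hdf, pow_mul, div_pow, show (4 : ℝ) = 2 * 2 by norm_num, mul_pow]
  field_simp

/-! ### The exponentially scaled Bessel function -/

theorem exists_rpow_mul_exp_neg_le {p : ℝ} (hp : 0 ≤ p) :
    ∃ C > 0, ∀ z, 0 ≤ z → z ^ p * Real.exp (-z) ≤ C := by
  obtain ⟨n, hn⟩ := exists_nat_ge p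
  have hf : (1 : ℝ) ≤ n.factorial := by exact_mod_cast n.factorial_pos
  refine ⟨n.factorial, by positivity, fun z hz => ?_⟩
  rw [Real.exp_neg, ← div_eq_mul_inv, div_le_iff₀ (Real.exp_pos z)]
  rcases le_total z 1 with h | h
  · calc z ^ p ≤ 1 := Real.rpow_le_one hz h hp
      _ ≤ n.factorial * Real.exp z :=
        one_le_mul_of_one_le_of_one_le hf (Real.one_le_exp hz)
  · calc z ^ p ≤ z ^ n := by
          rw [← Real.rpow_natCast]
          exact Real.rpow_le_rpow_of_exponent_le h hn
      _ ≤ n.factorial * Real.exp z := by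
          have := Real.pow_div_factorial_le_exp z hz n
          rwa [div_le_iff₀ (by positivity), mul_comm] at this

/-- Half of the exponential absorbs the linear factor, because `v ≤ e^(v/2)`. This trades a
derivative of the Poisson integral for its value at half the argument. -/
theorem mul_exp_neg_le_exp_neg_half (v : ℝ) : v * Real.exp (-v) ≤ Real.exp (-(v / 2)) := by
  have h : v ≤ Real.exp (v / 2) := by
    rcases le_total v 0 with h | h
    · exact h.trans (Real.exp_pos _).le
    · have := Real.quadratic_le_exp_of_nonneg (x := v / 2) (by linarith)
      nlinarith [sq_nonneg (v - 2)]
  calc v * Real.exp (-v) ≤ Real.exp (v / 2) * Real.exp (-v) :=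
        mul_le_mul_of_nonneg_right h (Real.exp_pos _).le
    _ = Real.exp (-(v / 2)) := by
        rw [← Real.exp_add]
        congr 1
        ring

theorem weight_nonneg {β u : ℝ} (hu : u ∈ Ioo (0 : ℝ) 1) : 0 ≤ (u * (2 - u)) ^ (β - 1) := by
  have h1 := hu.1
  have h2 : 0 < 2 - u := by linarith [hu.2]
  positivity

theorem integrableOn_poissonIntegral {β z : ℝ} (hβ : 0 < β) (hz : 0 ≤ z) :
    IntegrableOn (fun u : ℝ => (Real.exp (-(z * u)) + Real.exp (-(z * (2 - u)))) *
      (u * (2 - u)) ^ (β - 1)) (Ioo 0 1) := by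
  refine Integrable.bdd_mul (c := 2) (integrableOn_weight hβ)
    (by fun_prop) ?_
  filter_upwards [ae_restrict_mem measurableSet_Ioo] with u hu
  have h1 : Real.exp (-(z * u)) ≤ 1 := Real.exp_le_one_iff.2 (by nlinarith [hu.1])
  have h2 : Real.exp (-(z * (2 - u))) ≤ 1 := Real.exp_le_one_iff.2 (by nlinarith [hu.2])
  rw [Real.norm_of_nonneg (by positivity)]
  linarith

theorem poissonIntegral_nonneg (β z : ℝ) : 0 ≤ poissonIntegral β z :=
  setIntegral_nonneg measurableSet_Ioo fun _ hu =>
    mul_nonneg (by positivity) (weight_nonneg hu)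

/-- The derivative of `poissonIntegral`. -/
def poissonIntegralDeriv (β z : ℝ) : ℝ :=
  ∫ u in Ioo (0 : ℝ) 1, (-(u * Real.exp (-(z * u))) - (2 - u) * Real.exp (-(z * (2 - u)))) *
    (u * (2 - u)) ^ (β - 1)

theorem hasDerivAt_poissonIntegral {β z : ℝ} (hβ : 0 < β) (hz : 0 < z) :
    HasDerivAt (poissonIntegral β) (poissonIntegralDeriv β z) z := by
  refine (hasDerivAt_integral_of_dominated_loc_of_deriv_le (𝕜 := ℝ)
    (F := fun z u => (Real.exp (-(z * u)) + Real.exp (-(z * (2 - u)))) * (u * (2 - u)) ^ (β - 1))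
    (F' := fun z u => (-(u * Real.exp (-(z * u))) - (2 - u) * Real.exp (-(z * (2 - u)))) *
      (u * (2 - u)) ^ (β - 1)) (bound := fun u => 2 * (u * (2 - u)) ^ (β - 1))
    (Ioi_mem_nhds hz) ?_ (integrableOn_poissonIntegral hβ hz.le) ?_ ?_
    ((integrableOn_weight hβ).const_mul 2) ?_).2
  · exact Filter.Eventually.of_forall fun z => by fun_prop
  · fun_prop
  · filter_upwards [ae_restrict_mem measurableSet_Ioo] with u hu v hv
    have hv : 0 < v := hv
    have h1 : Real.exp (-(v * u)) ≤ 1 := Real.exp_le_one_iff.2 (by nlinarith [hu.1])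
    have h2 : Real.exp (-(v * (2 - u))) ≤ 1 := Real.exp_le_one_iff.2 (by nlinarith [hu.2])
    have h3 := Real.exp_pos (-(v * u))
    have h4 := Real.exp_pos (-(v * (2 - u)))
    rw [norm_mul, Real.norm_of_nonneg (weight_nonneg hu)]
    refine mul_le_mul_of_nonneg_right ?_ (weight_nonneg hu)
    rw [Real.norm_eq_abs, abs_le]
    constructor <;> nlinarith [hu.1, hu.2]
  · refine Filter.Eventually.of_forall fun u v _ => ?_
    have h1 : HasDerivAt (fun z : ℝ => Real.exp (-(z * u))) (Real.exp (-(v * u)) * -u) v := by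
      simpa using ((hasDerivAt_id v).mul_const u).fun_neg.exp
    have h2 : HasDerivAt (fun z : ℝ => Real.exp (-(z * (2 - u))))
        (Real.exp (-(v * (2 - u))) * -(2 - u)) v := by
      have := ((hasDerivAt_id v).mul_const (2 - u)).fun_neg.exp
      simpa using this
    exact ((h1.add h2).mul_const _).congr_deriv (by ring)

/-- Differentiation brings down `u` or `2 - u`; together with `z` this is the exponent itself, which
half of the exponential absorbs. -/
theorem abs_mul_poissonIntegralDeriv_le {β z : ℝ} (hβ : 0 < β) (hz : 0 < z) :
    |z * poissonIntegralDeriv β z| ≤ poissonIntegral β (z / 2) := by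
  rw [poissonIntegralDeriv, ← integral_const_mul, ← Real.norm_eq_abs]
  refine norm_integral_le_of_norm_le (integrableOn_poissonIntegral hβ (by positivity)) ?_
  filter_upwards [ae_restrict_mem measurableSet_Ioo] with u hu
  have h1 := mul_exp_neg_le_exp_neg_half (z * u)
  have h2 := mul_exp_neg_le_exp_neg_half (z * (2 - u))
  have h3 : 0 < z * u * Real.exp (-(z * u)) := by have := hu.1; positivity
  have h4 : 0 < z * (2 - u) * Real.exp (-(z * (2 - u))) := by
    have : 0 < 2 - u := by linarith [hu.2]
    positivity
  rw [← mul_assoc, norm_mul, Real.norm_of_nonneg (weight_nonneg hu)]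
  refine mul_le_mul_of_nonneg_right ?_ (weight_nonneg hu)
  rw [show z / 2 * u = z * u / 2 by ring, show z / 2 * (2 - u) = z * (2 - u) / 2 by ring,
    Real.norm_eq_abs, abs_le]
  constructor <;> nlinarith

theorem two_sub_rpow_le {β u : ℝ} (hu : u ∈ Ioo (0 : ℝ) 1) (hβ : 0 < β) :
    (2 - u) ^ (β - 1) ≤ 2 ^ β := by
  have h1 : 1 ≤ 2 - u := by linarith [hu.2]
  calc (2 - u) ^ (β - 1) ≤ (2 - u) ^ β := Real.rpow_le_rpow_of_exponent_le h1 (by linarith)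
    _ ≤ 2 ^ β := Real.rpow_le_rpow (by linarith) (by linarith [hu.1]) hβ.le

theorem integrableOn_rpow_mul_exp_neg {a z : ℝ} (ha : 0 < a) (hz : 0 < z) :
    IntegrableOn (fun u : ℝ => u ^ (a - 1) * Real.exp (-(z * u))) (Ioi 0) := by
  have h := integrableOn_rpow_mul_exp_neg_mul_rpow (p := 1) (s := a - 1) (b := z) (by linarith)
    one_pos hz
  simpa using h

/-- Both exponentials are at most `e^(-zu)` and `(2 - u)^(β-1)` is bounded, so a Gamma integral over
the half-line dominates. This is the sharp order for large `z`. -/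
theorem poissonIntegral_le {β z : ℝ} (hβ : 0 < β) (hz : 0 < z) :
    poissonIntegral β z ≤ 2 * 2 ^ β * ((1 / z) ^ β * Real.Gamma β) := by
  rw [← Real.integral_rpow_mul_exp_neg_mul_Ioi hβ hz, ← integral_const_mul]
  have hi : IntegrableOn (fun u : ℝ => 2 * 2 ^ β * (u ^ (β - 1) * Real.exp (-(z * u)))) (Ioi 0) :=
    (integrableOn_rpow_mul_exp_neg hβ hz).const_mul (2 * 2 ^ β)
  refine (setIntegral_mono_on (integrableOn_poissonIntegral hβ hz.le)
    (hi.mono_set Ioo_subset_Ioi_self) measurableSet_Ioo fun u hu => ?_).trans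
    (setIntegral_mono_set hi ?_ (Filter.Eventually.of_forall Ioo_subset_Ioi_self))
  · have h0 := hu.1
    have h1 : Real.exp (-(z * (2 - u))) ≤ Real.exp (-(z * u)) :=
      Real.exp_le_exp.2 (by nlinarith [hu.2])
    rw [Real.mul_rpow hu.1.le (by linarith [hu.2])]
    calc _ ≤ (2 * Real.exp (-(z * u))) * (u ^ (β - 1) * 2 ^ β) := by
          refine mul_le_mul (by linarith) ?_ (mul_nonneg (by positivity)
            (Real.rpow_nonneg (by linarith [hu.2]) _)) (by positivity)
          exact mul_le_mul_of_nonneg_left (two_sub_rpow_le hu hβ) (by positivity)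
      _ = _ := by ring
  · filter_upwards [ae_restrict_mem measurableSet_Ioi] with u hu
    have : 0 < u := hu
    simp only [Pi.zero_apply]
    positivity

theorem poissonIntegral_le_zero {β z : ℝ} (hβ : 0 < β) (hz : 0 ≤ z) :
    poissonIntegral β z ≤ 2 * ∫ u in Ioo (0 : ℝ) 1, (u * (2 - u)) ^ (β - 1) := by
  rw [← integral_const_mul]
  refine setIntegral_mono_on (integrableOn_poissonIntegral hβ hz)
    ((integrableOn_weight hβ).const_mul 2) measurableSet_Ioo fun u hu => ?_
  have h1 : Real.exp (-(z * u)) ≤ 1 := Real.exp_le_one_iff.2 (by nlinarith [hu.1])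
  have h2 : Real.exp (-(z * (2 - u))) ≤ 1 := Real.exp_le_one_iff.2 (by nlinarith [hu.2])
  exact mul_le_mul_of_nonneg_right (by linarith) (weight_nonneg hu)

/-- The Gamma integral gives the bound when the minimum is `1`, the total mass of the weight when it
is `z^β`. -/
theorem exists_rpow_mul_poissonIntegral_le {β : ℝ} (hβ : 0 < β) :
    ∃ C > 0, ∀ z > 0, z ^ β * poissonIntegral β z ≤ C * min 1 (z ^ β) := by
  have hG := Real.Gamma_pos_of_pos hβ
  set W := ∫ u in Ioo (0 : ℝ) 1, (u * (2 - u)) ^ (β - 1)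
  have hW : 0 ≤ W := setIntegral_nonneg measurableSet_Ioo fun _ hu => weight_nonneg hu
  refine ⟨2 * 2 ^ β * Real.Gamma β + 2 * W, by positivity, fun z hz => ?_⟩
  have hzβ : 0 < z ^ β := by positivity
  rcases min_cases 1 (z ^ β) with ⟨h, -⟩ | ⟨h, -⟩
  · rw [h, mul_one]
    calc z ^ β * poissonIntegral β z
        ≤ z ^ β * (2 * 2 ^ β * ((1 / z) ^ β * Real.Gamma β)) :=
          mul_le_mul_of_nonneg_left (poissonIntegral_le hβ hz) hzβ.le
      _ = 2 * 2 ^ β * Real.Gamma β := by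
          rw [Real.div_rpow zero_le_one hz.le, Real.one_rpow]
          field_simp
      _ ≤ _ := by linarith
  · rw [h, mul_comm]
    refine mul_le_mul_of_nonneg_right ((poissonIntegral_le_zero hβ hz.le).trans ?_) hzβ.le
    have : 0 ≤ 2 * 2 ^ β * Real.Gamma β := by positivity
    linarith

/-- The constant `1 / (√π 2^{β-1/2} Γ(β))`. -/
def scaledBesselConst (β : ℝ) : ℝ := 1 / (√Real.pi * 2 ^ (β - 1 / 2) * Real.Gamma β)

/-- The function `√z e^{-z} I_{β-1/2}(z)`. -/
def scaledBessel (β z : ℝ) : ℝ :=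
  scaledBesselConst β * (z ^ β * poissonIntegral β z)

/-- The derivative of `scaledBessel` on the positive half-line. -/
def scaledBesselDeriv (β z : ℝ) : ℝ :=
  scaledBesselConst β *
    (β / z * (z ^ β * poissonIntegral β z) + z ^ β * poissonIntegralDeriv β z)

theorem scaledBesselConst_pos {β : ℝ} (hβ : 0 < β) :
    0 < scaledBesselConst β := by
  rw [scaledBesselConst]
  have := Real.Gamma_pos_of_pos hβ
  have := Real.sqrt_pos.2 Real.pi_pos
  positivity

theorem hasDerivAt_scaledBessel {β z : ℝ} (hβ : 0 < β) (hz : 0 < z) :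
    HasDerivAt (scaledBessel β) (scaledBesselDeriv β z) z := by
  have h := ((Real.hasDerivAt_rpow_const (p := β) (Or.inl hz.ne')).mul
    (hasDerivAt_poissonIntegral hβ hz)).const_mul
      (scaledBesselConst β)
  refine h.congr_deriv ?_
  rw [Real.rpow_sub_one hz.ne', scaledBesselDeriv]
  ring

theorem scaledBessel_nonneg {β z : ℝ} (hβ : 0 < β) (hz : 0 < z) : 0 ≤ scaledBessel β z :=
  mul_nonneg (scaledBesselConst_pos hβ).le
    (mul_nonneg (Real.rpow_nonneg hz.le _) (poissonIntegral_nonneg _ _))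

/-- The operator `z d/dz` preserves the bound: on `z^β` it acts as multiplication by `β`, and on the
Poisson integral it costs a halving of `z`, hence a factor `2^β`. -/
theorem exists_scaledBessel_le {β : ℝ} (hβ : 0 < β) :
    ∃ C > 0, ∀ z > 0, scaledBessel β z ≤ C * min 1 (z ^ β) ∧
      |z * scaledBesselDeriv β z| ≤ C * min 1 (z ^ β) := by
  obtain ⟨C, hC, h⟩ := exists_rpow_mul_poissonIntegral_le hβ
  set c := scaledBesselConst β with hc
  have hc0 : 0 < c := scaledBesselConst_pos hβ
  have h2β : (1 : ℝ) ≤ 2 ^ β := Real.one_le_rpow one_le_two hβ.le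
  refine ⟨c * C * (1 + β + 2 ^ β), by positivity, fun z hz => ?_⟩
  have hm : 0 < min 1 (z ^ β) := lt_min one_pos (by positivity)
  have hcCm : 0 < c * C * min 1 (z ^ β) := by positivity
  have hP : z ^ β * poissonIntegral β z ≤ C * min 1 (z ^ β) := h z hz
  have hP0 : 0 ≤ z ^ β * poissonIntegral β z :=
    mul_nonneg (Real.rpow_nonneg hz.le _) (poissonIntegral_nonneg _ _)
  have hF : scaledBessel β z ≤ c * C * min 1 (z ^ β) := by
    rw [scaledBessel, mul_assoc]
    exact mul_le_mul_of_nonneg_left hP hc0.le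
  constructor
  · nlinarith
  · have e1 : z * scaledBesselDeriv β z =
        β * scaledBessel β z + c * (z ^ β * (z * poissonIntegralDeriv β z)) := by
      rw [scaledBesselDeriv, scaledBessel, ← hc]
      field_simp
    have e2 : |z ^ β * (z * poissonIntegralDeriv β z)| ≤ 2 ^ β * (C * min 1 (z ^ β)) := by
      rw [abs_mul, abs_of_nonneg (Real.rpow_nonneg hz.le _)]
      calc z ^ β * |z * poissonIntegralDeriv β z| ≤ z ^ β * poissonIntegral β (z / 2) :=
            mul_le_mul_of_nonneg_left (abs_mul_poissonIntegralDeriv_le hβ hz)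
              (Real.rpow_nonneg hz.le _)
        _ = 2 ^ β * ((z / 2) ^ β * poissonIntegral β (z / 2)) := by
            rw [Real.div_rpow hz.le zero_le_two]
            field_simp
        _ ≤ 2 ^ β * (C * min 1 ((z / 2) ^ β)) :=
            mul_le_mul_of_nonneg_left (h _ (by positivity)) (by positivity)
        _ ≤ 2 ^ β * (C * min 1 (z ^ β)) := by
            gcongr
            linarith
    rw [e1]
    refine (abs_add_le _ _).trans ?_
    rw [abs_mul, abs_mul, abs_of_pos hβ, abs_of_pos hc0, abs_of_nonneg (scaledBessel_nonneg hβ hz)]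
    have h3 := mul_le_mul_of_nonneg_left hF hβ.le
    have h4 := mul_le_mul_of_nonneg_left e2 hc0.le
    nlinarith

/-- The left side is the limit of the scaled Bessel function at infinity: by Laplace's method `z^β`
times the Poisson integral tends to `2^(β-1) Γ(β)`. -/
theorem scaledBesselConst_mul {β : ℝ} (hβ : 0 < β) :
    scaledBesselConst β * (2 ^ (β - 1) * Real.Gamma β) =
      1 / √(2 * Real.pi) := by
  have hG := (Real.Gamma_pos_of_pos hβ).ne'
  have hpi := (Real.sqrt_pos.2 Real.pi_pos).ne'
  have e : (2 : ℝ) ^ (β - 1 / 2) = 2 ^ (β - 1) * √2 := by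
    rw [Real.sqrt_eq_rpow, ← Real.rpow_add two_pos]
    congr 1
    ring
  rw [scaledBesselConst, e, Real.sqrt_mul zero_le_two]
  have h2 : (2 : ℝ) ^ (β - 1) ≠ 0 := by positivity
  have h3 : √(2 : ℝ) ≠ 0 := by positivity
  field_simp

/-- Freezing the slowly varying factor of the weight at `u = 0`. For `u < 1` this is the mean value
inequality on `[1, 2]`; for `u ≥ 1` the indicator vanishes and the constant `2^(β-1)` is at most
`2^(β-1) u`. The cut-off lets the main term be integrated over the whole half-line. -/
theorem exists_abs_two_sub_rpow_sub_le {β : ℝ} (hβ : 0 < β) :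
    ∃ C > 0, ∀ u > 0, |(Ioo (0 : ℝ) 1).indicator (fun u => (2 - u) ^ (β - 1)) u - 2 ^ (β - 1)| ≤
      C * u := by
  refine ⟨|β - 1| * 2 ^ β + 2 ^ (β - 1), by positivity, fun u hu => ?_⟩
  have hp : (0 : ℝ) < 2 ^ (β - 1) := by positivity
  by_cases h : u < 1
  · rw [indicator_of_mem (show u ∈ Ioo (0 : ℝ) 1 from ⟨hu, h⟩)]
    have hL := (convex_Icc (1 : ℝ) 2).norm_image_sub_le_of_norm_hasDerivWithin_le
      (f := fun v : ℝ => v ^ (β - 1)) (f' := fun v => (β - 1) * v ^ (β - 1 - 1))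
      (C := |β - 1| * 2 ^ β) (x := 2) (y := 2 - u)
      (fun v hv => (Real.hasDerivAt_rpow_const (Or.inl (by linarith [hv.1]))).hasDerivWithinAt)
      (fun v hv => ?_) (by norm_num) ⟨by linarith, by linarith⟩
    · rw [Real.norm_eq_abs, Real.norm_eq_abs, show 2 - u - 2 = -u by ring, abs_neg,
        abs_of_pos hu] at hL
      refine hL.trans (mul_le_mul_of_nonneg_right ?_ hu.le)
      linarith
    · rw [norm_mul, Real.norm_eq_abs, Real.norm_of_nonneg (Real.rpow_nonneg (by linarith [hv.1]) _)]
      refine mul_le_mul_of_nonneg_left ?_ (abs_nonneg _)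
      calc v ^ (β - 1 - 1) ≤ v ^ β := Real.rpow_le_rpow_of_exponent_le hv.1 (by linarith)
        _ ≤ 2 ^ β := Real.rpow_le_rpow (by linarith [hv.1]) hv.2 hβ.le
  · rw [indicator_of_notMem fun h' => h h'.2, zero_sub, abs_neg, abs_of_pos hp]
    have h1 : 1 ≤ u := not_lt.1 h
    have : 0 ≤ |β - 1| * 2 ^ β := by positivity
    nlinarith

/-- Watson's lemma with one term. The frozen weight gives the limit exactly, the error `O(u)` gains
one power of `1/z` in the Gamma integral, and the second exponential contributes only `O(e^(-z))`.
-/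
theorem exists_abs_scaledBessel_sub_le {β : ℝ} (hβ : 0 < β) :
    ∃ C > 0, ∀ z > 0, |scaledBessel β z - 1 / √(2 * Real.pi)| ≤ C / z := by
  obtain ⟨A, hA, hAb⟩ := exists_abs_two_sub_rpow_sub_le hβ
  obtain ⟨B, hB, hBb⟩ := exists_rpow_mul_exp_neg_le (p := β + 1) (by linarith)
  have hc0 := scaledBesselConst_pos hβ
  rw [← scaledBesselConst_mul hβ]
  set c := scaledBesselConst β with hc
  set W := ∫ u in Ioo (0 : ℝ) 1, (u * (2 - u)) ^ (β - 1) with hWd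
  have hW : 0 ≤ W := setIntegral_nonneg measurableSet_Ioo fun _ hu => weight_nonneg hu
  have hG1 : 0 < Real.Gamma (β + 1) := Real.Gamma_pos_of_pos (by linarith)
  refine ⟨c * (A * Real.Gamma (β + 1) + B * W), by positivity, fun z hz => ?_⟩
  have hzβ : 0 < z ^ β := by positivity
  have hi1 : IntegrableOn (fun u : ℝ => u ^ (β - 1) * Real.exp (-(z * u))) (Ioi 0) :=
    integrableOn_rpow_mul_exp_neg hβ hz
  have hib : IntegrableOn (fun u : ℝ => u ^ (β + 1 - 1) * Real.exp (-(z * u))) (Ioi 0) :=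
    integrableOn_rpow_mul_exp_neg (by linarith) hz
  -- `I₁` below carries the error of replacing `q` by its value `2^(β-1)` at the origin, and `I₂`
  -- the exponential `e^(-z(2-u))`.
  set q : ℝ → ℝ := (Ioo (0 : ℝ) 1).indicator (fun u => (2 - u) ^ (β - 1)) with hq
  have hqm : Measurable q := Measurable.indicator (by fun_prop) measurableSet_Ioo
  have hdb : ∀ u ∈ Ioi (0 : ℝ), ‖u ^ (β - 1) * Real.exp (-(z * u)) * (q u - 2 ^ (β - 1))‖ ≤
      A * (u ^ (β + 1 - 1) * Real.exp (-(z * u))) := fun u hu => by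
    have hu : 0 < u := hu
    rw [norm_mul, Real.norm_of_nonneg (by positivity), Real.norm_eq_abs]
    calc _ ≤ u ^ (β - 1) * Real.exp (-(z * u)) * (A * u) :=
          mul_le_mul_of_nonneg_left (hAb u hu) (by positivity)
      _ = _ := by
          rw [show β + 1 - 1 = β - 1 + 1 by ring, Real.rpow_add_one hu.ne']
          ring
  have hid : IntegrableOn (fun u : ℝ => u ^ (β - 1) * Real.exp (-(z * u)) *
      (q u - 2 ^ (β - 1))) (Ioi 0) :=
    Integrable.mono' (hib.const_mul A) (by fun_prop)
      ((ae_restrict_mem measurableSet_Ioi).mono hdb)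
  have hIb : |∫ u in Ioi (0 : ℝ), u ^ (β - 1) * Real.exp (-(z * u)) * (q u - 2 ^ (β - 1))| ≤
      A * ((1 / z) ^ (β + 1) * Real.Gamma (β + 1)) := by
    rw [← Real.integral_rpow_mul_exp_neg_mul_Ioi (by linarith) hz, ← integral_const_mul,
      ← Real.norm_eq_abs]
    exact norm_integral_le_of_norm_le (hib.const_mul A)
      ((ae_restrict_mem measurableSet_Ioi).mono hdb)
  have hI : ∫ u in Ioi (0 : ℝ), u ^ (β - 1) * Real.exp (-(z * u)) * q u =
      (∫ u in Ioi (0 : ℝ), u ^ (β - 1) * Real.exp (-(z * u)) * (q u - 2 ^ (β - 1))) +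
        2 ^ (β - 1) * ((1 / z) ^ β * Real.Gamma β) := by
    rw [← Real.integral_rpow_mul_exp_neg_mul_Ioi hβ hz, ← integral_const_mul,
      ← integral_add hid (hi1.const_mul _)]
    congr 1
    funext u
    ring
  have hi2 : IntegrableOn (fun u : ℝ => Real.exp (-(z * (2 - u))) * (u * (2 - u)) ^ (β - 1))
      (Ioo 0 1) := by
    refine Integrable.bdd_mul (c := 1) (integrableOn_weight hβ) (by fun_prop) ?_
    filter_upwards [ae_restrict_mem measurableSet_Ioo] with u hu
    rw [Real.norm_of_nonneg (Real.exp_pos _).le]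
    exact Real.exp_le_one_iff.2 (by nlinarith [hu.2])
  have hE : |∫ u in Ioo (0 : ℝ) 1, Real.exp (-(z * (2 - u))) * (u * (2 - u)) ^ (β - 1)| ≤
      Real.exp (-z) * W := by
    rw [hWd, ← integral_const_mul, ← Real.norm_eq_abs]
    refine norm_integral_le_of_norm_le ((integrableOn_weight hβ).const_mul _) ?_
    filter_upwards [ae_restrict_mem measurableSet_Ioo] with u hu
    rw [norm_mul, Real.norm_of_nonneg (weight_nonneg hu), Real.norm_of_nonneg (Real.exp_pos _).le]
    exact mul_le_mul_of_nonneg_right (Real.exp_le_exp.2 (by nlinarith [hu.2])) (weight_nonneg hu)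
  have hsplit : poissonIntegral β z = (∫ u in Ioi (0 : ℝ), u ^ (β - 1) * Real.exp (-(z * u)) * q u)
      + ∫ u in Ioo (0 : ℝ) 1, Real.exp (-(z * (2 - u))) * (u * (2 - u)) ^ (β - 1) := by
    have e1 : ∫ u in Ioi (0 : ℝ), u ^ (β - 1) * Real.exp (-(z * u)) * q u =
        ∫ u in Ioo (0 : ℝ) 1, Real.exp (-(z * u)) * (u * (2 - u)) ^ (β - 1) := by
      have e2 : ∀ u, u ^ (β - 1) * Real.exp (-(z * u)) * q u = (Ioo (0 : ℝ) 1).indicator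
          (fun u => Real.exp (-(z * u)) * (u * (2 - u)) ^ (β - 1)) u := fun u => by
        by_cases hu : u ∈ Ioo (0 : ℝ) 1
        · rw [hq, indicator_of_mem hu, indicator_of_mem hu,
            Real.mul_rpow hu.1.le (by linarith [hu.2])]
          ring
        · rw [hq, indicator_of_notMem hu, indicator_of_notMem hu, mul_zero]
      simp only [e2]
      rw [setIntegral_indicator measurableSet_Ioo, inter_eq_right.2 Ioo_subset_Ioi_self]
    have hi3 : IntegrableOn (fun u : ℝ => Real.exp (-(z * u)) * (u * (2 - u)) ^ (β - 1))
        (Ioo 0 1) := by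
      refine Integrable.bdd_mul (c := 1) (integrableOn_weight hβ) (by fun_prop) ?_
      filter_upwards [ae_restrict_mem measurableSet_Ioo] with u hu
      rw [Real.norm_of_nonneg (Real.exp_pos _).le]
      exact Real.exp_le_one_iff.2 (by nlinarith [hu.1])
    rw [e1, ← integral_add hi3 hi2, poissonIntegral]
    congr 1
    funext u
    ring
  have e1 : (1 / z) ^ β = (z ^ β)⁻¹ := by
    rw [Real.div_rpow zero_le_one hz.le, Real.one_rpow, one_div]
  have e2 : (1 / z) ^ (β + 1) = (z ^ β)⁻¹ / z := by
    rw [Real.rpow_add_one (by positivity), e1]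
    ring
  rw [e1] at hI
  rw [e2] at hIb
  set I₁ := ∫ u in Ioi (0 : ℝ), u ^ (β - 1) * Real.exp (-(z * u)) * (q u - 2 ^ (β - 1))
  set I₂ := ∫ u in Ioo (0 : ℝ) 1, Real.exp (-(z * (2 - u))) * (u * (2 - u)) ^ (β - 1)
  have e3 : scaledBessel β z - c * (2 ^ (β - 1) * Real.Gamma β) = c * (z ^ β * (I₁ + I₂)) := by
    rw [scaledBessel, hsplit, hI]
    field_simp
    ring
  rw [e3, abs_mul, abs_of_pos hc0, mul_div_assoc]
  refine mul_le_mul_of_nonneg_left ?_ hc0.le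
  rw [abs_mul, abs_of_pos hzβ]
  have h4 : z ^ β * Real.exp (-z) ≤ B / z := by
    rw [le_div_iff₀ hz]
    have := hBb z hz.le
    rw [Real.rpow_add_one hz.ne'] at this
    linarith
  calc z ^ β * |I₁ + I₂| ≤ z ^ β * (A * ((z ^ β)⁻¹ / z * Real.Gamma (β + 1)) +
        Real.exp (-z) * W) :=
        mul_le_mul_of_nonneg_left ((abs_add_le _ _).trans (add_le_add hIb hE)) hzβ.le
    _ = A * Real.Gamma (β + 1) / z + z ^ β * Real.exp (-z) * W := by
        field_simp
    _ ≤ A * Real.Gamma (β + 1) / z + B / z * W := by gcongr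
    _ = _ := by ring

/-! ### The heat kernel in closed form -/

/-- The exponent of Mehler's kernel. -/
def mehlerExponent (t x y : ℝ) : ℝ :=
  -(x - y) ^ 2 / (2 * Real.sinh (2 * t)) - (x ^ 2 + y ^ 2) * Real.tanh t / 2

theorem sinh_two_mul_pos {t : ℝ} (ht : 0 < t) : 0 < Real.sinh (2 * t) :=
  Real.sinh_pos_iff.2 (by linarith)

theorem tanh_pos_of_pos {t : ℝ} (ht : 0 < t) : 0 < Real.tanh t := by
  rw [Real.tanh_eq_sinh_div_cosh]
  exact div_pos (Real.sinh_pos_iff.2 ht) (Real.cosh_pos t)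

/-- Hille–Hardy with `α = β - 1/2`, `r = e^(-4t)` and the arguments `x²`, `y²`. The factor `e^z`
that Poisson's integral splits off completes the square in the exponent. -/
theorem hasSum_laguerreHeatKernel {β t x y : ℝ} (hβ : 0 < β) (ht : 0 < t) (hx : 0 < x)
    (hy : 0 < y) :
    HasSum (fun n : ℕ =>
        Real.exp (-t * laguerreEigenvalue β n) * laguerreFun β n x * laguerreFun β n y)
      ((√(Real.sinh (2 * t)))⁻¹ * Real.exp (mehlerExponent t x y) *
        scaledBessel β (x * y / Real.sinh (2 * t))) := by
  set S := Real.sinh (2 * t) with hSd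
  have hS : 0 < S := sinh_two_mul_pos ht
  set z := x * y / S with hz
  set r := Real.exp (-4 * t) with hr
  have hr0 : 0 < r := Real.exp_pos _
  have hr1 : r < 1 := Real.exp_lt_one_iff.2 (by linarith)
  have hGβ := Real.Gamma_pos_of_pos hβ
  have hpi : 0 < √Real.pi := Real.sqrt_pos.2 Real.pi_pos
  -- This identity makes the Bessel argument `x² y² r / (1 - r)²` equal to `z² / 4`.
  have h1r : 1 - r = 2 * S * Real.exp (-(2 * t)) := by
    have e1 : Real.exp (-(2 * t)) * Real.exp (-(2 * t)) = r := by
      rw [← Real.exp_add, hr]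
      congr 1
      ring
    have e2 : Real.exp (2 * t) * Real.exp (-(2 * t)) = 1 := by rw [← Real.exp_add]; simp
    rw [hSd, Real.sinh_eq]
    linear_combination e1 - e2
  have hrr : r = Real.exp (-(2 * t)) ^ 2 := by
    rw [sq, ← Real.exp_add, hr]
    congr 1
    ring
  have hexp := Real.exp_pos (-(2 * t))
  have hu : x ^ 2 * y ^ 2 * r / (1 - r) ^ 2 = z ^ 2 / 4 := by
    rw [h1r, hrr, hz]
    field_simp
    norm_num
  have hG : ∀ k : ℕ, Real.Gamma (k + (β - 1 / 2) + 1) = Real.Gamma (k + β + 1 / 2) := fun k => by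
    congr 1
    ring
  have h := hasSum_hilleHardy (α := β - 1 / 2) (by linarith) hr0 hr1 (sq_nonneg x) (sq_nonneg y)
    (b := Real.exp z * (1 / (√Real.pi * Real.Gamma β) * poissonIntegral β z)) (by
      simp only [hu, hG]
      exact hasSum_poissonIntegral hβ z)
  have h2 := h.mul_left (2 * Real.exp (-t * (2 * β + 1)) *
    (x ^ β * y ^ β * Real.exp (-(x ^ 2 + y ^ 2) / 2)))
  have hval : 2 * Real.exp (-t * (2 * β + 1)) *
    (x ^ β * y ^ β * Real.exp (-(x ^ 2 + y ^ 2) / 2)) * ((1 - r) ^ (-(β - 1 / 2 + 1)) *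
      Real.exp (-((x ^ 2 + y ^ 2) * (r / (1 - r)))) *
      (Real.exp z * (1 / (√Real.pi * Real.Gamma β) * poissonIntegral β z))) =
      (√S)⁻¹ * Real.exp (mehlerExponent t x y) * scaledBessel β z := by
    have e1 : (1 - r) ^ (-(β - 1 / 2 + 1)) =
        (2 * 2 ^ (β - 1 / 2))⁻¹ * ((S ^ β)⁻¹ * (√S)⁻¹) * Real.exp (t * (2 * β + 1)) := by
      have a1 : (2 : ℝ) ^ (-(β - 1 / 2 + 1)) = (2 * 2 ^ (β - 1 / 2))⁻¹ := by
        rw [Real.rpow_neg zero_le_two, Real.rpow_add_one two_ne_zero, mul_comm]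
      have a2 : S ^ (-(β - 1 / 2 + 1)) = (S ^ β)⁻¹ * (√S)⁻¹ := by
        rw [Real.rpow_neg hS.le, Real.sqrt_eq_rpow, ← mul_inv, ← Real.rpow_add hS]
        congr 2
        ring
      rw [h1r, Real.mul_rpow (by positivity) hexp.le, Real.mul_rpow zero_le_two hS.le,
        ← Real.exp_mul, a1, a2]
      congr 2
      ring
    -- Uses `r / (1 - r) = e^(-2t) / (2S)`, `S + e^(-2t) = cosh 2t` and `S tanh t = cosh 2t - 1`.
    have e2 : mehlerExponent t x y =
        -(x ^ 2 + y ^ 2) / 2 + -((x ^ 2 + y ^ 2) * (r / (1 - r))) + z := by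
      have b1 : r / (1 - r) = Real.exp (-(2 * t)) / (2 * S) := by
        rw [h1r, hrr]
        field_simp
      have b2 : S + Real.exp (-(2 * t)) = Real.cosh (2 * t) := by
        rw [hSd, Real.sinh_eq, Real.cosh_eq]
        ring
      have b3 : S * Real.tanh t = Real.cosh (2 * t) - 1 := by
        have := Real.cosh_pos t
        rw [hSd, Real.sinh_two_mul, Real.cosh_two_mul, Real.tanh_eq_sinh_div_cosh,
          Real.cosh_sq]
        field_simp
        ring
      have b4 : Real.tanh t = (S + Real.exp (-(2 * t)) - 1) / S := by
        rw [b2, ← b3]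
        field_simp
      rw [mehlerExponent, b1, hz, b4, ← hSd]
      field_simp
      ring
    rw [e1, e2, Real.exp_add, Real.exp_add, scaledBessel, scaledBesselConst, hz,
      Real.div_rpow (by positivity) hS.le, Real.mul_rpow hx.le hy.le,
      show -t * (2 * β + 1) = -(t * (2 * β + 1)) by ring, Real.exp_neg (t * (2 * β + 1))]
    have := Real.exp_pos (t * (2 * β + 1))
    field_simp
  rw [hval] at h2
  refine h2.congr_fun fun n => ?_
  have hn : (0 : ℝ) ≤ n := n.cast_nonneg
  have hGn : 0 < Real.Gamma (n + β + 1 / 2) := Real.Gamma_pos_of_pos (by linarith)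
  have hq : √(2 * n.factorial / Real.Gamma (n + β + 1 / 2)) *
      √(2 * n.factorial / Real.Gamma (n + β + 1 / 2)) =
      2 * n.factorial / Real.Gamma (n + β + 1 / 2) := Real.mul_self_sqrt (by positivity)
  have he : Real.exp (-t * laguerreEigenvalue β n) = Real.exp (-t * (2 * β + 1)) * r ^ n := by
    rw [hr, ← Real.exp_nat_mul, ← Real.exp_add, laguerreEigenvalue]
    congr 1
    ring
  have he2 : Real.exp (-(x ^ 2 + y ^ 2) / 2) =
      Real.exp (-x ^ 2 / 2) * Real.exp (-y ^ 2 / 2) := by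
    rw [← Real.exp_add]
    congr 1
    ring
  rw [he, he2, laguerreFun, laguerreFun, hG]
  linear_combination (Real.exp (-t * (2 * β + 1)) * r ^ n * laguerrePoly (β - 1 / 2) n (x ^ 2) *
    laguerrePoly (β - 1 / 2) n (y ^ 2) * x ^ β * y ^ β * Real.exp (-x ^ 2 / 2) *
    Real.exp (-y ^ 2 / 2)) * hq

theorem laguerreHeatKernel_eq {β t x y : ℝ} (hβ : 0 < β) (ht : 0 < t) (hx : 0 < x)
    (hy : 0 < y) :
    laguerreHeatKernel β t x y = (√(Real.sinh (2 * t)))⁻¹ * Real.exp (mehlerExponent t x y) *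
        scaledBessel β (x * y / Real.sinh (2 * t)) :=
  (hasSum_laguerreHeatKernel hβ ht hx hy).tsum_eq

theorem hasDerivAt_mehlerExponent (t x y : ℝ) :
    HasDerivAt (fun x => mehlerExponent t x y)
      (-(x - y) / Real.sinh (2 * t) - x * Real.tanh t) x := by
  have h1 := (((((hasDerivAt_id x).sub_const y).fun_pow 2).fun_neg).div_const
    (2 * Real.sinh (2 * t))).fun_sub
    (((((hasDerivAt_id x).fun_pow 2).add_const (y ^ 2)).mul_const (Real.tanh t)).div_const 2)
  refine h1.congr_deriv ?_
  simp only [id, Nat.cast_ofNat]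
  rw [show (2 * (x - y) ^ (2 - 1) * 1 : ℝ) = 2 * (x - y) by norm_num, ← mul_neg,
    mul_div_mul_left _ _ two_ne_zero]
  ring

/-- The heat kernel is differentiable in `x`, with an explicit derivative. -/
theorem hasDerivAt_laguerreHeatKernel {β t x y : ℝ} (hβ : 0 < β) (ht : 0 < t) (hx : 0 < x)
    (hy : 0 < y) :
    HasDerivAt (fun x => laguerreHeatKernel β t x y)
      ((√(Real.sinh (2 * t)))⁻¹ * Real.exp (mehlerExponent t x y) *
        ((-(x - y) / Real.sinh (2 * t) - x * Real.tanh t) *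
            scaledBessel β (x * y / Real.sinh (2 * t)) +
          y / Real.sinh (2 * t) * scaledBesselDeriv β (x * y / Real.sinh (2 * t)))) x := by
  have hS := sinh_two_mul_pos ht
  have hz : 0 < x * y / Real.sinh (2 * t) := by positivity
  have h1 := (hasDerivAt_mehlerExponent t x y).exp.const_mul (√(Real.sinh (2 * t)))⁻¹
  have h2 : HasDerivAt (fun x => x * y / Real.sinh (2 * t)) (y / Real.sinh (2 * t)) x := by
    simpa using ((hasDerivAt_id x).mul_const y).div_const (Real.sinh (2 * t))
  have h3 := h1.mul (HasDerivAt.comp x (hasDerivAt_scaledBessel hβ hz) h2)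
  refine (h3.congr_deriv (by simp only [Function.comp]; ring)).congr_of_eventuallyEq ?_
  filter_upwards [lt_mem_nhds hx] with u hu
  rw [laguerreHeatKernel_eq hβ ht hu hy]
  rfl

/-! ### Pointwise bounds -/

/-- A majorant of the heat kernel. -/
def heatMajorant (β t x y : ℝ) : ℝ :=
  (√(Real.sinh (2 * t)))⁻¹ * Real.exp (mehlerExponent t x y) *
    min 1 ((x * y / Real.sinh (2 * t)) ^ β)

theorem heatMajorant_nonneg {β t x y : ℝ} (ht : 0 < t) (hx : 0 < x) (hy : 0 < y) :
    0 ≤ heatMajorant β t x y := by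
  have hS := sinh_two_mul_pos ht
  have : 0 ≤ min 1 ((x * y / Real.sinh (2 * t)) ^ β) := le_min zero_le_one (by positivity)
  rw [heatMajorant]
  positivity

/-- In the derivative the Gaussian factor produces `|x - y| / sinh 2t` and `x tanh t ≤ x`. The
Bessel factor produces `(y / sinh 2t) F'(z) = z F'(z) / x`, of size `1/x` times the bound for `F`.
-/
theorem exists_abs_laguerreHeatKernel_le {β : ℝ} (hβ : 0 < β) :
    ∃ C > 0, ∀ t > 0, ∀ x > 0, ∀ y > 0,
      |laguerreHeatKernel β t x y| ≤ C * heatMajorant β t x y ∧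
      |deriv (fun x' => laguerreHeatKernel β t x' y) x| ≤
        C * (heatMajorant β t x y * (|x - y| / Real.sinh (2 * t) + (x + 1 / x))) := by
  obtain ⟨C, hC, h⟩ := exists_scaledBessel_le hβ
  refine ⟨C, hC, fun t ht x hx y hy => ?_⟩
  have hS := sinh_two_mul_pos ht
  rw [laguerreHeatKernel_eq hβ ht hx hy, (hasDerivAt_laguerreHeatKernel hβ ht hx hy).deriv,
    heatMajorant]
  set S := Real.sinh (2 * t)
  have hz : 0 < x * y / S := by positivity
  obtain ⟨hF, hF'⟩ := h _ hz
  have hF0 := scaledBessel_nonneg hβ hz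
  have hG : 0 < (√S)⁻¹ * Real.exp (mehlerExponent t x y) := by positivity
  set z := x * y / S with hzd
  set m := min 1 (z ^ β)
  constructor
  · rw [abs_mul, abs_of_pos hG, abs_of_nonneg hF0]
    calc _ ≤ (√S)⁻¹ * Real.exp (mehlerExponent t x y) * (C * m) :=
          mul_le_mul_of_nonneg_left hF hG.le
      _ = _ := by ring
  · rw [abs_mul, abs_of_pos hG]
    have hT0 := tanh_pos_of_pos ht
    have hT1 := (Real.tanh_lt_one t).le
    have e1 : |(-(x - y) / S - x * Real.tanh t)| ≤ |x - y| / S + x := by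
      refine (abs_sub _ _).trans ?_
      rw [abs_div, abs_neg, abs_of_pos hS, abs_mul, abs_of_pos hx, abs_of_pos hT0]
      nlinarith
    have e2 : |y / S * scaledBesselDeriv β z| ≤ 1 / x * (C * m) := by
      have : y / S * scaledBesselDeriv β z = 1 / x * (z * scaledBesselDeriv β z) := by
        rw [hzd]
        field_simp
      rw [this, abs_mul, abs_of_pos (by positivity : 0 < 1 / x)]
      exact mul_le_mul_of_nonneg_left hF' (by positivity)
    calc _ ≤ (√S)⁻¹ * Real.exp (mehlerExponent t x y) *
          ((|x - y| / S + x) * (C * m) + 1 / x * (C * m)) := by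
          refine mul_le_mul_of_nonneg_left ((abs_add_le _ _).trans (add_le_add ?_ e2)) hG.le
          rw [abs_mul, abs_of_nonneg hF0]
          exact mul_le_mul e1 hF hF0 (by positivity)
      _ = _ := by ring

/-! ### The heat semigroup -/

theorem measurable_laguerreFun (β : ℝ) (n : ℕ) : Measurable (laguerreFun β n) := by
  unfold laguerreFun laguerrePoly
  fun_prop

theorem mehlerExponent_le {t x y : ℝ} (ht : 0 < t) :
    mehlerExponent t x y ≤ -(Real.tanh t / 2) * y ^ 2 := by
  have hS := sinh_two_mul_pos ht
  have hT := tanh_pos_of_pos ht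
  have h1 : -(x - y) ^ 2 / (2 * Real.sinh (2 * t)) ≤ 0 :=
    div_nonpos_of_nonpos_of_nonneg (by nlinarith [sq_nonneg (x - y)]) (by positivity)
  have h2 : 0 ≤ x ^ 2 * Real.tanh t := by positivity
  rw [mehlerExponent]
  linarith

/-- On the diagonal the series has nonnegative terms, so each term is at most `T_s(y, y)`, which
decays like a Gaussian. This bounds all eigenfunctions at once without asymptotics of Laguerre
polynomials. -/
theorem exists_abs_laguerreFun_le {β s : ℝ} (hβ : 0 < β) (hs : 0 < s) :
    ∃ A > 0, ∃ b > 0, ∀ (n : ℕ), ∀ y > 0,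
      Real.exp (-(s / 2) * laguerreEigenvalue β n) * |laguerreFun β n y| ≤
        A * Real.exp (-b * y ^ 2) := by
  obtain ⟨C, hC, h⟩ := exists_abs_laguerreHeatKernel_le hβ
  have hS := sinh_two_mul_pos hs
  have hT := tanh_pos_of_pos hs
  refine ⟨√(C * (√(Real.sinh (2 * s)))⁻¹), by positivity, Real.tanh s / 4, by positivity,
    fun n y hy => ?_⟩
  refine le_of_sq_le_sq ?_ (by positivity)
  have h1 : Real.exp (-s * laguerreEigenvalue β n) * laguerreFun β n y * laguerreFun β n y ≤
      laguerreHeatKernel β s y y := by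
    rw [laguerreHeatKernel_eq hβ hs hy hy]
    refine le_hasSum (hasSum_laguerreHeatKernel hβ hs hy hy) n fun k _ => ?_
    rw [mul_assoc]
    exact mul_nonneg (Real.exp_pos _).le (mul_self_nonneg _)
  have h2 : laguerreHeatKernel β s y y ≤
      C * ((√(Real.sinh (2 * s)))⁻¹ * Real.exp (-(Real.tanh s / 2) * y ^ 2)) := by
    refine (le_abs_self _).trans ((h s hs y hy y hy).1.trans ?_)
    refine mul_le_mul_of_nonneg_left ?_ hC.le
    rw [heatMajorant]
    refine (mul_le_of_le_one_right (by positivity) (min_le_left _ _)).trans ?_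
    exact mul_le_mul_of_nonneg_left (Real.exp_le_exp.2 (mehlerExponent_le hs)) (by positivity)
  have e1 : (Real.exp (-(s / 2) * laguerreEigenvalue β n) * |laguerreFun β n y|) ^ 2 =
      Real.exp (-s * laguerreEigenvalue β n) * laguerreFun β n y * laguerreFun β n y := by
    rw [mul_pow, sq_abs, ← Real.exp_nat_mul, mul_assoc, ← sq]
    congr 2
    push_cast
    ring
  have e2 : (√(C * (√(Real.sinh (2 * s)))⁻¹) * Real.exp (-(Real.tanh s / 4) * y ^ 2)) ^ 2 =
      C * ((√(Real.sinh (2 * s)))⁻¹ * Real.exp (-(Real.tanh s / 2) * y ^ 2)) := by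
    rw [mul_pow, Real.sq_sqrt (by positivity), ← Real.exp_nat_mul, mul_assoc]
    congr 3
    push_cast
    ring
  rw [e1, e2]
  exact h1.trans h2

theorem integrableOn_exp_neg_mul_sq_mul {f : ℝ → ℝ} (hf : MemLp f 2 (volume.restrict (Ioi 0)))
    {b : ℝ} (hb : 0 < b) : IntegrableOn (fun y => Real.exp (-b * y ^ 2) * f y) (Ioi 0) := by
  have h : MemLp (fun y : ℝ => Real.exp (-b * y ^ 2)) 2 (volume.restrict (Ioi 0)) := by
    rw [memLp_two_iff_integrable_sq (by fun_prop)]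
    have := (integrable_exp_neg_mul_sq (b := 2 * b) (by positivity)).integrableOn (s := Ioi 0)
    refine this.congr (Filter.Eventually.of_forall fun y => ?_)
    simp only [← Real.exp_nat_mul]
    congr 1
    push_cast
    ring
  exact h.integrable_mul hf

theorem summable_exp_neg_mul_laguerreEigenvalue (β : ℝ) {s : ℝ} (hs : 0 < s) :
    Summable fun n : ℕ => Real.exp (-s * laguerreEigenvalue β n) := by
  have h : Summable fun n : ℕ => Real.exp (-s * (2 * β + 1)) * Real.exp (-(4 * s)) ^ n :=
    (summable_geometric_of_lt_one (Real.exp_pos _).le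
      (Real.exp_lt_one_iff.2 (by linarith))).mul_left _
  refine h.congr fun n => ?_
  rw [← Real.exp_nat_mul, ← Real.exp_add, laguerreEigenvalue]
  congr 1
  ring

/-- Termwise integration of the series. A Gaussian is in `L²`, so its product with `f` is integrable
and dominates every term, with summable coefficients. -/
theorem isLaguerreSemigroupKernel {β : ℝ} (hβ : 0 < β) :
    IsLaguerreSemigroupKernel β (laguerreHeatKernel β) := by
  intro t ht f hf x hx
  have hS := sinh_two_mul_pos ht
  obtain ⟨A, hA, b, hb, hAb⟩ := exists_abs_laguerreFun_le hβ (half_pos ht)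
  obtain ⟨C, hC, hCb⟩ := exists_abs_laguerreHeatKernel_le hβ
  have hgf := integrableOn_exp_neg_mul_sq_mul hf hb
  set F : ℕ → ℝ → ℝ := fun n y =>
    Real.exp (-t * laguerreEigenvalue β n) * laguerreFun β n x * laguerreFun β n y * f y with hF
  set M : ℕ → ℝ := fun n => Real.exp (-(t / 2) * laguerreEigenvalue β n) *
    (A * Real.exp (-b * x ^ 2)) * A with hM
  have hFb : ∀ n, ∀ y ∈ Ioi (0 : ℝ), ‖F n y‖ ≤ M n * ‖Real.exp (-b * y ^ 2) * f y‖ := by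
    intro n y hy
    have h1 := hAb n x hx
    have h2 := hAb n y hy
    -- A quarter of the time goes to each eigenfunction bound; the remaining half keeps the sum over
    -- `n` finite.
    have e : Real.exp (-t * laguerreEigenvalue β n) =
        Real.exp (-(t / 2) * laguerreEigenvalue β n) *
          (Real.exp (-(t / 2 / 2) * laguerreEigenvalue β n) *
            Real.exp (-(t / 2 / 2) * laguerreEigenvalue β n)) := by
      rw [← Real.exp_add, ← Real.exp_add]
      congr 1
      ring
    simp only [hF, hM, norm_mul, Real.norm_eq_abs, Real.abs_exp]
    rw [e]
    calc _ = Real.exp (-(t / 2) * laguerreEigenvalue β n) *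
          (Real.exp (-(t / 2 / 2) * laguerreEigenvalue β n) * |laguerreFun β n x|) *
          (Real.exp (-(t / 2 / 2) * laguerreEigenvalue β n) * |laguerreFun β n y|) * |f y| := by
          ring
      _ ≤ Real.exp (-(t / 2) * laguerreEigenvalue β n) * (A * Real.exp (-b * x ^ 2)) *
          (A * Real.exp (-b * y ^ 2)) * |f y| := by gcongr
      _ = _ := by ring
  have hFm : ∀ n, AEStronglyMeasurable (F n) (volume.restrict (Ioi 0)) := fun n =>
    ((measurable_laguerreFun β n).aestronglyMeasurable.const_mul _).mul hf.1
  have hFi : ∀ n, Integrable (F n) (volume.restrict (Ioi 0)) := fun n =>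
    Integrable.mono' (hgf.norm.const_mul (M n)) (hFm n)
      ((ae_restrict_mem measurableSet_Ioi).mono (hFb n))
  have hMs : Summable M :=
    ((summable_exp_neg_mul_laguerreEigenvalue β (half_pos ht)).mul_right _).mul_right _
  have hsum : Summable fun n => ∫ y in Ioi (0 : ℝ), ‖F n y‖ := by
    refine Summable.of_nonneg_of_le (fun n => integral_nonneg fun y => norm_nonneg _)
      (fun n => ?_) (hMs.mul_right (∫ y in Ioi (0 : ℝ), ‖Real.exp (-b * y ^ 2) * f y‖))
    rw [← integral_const_mul]
    exact setIntegral_mono_on (hFi n).norm (hgf.norm.const_mul _) measurableSet_Ioi (hFb n)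
  constructor
  · have hgf2 := integrableOn_exp_neg_mul_sq_mul hf (half_pos (tanh_pos_of_pos ht))
    have hcont : ContinuousOn (laguerreHeatKernel β t x) (Ioi 0) := by
      have h1 : ContinuousOn (fun y => (√(Real.sinh (2 * t)))⁻¹ *
          Real.exp (mehlerExponent t x y) * scaledBessel β (x * y / Real.sinh (2 * t)))
          (Ioi 0) := by
        refine ContinuousOn.mul ?_ ?_
        · unfold mehlerExponent
          fun_prop
        · refine ContinuousOn.comp (t := Ioi 0) (g := scaledBessel β)
            (fun z hz => (hasDerivAt_scaledBessel hβ hz).continuousAt.continuousWithinAt)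
            (by fun_prop) fun y hy => ?_
          have hy : 0 < y := hy
          have hx : 0 < x := hx
          exact div_pos (mul_pos hx hy) hS
      exact h1.congr fun y hy => laguerreHeatKernel_eq hβ ht hx hy
    refine Integrable.mono' (hgf2.norm.const_mul (C * (√(Real.sinh (2 * t)))⁻¹))
      ((hcont.aestronglyMeasurable measurableSet_Ioi).mul hf.1)
      ((ae_restrict_mem measurableSet_Ioi).mono fun y hy => ?_)
    rw [norm_mul, norm_mul, ← mul_assoc, Real.norm_eq_abs (Real.exp _), Real.abs_exp]
    refine mul_le_mul_of_nonneg_right ?_ (norm_nonneg _)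
    rw [mul_assoc]
    refine (hCb t ht x hx y hy).1.trans (mul_le_mul_of_nonneg_left ?_ hC.le)
    rw [heatMajorant]
    refine (mul_le_of_le_one_right (by positivity) (min_le_left _ _)).trans ?_
    exact mul_le_mul_of_nonneg_left (Real.exp_le_exp.2 (mehlerExponent_le ht)) (by positivity)
  · have h := hasSum_integral_of_summable_integral_norm hFi hsum
    have hval : ∫ y in Ioi (0 : ℝ), ∑' n, F n y =
        ∫ y in Ioi (0 : ℝ), laguerreHeatKernel β t x y * f y := by
      refine setIntegral_congr_fun measurableSet_Ioi fun y _ => ?_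
      simp only [hF]
      rw [tsum_mul_right, laguerreHeatKernel]
    rw [hval] at h
    refine h.congr_fun fun n => ?_
    rw [mul_right_comm, ← integral_const_mul]
    congr 1
    funext y
    simp only [hF]
    ring

/-! ### Hyperbolic functions and the majorant for small and large times -/

theorem cosh_le_two {t : ℝ} (h0 : 0 ≤ t) (h1 : t ≤ 1) : Real.cosh t ≤ 2 := by
  refine (Real.cosh_le_exp_half_sq t).trans ?_
  have h : Real.exp (t ^ 2 / 2) ≤ Real.exp (1 / 2) := Real.exp_le_exp.2 (by nlinarith)
  have h2 : Real.exp (1 / 2) ^ 2 = Real.exp 1 := by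
    rw [← Real.exp_nat_mul]
    norm_num
  have := Real.exp_one_lt_d9
  nlinarith [Real.exp_pos (1 / 2 : ℝ)]

theorem sinh_le_mul_cosh {t : ℝ} (ht : 0 ≤ t) : Real.sinh t ≤ t * Real.cosh t := by
  have hd : ∀ s : ℝ, HasDerivAt (fun s => s * Real.cosh s - Real.sinh s) (s * Real.sinh s) s :=
    fun s => (((hasDerivAt_id s).mul (Real.hasDerivAt_cosh s)).sub
      (Real.hasDerivAt_sinh s)).congr_deriv (by simp)
  have hmono : MonotoneOn (fun s => s * Real.cosh s - Real.sinh s) (Ici 0) := by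
    refine monotoneOn_of_deriv_nonneg (convex_Ici 0)
      (fun s _ => (hd s).continuousAt.continuousWithinAt)
      (fun s _ => (hd s).differentiableAt.differentiableWithinAt) fun s hs => ?_
    rw [(hd s).deriv]
    rw [interior_Ici] at hs
    exact mul_nonneg (le_of_lt hs) (Real.sinh_nonneg_iff.2 (le_of_lt hs))
  have := hmono self_mem_Ici ht ht
  simp at this
  linarith

theorem two_mul_le_sinh_two_mul {t : ℝ} (ht : 0 ≤ t) : 2 * t ≤ Real.sinh (2 * t) :=
  Real.self_le_sinh_iff.2 (by linarith)

theorem sinh_two_mul_le {t : ℝ} (h0 : 0 ≤ t) (h1 : t ≤ 1) :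
    Real.sinh (2 * t) ≤ 2 * t * (1 + 2 * t ^ 2) := by
  have hc := Real.cosh_pos t
  have h2 : Real.cosh t ^ 2 ≤ 1 + 2 * t ^ 2 := by
    calc Real.cosh t ^ 2 ≤ Real.exp (t ^ 2 / 2) ^ 2 :=
          pow_le_pow_left₀ hc.le (Real.cosh_le_exp_half_sq t) 2
      _ = Real.exp (t ^ 2) := by
          rw [← Real.exp_nat_mul]
          congr 1
          push_cast
          ring
      _ ≤ 1 + 2 * t ^ 2 := by
          have ht2 : t ^ 2 ≤ 1 := by nlinarith
          have h := Real.exp_bound' (sq_nonneg t) ht2 (n := 2) (by norm_num)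
          norm_num [Finset.sum_range_succ] at h
          nlinarith [sq_nonneg t]
  calc Real.sinh (2 * t) = 2 * Real.sinh t * Real.cosh t := Real.sinh_two_mul t
    _ ≤ 2 * (t * Real.cosh t) * Real.cosh t := by
        have := sinh_le_mul_cosh h0
        gcongr
    _ = 2 * t * Real.cosh t ^ 2 := by ring
    _ ≤ _ := by gcongr

theorem sinh_two_mul_le_six_mul {t : ℝ} (h0 : 0 ≤ t) (h1 : t ≤ 1) :
    Real.sinh (2 * t) ≤ 6 * t := by
  refine (sinh_two_mul_le h0 h1).trans ?_
  have ht2 : t ^ 2 ≤ 1 := by nlinarith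
  nlinarith

theorem half_le_tanh {t : ℝ} (h0 : 0 ≤ t) (h1 : t ≤ 1) : t / 2 ≤ Real.tanh t := by
  rw [Real.tanh_eq_sinh_div_cosh, le_div_iff₀ (Real.cosh_pos t)]
  have h2 := cosh_le_two h0 h1
  have h3 := Real.self_le_sinh_iff.2 h0
  nlinarith

theorem tanh_le_self {t : ℝ} (h0 : 0 ≤ t) : Real.tanh t ≤ t := by
  rw [Real.tanh_eq_sinh_div_cosh, div_le_iff₀ (Real.cosh_pos t)]
  exact sinh_le_mul_cosh h0

theorem half_le_tanh_of_one_le {t : ℝ} (h1 : 1 ≤ t) : 1 / 2 ≤ Real.tanh t := by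
  have h2 : Real.exp (-t) * 3 ≤ Real.exp t := by
    have h3 : 3 ≤ Real.exp (2 * t) := by
      have := Real.add_one_le_exp (2 * t)
      linarith
    have h4 : Real.exp t = Real.exp (-t) * Real.exp (2 * t) := by
      rw [← Real.exp_add]
      congr 1
      ring
    rw [h4]
    exact mul_le_mul_of_nonneg_left h3 (Real.exp_pos _).le
  have := Real.exp_pos t
  have := Real.exp_pos (-t)
  rw [Real.tanh_eq, div_le_div_iff₀ two_pos (by positivity)]
  linarith

/-- The cube is what makes `(sinh 2t)^(-1/2) t^(-1/2)` at most `t^(-2)`, an integrable tail. -/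
theorem pow_three_le_sinh_two_mul {t : ℝ} (h1 : 1 ≤ t) : t ^ 3 ≤ Real.sinh (2 * t) := by
  have h2 : Real.exp (-(2 * t)) ≤ 1 := Real.exp_le_one_iff.2 (by linarith)
  have h3 := Real.sum_le_exp_of_nonneg (x := 2 * t) (by linarith) 5
  norm_num [Finset.sum_range_succ, Nat.factorial] at h3
  rw [Real.sinh_eq]
  nlinarith [pow_pos (by linarith : 0 < t) 3, sq_nonneg (t ^ 2 - t), sq_nonneg t]

/-- Small times: `t ≤ sinh 2t ≤ 6t` and `tanh t ≥ t / 2` give the constants `12` and `4`. -/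
theorem heatMajorant_le_of_le_one {β t x y : ℝ} (hβ : 0 < β) (ht : 0 < t) (ht1 : t ≤ 1)
    (hx : 0 < x) (hy : 0 < y) :
    heatMajorant β t x y / √t ≤ t⁻¹ * (Real.exp (-((x - y) ^ 2 / (12 * t))) *
      Real.exp (-((x ^ 2 + y ^ 2) * t / 4)) * min 1 ((x * y / t) ^ β)) := by
  have hS := sinh_two_mul_pos ht
  have hS1 : t ≤ Real.sinh (2 * t) := by linarith [two_mul_le_sinh_two_mul ht.le]
  have hS2 := sinh_two_mul_le_six_mul ht.le ht1
  have hT := half_le_tanh ht.le ht1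
  have e1 : Real.exp (mehlerExponent t x y) ≤ Real.exp (-((x - y) ^ 2 / (12 * t))) *
      Real.exp (-((x ^ 2 + y ^ 2) * t / 4)) := by
    rw [← Real.exp_add, mehlerExponent]
    refine Real.exp_le_exp.2 ?_
    have h1 : (x - y) ^ 2 / (12 * t) ≤ (x - y) ^ 2 / (2 * Real.sinh (2 * t)) :=
      div_le_div_of_nonneg_left (sq_nonneg _) (by positivity) (by linarith)
    have h2 : (x ^ 2 + y ^ 2) * (t / 2) ≤ (x ^ 2 + y ^ 2) * Real.tanh t :=
      mul_le_mul_of_nonneg_left hT (by positivity)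
    rw [neg_div]
    linarith
  have e2 : min 1 ((x * y / Real.sinh (2 * t)) ^ β) ≤ min 1 ((x * y / t) ^ β) := by
    gcongr
  have e3 : (√(Real.sinh (2 * t)))⁻¹ ≤ (√t)⁻¹ := by
    gcongr
  have e4 : t⁻¹ = (√t)⁻¹ / √t := by
    rw [div_eq_mul_inv, ← mul_inv, Real.mul_self_sqrt ht.le]
  have hm : 0 ≤ min 1 ((x * y / Real.sinh (2 * t)) ^ β) := le_min zero_le_one (by positivity)
  rw [e4, heatMajorant, div_mul_eq_mul_div, ← mul_assoc]
  gcongr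

/-- Large times: the factor in `x - y` is dropped, and `tanh t ≥ 1/2` gives Gaussian decay in `x`
and `y` separately. -/
theorem heatMajorant_le_of_one_le {β t x y : ℝ} (hβ : 0 < β) (ht1 : 1 ≤ t)
    (hx : 0 < x) (hy : 0 < y) :
    heatMajorant β t x y / √t ≤ t ^ (-2 : ℝ) * (Real.exp (-(x ^ 2 / 4)) *
      Real.exp (-(y ^ 2 / 4)) * min 1 ((x * y) ^ β)) := by
  have ht : 0 < t := by linarith
  have hS := sinh_two_mul_pos ht
  have hS1 := pow_three_le_sinh_two_mul ht1
  have hS2 : 1 ≤ Real.sinh (2 * t) := by linarith [two_mul_le_sinh_two_mul ht.le]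
  have hT := half_le_tanh_of_one_le ht1
  have e1 : Real.exp (mehlerExponent t x y) ≤ Real.exp (-(x ^ 2 / 4)) *
      Real.exp (-(y ^ 2 / 4)) := by
    rw [← Real.exp_add, mehlerExponent]
    refine Real.exp_le_exp.2 ?_
    have h1 : 0 ≤ (x - y) ^ 2 / (2 * Real.sinh (2 * t)) := by positivity
    have h2 : (x ^ 2 + y ^ 2) * (1 / 2) ≤ (x ^ 2 + y ^ 2) * Real.tanh t :=
      mul_le_mul_of_nonneg_left hT (by positivity)
    rw [neg_div]
    linarith
  have e2 : min 1 ((x * y / Real.sinh (2 * t)) ^ β) ≤ min 1 ((x * y) ^ β) := by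
    have : x * y / Real.sinh (2 * t) ≤ x * y := div_le_self (by positivity) hS2
    gcongr
  have e3 : (√(Real.sinh (2 * t)))⁻¹ / √t ≤ t ^ (-2 : ℝ) := by
    rw [Real.rpow_neg ht.le, div_eq_mul_inv, ← mul_inv, ← Real.sqrt_mul hS.le]
    refine inv_anti₀ (by positivity) (Real.le_sqrt_of_sq_le ?_)
    rw [Real.rpow_two]
    nlinarith
  have hm : 0 ≤ min 1 ((x * y / Real.sinh (2 * t)) ^ β) := le_min zero_le_one (by positivity)
  calc heatMajorant β t x y / √t = ((√(Real.sinh (2 * t)))⁻¹ / √t) *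
        (Real.exp (mehlerExponent t x y) * min 1 ((x * y / Real.sinh (2 * t)) ^ β)) := by
        rw [heatMajorant]
        ring
    _ ≤ _ := by gcongr

/-! ### One-dimensional integrals -/

/-- With the next lemma, a calculus of bounds of the form `ENNReal.ofReal I`: the explicit integrals
below are assembled from it linearly, without proving integrability of the combinations. -/
theorem lintegral_ofReal_mul_le {μ : Measure ℝ} {f : ℝ → ℝ} {c I : ℝ} (hc : 0 ≤ c)
    (h : ∫⁻ x, ENNReal.ofReal (f x) ∂μ ≤ ENNReal.ofReal I) :
    ∫⁻ x, ENNReal.ofReal (c * f x) ∂μ ≤ ENNReal.ofReal (c * I) := by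
  simp only [ENNReal.ofReal_mul hc]
  rw [lintegral_const_mul' _ _ ENNReal.ofReal_ne_top]
  gcongr

theorem lintegral_ofReal_add_le {μ : Measure ℝ} {f g : ℝ → ℝ} {I J : ℝ} (hf : Measurable f)
    (hI : 0 ≤ I) (hJ : 0 ≤ J) (h1 : ∫⁻ x, ENNReal.ofReal (f x) ∂μ ≤ ENNReal.ofReal I)
    (h2 : ∫⁻ x, ENNReal.ofReal (g x) ∂μ ≤ ENNReal.ofReal J) :
    ∫⁻ x, ENNReal.ofReal (f x + g x) ∂μ ≤ ENNReal.ofReal (I + J) := by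
  rw [ENNReal.ofReal_add hI hJ]
  refine (lintegral_mono fun x => ENNReal.ofReal_add_le).trans ?_
  rw [lintegral_add_left hf.ennreal_ofReal]
  exact add_le_add h1 h2

theorem lintegral_ofReal_gaussian_le (y : ℝ) {a : ℝ} (ha : 0 < a) :
    ∫⁻ x in Ioi (0 : ℝ), ENNReal.ofReal (Real.exp (-((x - y) ^ 2 / a))) ≤
      ENNReal.ofReal √(Real.pi * a) := by
  refine (setLIntegral_le_lintegral _ _).trans (le_of_eq ?_)
  have e : ∀ x : ℝ, Real.exp (-((x - y) ^ 2 / a)) = Real.exp (-a⁻¹ * (x - y) ^ 2) := fun x => by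
    congr 1
    field_simp
  simp only [e]
  have h := (integrable_exp_neg_mul_sq (b := a⁻¹) (by positivity)).comp_sub_right y
  rw [← ofReal_integral_eq_lintegral_ofReal h
    (Filter.Eventually.of_forall fun x => (Real.exp_pos _).le),
    integral_sub_right_eq_self (fun x => Real.exp (-a⁻¹ * x ^ 2)) y, integral_gaussian,
    div_inv_eq_mul]

theorem lintegral_ofReal_rpow_mul_gaussian {q a : ℝ} (hq : -1 < q) (ha : 0 < a) :
    ∫⁻ x in Ioi (0 : ℝ), ENNReal.ofReal (x ^ q * Real.exp (-(x ^ 2 / a))) =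
      ENNReal.ofReal (Real.Gamma ((q + 1) / 2) / 2 * a ^ ((q + 1) / 2)) := by
  have e : ∀ x : ℝ, x ^ q * Real.exp (-(x ^ 2 / a)) =
      x ^ q * Real.exp (-a⁻¹ * x ^ (2 : ℝ)) := fun x => by
    rw [Real.rpow_two]
    congr 2
    field_simp
  simp only [e]
  rw [← ofReal_integral_eq_lintegral_ofReal
    (integrableOn_rpow_mul_exp_neg_mul_rpow hq two_pos (by positivity))
    ((ae_restrict_mem measurableSet_Ioi).mono fun x hx =>
      mul_nonneg (Real.rpow_nonneg (le_of_lt hx) _) (Real.exp_pos _).le),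
    integral_rpow_mul_exp_neg_mul_rpow two_pos hq (by positivity)]
  congr 1
  rw [Real.inv_rpow ha.le, neg_div, Real.rpow_neg ha.le, inv_inv]
  ring

theorem lintegral_ofReal_rpow_mul_exp_neg {q b : ℝ} (hq : 0 < q) (hb : 0 < b) :
    ∫⁻ t in Ioi (0 : ℝ), ENNReal.ofReal (t ^ (q - 1) * Real.exp (-(b * t))) =
      ENNReal.ofReal ((1 / b) ^ q * Real.Gamma q) := by
  rw [← Real.integral_rpow_mul_exp_neg_mul_Ioi hq hb, ofReal_integral_eq_lintegral_ofReal
    (integrableOn_rpow_mul_exp_neg hq hb)]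
  exact (ae_restrict_mem measurableSet_Ioi).mono fun x hx =>
    mul_nonneg (Real.rpow_nonneg (le_of_lt hx) _) (Real.exp_pos _).le

/-- The substitution `t ↦ 1/t` in the Gamma integral. -/
theorem lintegral_ofReal_rpow_mul_exp_neg_div {q b : ℝ} (hq : 0 < q) (hb : 0 < b) :
    ∫⁻ t in Ioi (0 : ℝ), ENNReal.ofReal (t ^ (-1 - q) * Real.exp (-(b / t))) =
      ENNReal.ofReal ((1 / b) ^ q * Real.Gamma q) := by
  have hi := integrableOn_rpow_mul_exp_neg hq hb
  have e : ∀ t ∈ Ioi (0 : ℝ), (|(-1 : ℝ)| * t ^ ((-1 : ℝ) - 1)) •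
      ((t ^ (-1 : ℝ)) ^ (q - 1) * Real.exp (-(b * t ^ (-1 : ℝ)))) =
      t ^ (-1 - q) * Real.exp (-(b / t)) := fun t ht => by
    have ht : 0 < t := ht
    rw [← Real.rpow_mul ht.le, Real.rpow_neg_one, smul_eq_mul, ← mul_assoc, abs_neg, abs_one,
      one_mul, ← Real.rpow_add ht, ← div_eq_mul_inv]
    congr 2
    ring
  have hi2 := (integrableOn_congr_fun e measurableSet_Ioi).1
    ((integrableOn_Ioi_comp_rpow_iff _ (by norm_num : (-1 : ℝ) ≠ 0)).2 hi)
  have hI := integral_comp_rpow_Ioi (fun v : ℝ => v ^ (q - 1) * Real.exp (-(b * v)))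
    (by norm_num : (-1 : ℝ) ≠ 0)
  rw [setIntegral_congr_fun measurableSet_Ioi e, Real.integral_rpow_mul_exp_neg_mul_Ioi hq hb] at hI
  rw [← hI, ofReal_integral_eq_lintegral_ofReal hi2]
  exact (ae_restrict_mem measurableSet_Ioi).mono fun x hx =>
    mul_nonneg (Real.rpow_nonneg (le_of_lt hx) _) (Real.exp_pos _).le

theorem lintegral_ofReal_rpow_Ioi {p A : ℝ} (hp : 0 < p) (hA : 0 < A) :
    ∫⁻ t in Ioi A, ENNReal.ofReal (t ^ (-1 - p)) = ENNReal.ofReal (A ^ (-p) / p) := by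
  have hi : IntegrableOn (fun t : ℝ => t ^ (-1 - p)) (Ioi A) :=
    integrableOn_Ioi_rpow_of_lt (by linarith) hA
  rw [← ofReal_integral_eq_lintegral_ofReal hi, integral_Ioi_rpow_of_lt (by linarith) hA]
  · congr 1
    rw [show -1 - p + 1 = -p by ring, neg_div_neg_eq]
  · exact (ae_restrict_mem measurableSet_Ioi).mono fun x hx =>
      Real.rpow_nonneg (hA.le.trans (le_of_lt hx)) _

/-! ### Integrals of the majorant -/

/-- Half of the Gaussian absorbs `|v|`: for `w = |v| / √t` one has `w ≤ 3 (1 + w²/24) ≤ 3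
e^(w²/24)`. -/
theorem abs_mul_gaussian_le {t : ℝ} (ht : 0 < t) (v : ℝ) :
    |v| * Real.exp (-(v ^ 2 / (12 * t))) ≤ 3 * √t * Real.exp (-(v ^ 2 / (24 * t))) := by
  have hs : 0 < √t := Real.sqrt_pos.2 ht
  have hst : √t ^ 2 = t := Real.sq_sqrt ht.le
  have h1 : |v| ≤ 3 * √t * Real.exp (v ^ 2 / (24 * t)) := by
    have h2 := Real.add_one_le_exp (v ^ 2 / (24 * t))
    have h3 : |v| = √t * (|v| / √t) := by field_simp
    have h4 : v ^ 2 / (24 * t) = (|v| / √t) ^ 2 / 24 := by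
      rw [div_pow, sq_abs, hst]
      field_simp
    rw [h4] at h2 ⊢
    set w := |v| / √t
    rw [h3, mul_comm 3, mul_assoc]
    refine mul_le_mul_of_nonneg_left ?_ hs.le
    nlinarith [sq_nonneg (w - 4)]
  calc |v| * Real.exp (-(v ^ 2 / (12 * t)))
      ≤ 3 * √t * Real.exp (v ^ 2 / (24 * t)) * Real.exp (-(v ^ 2 / (12 * t))) :=
        mul_le_mul_of_nonneg_right h1 (Real.exp_pos _).le
    _ = 3 * √t * Real.exp (-(v ^ 2 / (24 * t))) := by
        rw [mul_assoc, ← Real.exp_add]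
        congr 2
        field_simp
        ring

/-- If `x` is well below `y`, or if the time exceeds `y²`, then `x² + y² ≤ 8 (x - y)² + 12 t`, so
the Gaussian in `x - y` decays in both variables separately. Here `96 = 8 · 12`, and the slack `12
t` costs `e^(1/8) ≤ 2`. -/
theorem gaussian_le_of_lt_or_lt {t x y : ℝ} (ht : 0 < t) (hx : 0 < x) (hy : 0 < y)
    (h : x < y / 2 ∨ y ^ 2 < t) :
    Real.exp (-((x - y) ^ 2 / (12 * t))) ≤
      2 * (Real.exp (-(x ^ 2 / (96 * t))) * Real.exp (-(y ^ 2 / (96 * t)))) := by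
  have h2 : Real.exp (1 / 8) ≤ 2 := by
    have h3 : Real.exp (1 / 8) ^ 8 = Real.exp 1 := by
      rw [← Real.exp_nat_mul]
      norm_num
    by_contra! h4
    have h5 : (2 : ℝ) ^ 8 < Real.exp (1 / 8) ^ 8 := pow_lt_pow_left₀ h4 (by norm_num) (by norm_num)
    have := Real.exp_one_lt_d9
    rw [h3] at h5
    norm_num at h5
    linarith
  have key : x ^ 2 + y ^ 2 ≤ 8 * (x - y) ^ 2 + 12 * t := by
    rcases h with h | h <;> nlinarith [sq_nonneg (x - 2 * y)]
  have key2 : -((x - y) ^ 2 / (12 * t)) ≤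
      1 / 8 + (-(x ^ 2 / (96 * t)) + -(y ^ 2 / (96 * t))) := by
    rw [← sub_nonneg]
    have : 1 / 8 + (-(x ^ 2 / (96 * t)) + -(y ^ 2 / (96 * t))) - -((x - y) ^ 2 / (12 * t)) =
        (8 * (x - y) ^ 2 + 12 * t - (x ^ 2 + y ^ 2)) / (96 * t) := by
      field_simp
      ring
    rw [this]
    exact div_nonneg (by linarith) (by positivity)
  refine (Real.exp_le_exp.2 key2).trans ?_
  rw [Real.exp_add, Real.exp_add]
  gcongr

/-- Once `t` dominates `y²`, the Gaussian may be recentred at the origin, by `(x - y)² ≥ x²/2 - y²`.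
-/
theorem gaussian_le_of_sq_le {c t x y : ℝ} (hc : 0 < c) (ht : 0 < t) (h : (c * y) ^ 2 ≤ t) :
    Real.exp (-((x - y) ^ 2 / (24 * t))) ≤
      Real.exp (1 / (24 * c ^ 2)) * Real.exp (-(x ^ 2 / (48 * t))) := by
  rw [← Real.exp_add]
  refine Real.exp_le_exp.2 ?_
  have h1 : y ^ 2 / (24 * t) ≤ 1 / (24 * c ^ 2) := by
    rw [div_le_div_iff₀ (by positivity) (by positivity)]
    nlinarith
  have h2 : x ^ 2 / (48 * t) - y ^ 2 / (24 * t) ≤ (x - y) ^ 2 / (24 * t) := by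
    rw [← sub_nonneg]
    have : (x - y) ^ 2 / (24 * t) - (x ^ 2 / (48 * t) - y ^ 2 / (24 * t)) =
        (x - 2 * y) ^ 2 / (48 * t) := by
      field_simp
      ring
    rw [this]
    positivity
  linarith

/-- A double integral is bounded by treating times at most `1` and times beyond `1` separately. -/
theorem lintegral_lintegral_le_of_le {A : Set ℝ} (hA : MeasurableSet A)
    {f g : ℝ → ℝ → ℝ} {b : ℝ → ℝ} (hg : Measurable (Function.uncurry g)) (hb : Measurable b)
    {I J : ℝ} (hI0 : 0 ≤ I) (hJ0 : 0 ≤ J)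
    (h1 : ∀ x > 0, ∀ t ∈ A, t ≤ 1 → f x t ≤ g x t)
    (h2 : ∀ x > 0, ∀ t ∈ A, 1 < t → f x t ≤ t ^ (-2 : ℝ) * b x)
    (hI : ∫⁻ t in A ∩ Iic 1, ∫⁻ x in Ioi (0 : ℝ), ENNReal.ofReal (g x t) ≤ ENNReal.ofReal I)
    (hJ : ∫⁻ x in Ioi (0 : ℝ), ENNReal.ofReal (b x) ≤ ENNReal.ofReal J) :
    ∫⁻ x in Ioi (0 : ℝ), ∫⁻ t in A, ENNReal.ofReal (f x t) ≤ ENNReal.ofReal (I + J) := by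
  have key : ∀ x ∈ Ioi (0 : ℝ), ∫⁻ t in A, ENNReal.ofReal (f x t) ≤
      (∫⁻ t in A ∩ Iic 1, ENNReal.ofReal (g x t)) + ENNReal.ofReal (b x) := by
    intro x hx
    -- The tail `t > 1` is integrated in `t` at once, with `∫_1^∞ t^(-2) dt = 1`; the part `t ≤ 1`
    -- is integrated in `x` first, after Tonelli.
    rw [← lintegral_inter_add_sdiff _ A measurableSet_Iic]
    refine add_le_add (setLIntegral_mono' (hA.inter measurableSet_Iic) fun t ht =>
      ENNReal.ofReal_le_ofReal (h1 x hx t ht.1 ht.2)) ?_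
    calc ∫⁻ t in A \ Iic 1, ENNReal.ofReal (f x t)
        ≤ ∫⁻ t in A \ Iic 1, ENNReal.ofReal (t ^ (-1 - 1 : ℝ)) * ENNReal.ofReal (b x) := by
          refine setLIntegral_mono' (hA.diff measurableSet_Iic) fun t ht => ?_
          have ht1 : 1 < t := not_le.1 ht.2
          rw [← ENNReal.ofReal_mul (by positivity)]
          refine ENNReal.ofReal_le_ofReal ((h2 x hx t ht.1 ht1).trans (le_of_eq ?_))
          norm_num
      _ ≤ ∫⁻ t in Ioi 1, ENNReal.ofReal (t ^ (-1 - 1 : ℝ)) * ENNReal.ofReal (b x) :=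
          lintegral_mono_set fun t ht => mem_Ioi.2 (not_le.1 ht.2)
      _ = ENNReal.ofReal (b x) := by
          rw [lintegral_mul_const' _ _ ENNReal.ofReal_ne_top,
            lintegral_ofReal_rpow_Ioi one_pos one_pos]
          simp
  refine (setLIntegral_mono' measurableSet_Ioi key).trans ?_
  rw [lintegral_add_right _ hb.ennreal_ofReal, ENNReal.ofReal_add hI0 hJ0,
    lintegral_lintegral_swap hg.ennreal_ofReal.aemeasurable]
  exact add_le_add hI hJ

/-- The Gaussian `e^(-y²/4)` absorbs every power of `y`. The singularity `1/x` meets the factor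
`(xy)^β`, and `x^(β-1)` is integrable at the origin as `β > 0`. -/
theorem exists_heatMajorant_le_of_one_lt {β : ℝ} (hβ : 0 < β) :
    ∃ b : ℝ → ℝ, Measurable b ∧
      (∃ J ≥ 0, ∫⁻ x in Ioi (0 : ℝ), ENNReal.ofReal (b x) ≤ ENNReal.ofReal J) ∧
      ∀ t > 1, ∀ x > 0, ∀ y > 0,
        heatMajorant β t x y * (|x - y| / Real.sinh (2 * t) + (x + 1 / x)) / √t ≤
          t ^ (-2 : ℝ) * b x := by
  obtain ⟨C, hC, hCb⟩ := exists_rpow_mul_exp_neg_le (p := β / 2) (by linarith)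
  refine ⟨fun x => 2 * (x ^ (1 : ℝ) * Real.exp (-(x ^ 2 / 4))) +
    (2 * (x ^ (0 : ℝ) * Real.exp (-(x ^ 2 / 4))) +
      (4 ^ (β / 2) * C) * (x ^ (β - 1) * Real.exp (-(x ^ 2 / 4)))), by fun_prop,
    ⟨_, ?_, lintegral_ofReal_add_le (by fun_prop) ?_ ?_
      (lintegral_ofReal_mul_le zero_le_two
        (lintegral_ofReal_rpow_mul_gaussian (by norm_num) four_pos).le)
      (lintegral_ofReal_add_le (by fun_prop) ?_ ?_
      (lintegral_ofReal_mul_le zero_le_two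
        (lintegral_ofReal_rpow_mul_gaussian (by norm_num) four_pos).le)
      (lintegral_ofReal_mul_le (by positivity)
        (lintegral_ofReal_rpow_mul_gaussian (by linarith) four_pos).le))⟩, ?_⟩
  rotate_left 5
  · intro t ht x hx y hy
    have hS := sinh_two_mul_pos (zero_lt_one.trans ht)
    have hS2 : 1 ≤ Real.sinh (2 * t) := by
      linarith [two_mul_le_sinh_two_mul (zero_lt_one.trans ht).le]
    have h := heatMajorant_le_of_one_le hβ ht.le hx hy
    have e1 : |x - y| / Real.sinh (2 * t) ≤ x + y :=
      (div_le_self (abs_nonneg _) hS2).trans (abs_le.2 ⟨by linarith, by linarith⟩)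
    have hm : 0 ≤ min 1 ((x * y) ^ β) := le_min zero_le_one (by positivity)
    have hm1 : min 1 ((x * y) ^ β) ≤ 1 := min_le_left _ _
    have hy1 : y * Real.exp (-(y ^ 2 / 4)) ≤ 2 := by
      rw [Real.exp_neg, ← div_eq_mul_inv, div_le_iff₀ (Real.exp_pos _)]
      have := Real.add_one_le_exp (y ^ 2 / 4)
      nlinarith [sq_nonneg (y - 1)]
    have hy2 : Real.exp (-(y ^ 2 / 4)) ≤ 1 := Real.exp_le_one_iff.2 (by
      have := sq_nonneg y
      linarith)
    have hy3 : y ^ β * Real.exp (-(y ^ 2 / 4)) ≤ 4 ^ (β / 2) * C := by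
      have e : y ^ β = 4 ^ (β / 2) * (y ^ 2 / 4) ^ (β / 2) := by
        rw [← Real.mul_rpow (by norm_num) (by positivity), mul_div_cancel₀ _ (by norm_num),
          ← Real.rpow_natCast, ← Real.rpow_mul hy.le]
        congr 1
        push_cast
        ring
      rw [e, mul_assoc]
      exact mul_le_mul_of_nonneg_left (hCb _ (by positivity)) (by positivity)
    have hx1 : 1 / x * ((x * y) ^ β * Real.exp (-(y ^ 2 / 4))) ≤
        x ^ (β - 1) * (4 ^ (β / 2) * C) := by
      rw [Real.mul_rpow hx.le hy.le, Real.rpow_sub_one hx.ne']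
      calc _ = x ^ β / x * (y ^ β * Real.exp (-(y ^ 2 / 4))) := by ring
        _ ≤ _ := mul_le_mul_of_nonneg_left hy3 (by positivity)
    have hE := Real.exp_pos (-(y ^ 2 / 4))
    have hX := Real.exp_pos (-(x ^ 2 / 4))
    rw [mul_div_right_comm]
    calc _ ≤ (t ^ (-2 : ℝ) * (Real.exp (-(x ^ 2 / 4)) * Real.exp (-(y ^ 2 / 4)) *
          min 1 ((x * y) ^ β))) * ((x + y) + (x + 1 / x)) := by gcongr
      _ = t ^ (-2 : ℝ) * (Real.exp (-(x ^ 2 / 4)) * ((2 * x + y) * (Real.exp (-(y ^ 2 / 4)) *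
          min 1 ((x * y) ^ β)) + 1 / x * (min 1 ((x * y) ^ β) * Real.exp (-(y ^ 2 / 4))))) := by
          ring
      _ ≤ t ^ (-2 : ℝ) * (Real.exp (-(x ^ 2 / 4)) * ((2 * x + 2) +
          x ^ (β - 1) * (4 ^ (β / 2) * C))) := by
          refine mul_le_mul_of_nonneg_left (mul_le_mul_of_nonneg_left (add_le_add ?_ ?_) hX.le)
            (by positivity)
          · have a1 : Real.exp (-(y ^ 2 / 4)) * min 1 ((x * y) ^ β) ≤ Real.exp (-(y ^ 2 / 4)) :=
              mul_le_of_le_one_right hE.le hm1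
            have a2 := mul_le_mul_of_nonneg_left a1 (by positivity : 0 ≤ 2 * x + y)
            nlinarith
          · refine le_trans ?_ hx1
            gcongr
            exact min_le_right _ _
      _ = _ := by
          simp only [Real.rpow_one, Real.rpow_zero]
          ring
  all_goals
    have := Real.Gamma_nonneg_of_nonneg (show (0 : ℝ) ≤ (1 + 1) / 2 by norm_num)
    have := Real.Gamma_nonneg_of_nonneg (show (0 : ℝ) ≤ (0 + 1) / 2 by norm_num)
    have := Real.Gamma_nonneg_of_nonneg (show (0 : ℝ) ≤ (β - 1 + 1) / 2 by linarith)
    positivity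

/-- The bound behind `(A₆)`. -/
theorem exists_lintegral_heatMajorant_le {β : ℝ} (hβ : 0 < β) :
    ∃ C ≥ 0, ∀ y > 0, ∫⁻ x in Ioi (0 : ℝ), ∫⁻ t in Ioi (0 : ℝ),
      ENNReal.ofReal (heatMajorant β t x y * (x + 1 / x) / √t) ≤ ENNReal.ofReal C := by
  obtain ⟨b, hbm, ⟨J, hJ0, hJ⟩, hb⟩ := exists_heatMajorant_le_of_one_lt hβ
  have hG := Real.Gamma_pos_of_pos (half_pos hβ)
  set D := √(Real.pi * 24) with hD
  -- The four summands come from the four terms of the small-time majorant: the part `y` of `x`, the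
  -- part `1/y` of `1/x`, the part with `x^(β-1)`, and the part `|x - y|` of `x`. By scaling none
  -- depends on `y`.
  set I := (D * (2 * √Real.pi) + (D * (6 * √Real.pi) +
    (Real.Gamma (β / 2) * 96 ^ (β / 2) * (96 ^ (β / 2) * Real.Gamma (β / 2)) + D * 3))) with hI
  refine ⟨I + J, by positivity, fun y hy => ?_⟩
  refine lintegral_lintegral_le_of_le measurableSet_Ioi
    (g := fun x t => t⁻¹ * (y * Real.exp (-(y ^ 2 / 4 * t)) + 3 * √t +
      6 / y * Real.exp (-(1 / y ^ 2 * t))) * Real.exp (-((x - y) ^ 2 / (24 * t))) +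
      t⁻¹ * (2 * (y / t) ^ β * Real.exp (-(y ^ 2 / 96 / t))) *
        (x ^ (β - 1) * Real.exp (-(x ^ 2 / (96 * t)))))
    (by simp only [Function.uncurry_def]; fun_prop) hbm (by positivity) hJ0 ?_ ?_ ?_ hJ
  · intro x hx t ht ht1
    have ht : 0 < t := ht
    rw [mul_div_right_comm]
    refine (mul_le_mul_of_nonneg_right (heatMajorant_le_of_le_one hβ ht ht1 hx hy)
      (by positivity)).trans ?_
    have hm : 0 ≤ min 1 ((x * y / t) ^ β) := le_min zero_le_one (by positivity)
    have hm1 : min 1 ((x * y / t) ^ β) ≤ 1 := min_le_left _ _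
    have hG2 : Real.exp (-((x - y) ^ 2 / (12 * t))) ≤ Real.exp (-((x - y) ^ 2 / (24 * t))) := by
      refine Real.exp_le_exp.2 (neg_le_neg (div_le_div_of_nonneg_left (sq_nonneg _) ?_ ?_)) <;>
        linarith
    have hE2 : Real.exp (-((x ^ 2 + y ^ 2) * t / 4)) ≤ Real.exp (-(y ^ 2 / 4 * t)) :=
      Real.exp_le_exp.2 (by nlinarith [mul_pos (pow_pos hx 2) ht])
    have hE3 : Real.exp (-((x ^ 2 + y ^ 2) * t / 4)) ≤ 1 := Real.exp_le_one_iff.2 (by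
      have : 0 ≤ (x ^ 2 + y ^ 2) * t := by positivity
      linarith)
    -- Splitting `x ≤ y + |x - y|`: the first part keeps `e^(-y² t/4)` for the time integral, and
    -- the second is absorbed by the Gaussian at a cost of `√t`.
    have hx1 : x * (Real.exp (-((x - y) ^ 2 / (12 * t))) *
        Real.exp (-((x ^ 2 + y ^ 2) * t / 4)) * min 1 ((x * y / t) ^ β)) ≤
        (y * Real.exp (-(y ^ 2 / 4 * t)) + 3 * √t) * Real.exp (-((x - y) ^ 2 / (24 * t))) := by
      have h1 := abs_mul_gaussian_le ht (x - y)
      have h2 : x ≤ y + |x - y| := by linarith [le_abs_self (x - y)]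
      calc _ ≤ (y + |x - y|) * (Real.exp (-((x - y) ^ 2 / (12 * t))) *
            Real.exp (-((x ^ 2 + y ^ 2) * t / 4)) * 1) := by gcongr
        _ = y * Real.exp (-((x ^ 2 + y ^ 2) * t / 4)) * Real.exp (-((x - y) ^ 2 / (12 * t))) +
            |x - y| * Real.exp (-((x - y) ^ 2 / (12 * t))) *
              Real.exp (-((x ^ 2 + y ^ 2) * t / 4)) := by ring
        _ ≤ y * Real.exp (-(y ^ 2 / 4 * t)) * Real.exp (-((x - y) ^ 2 / (24 * t))) +
            3 * √t * Real.exp (-((x - y) ^ 2 / (24 * t))) * 1 := by gcongr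
        _ = _ := by ring
    have hx2 : 1 / x * (Real.exp (-((x - y) ^ 2 / (12 * t))) *
        Real.exp (-((x ^ 2 + y ^ 2) * t / 4)) * min 1 ((x * y / t) ^ β)) ≤
        6 / y * Real.exp (-(1 / y ^ 2 * t)) * Real.exp (-((x - y) ^ 2 / (24 * t))) +
        2 * (y / t) ^ β * Real.exp (-(y ^ 2 / 96 / t)) *
          (x ^ (β - 1) * Real.exp (-(x ^ 2 / (96 * t)))) := by
      -- In this region `1/x` is tamed by the factor `(xy/t)^β`, and the Gaussian decays in `x` and
      -- in `y`. In the complement `1/x ≤ 2/y` and `t ≤ y²`.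
      by_cases h : x < y / 2 ∨ y ^ 2 < t
      · have h1 := gaussian_le_of_lt_or_lt ht hx hy h
        have e1 : 1 / x * (x * y / t) ^ β = (y / t) ^ β * x ^ (β - 1) := by
          rw [mul_div_assoc, Real.mul_rpow hx.le (by positivity), Real.rpow_sub_one hx.ne']
          ring
        have e2 : y ^ 2 / 96 / t = y ^ 2 / (96 * t) := by rw [div_div]
        rw [e2]
        refine le_add_of_nonneg_of_le (by positivity) ?_
        calc _ ≤ 1 / x * (2 * (Real.exp (-(x ^ 2 / (96 * t))) * Real.exp (-(y ^ 2 / (96 * t)))) *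
              1 * (x * y / t) ^ β) := by
              gcongr
              exact min_le_right _ _
          _ = 2 * (Real.exp (-(x ^ 2 / (96 * t))) * Real.exp (-(y ^ 2 / (96 * t)))) *
              (1 / x * (x * y / t) ^ β) := by ring
          _ = _ := by
              rw [e1]
              ring
      · push Not at h
        refine le_add_of_le_of_nonneg ?_ (by positivity)
        have h1 : 1 / x ≤ 2 / y := by
          rw [div_le_div_iff₀ hx hy]
          linarith [h.1]
        -- The restriction `t ≤ y²` is encoded by an exponential, so that the time integral becomes
        -- a Gamma integral over the half-line.
        have h2 : 1 ≤ 3 * Real.exp (-(1 / y ^ 2 * t)) := by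
          have h3 : 1 / y ^ 2 * t ≤ 1 := by
            rw [one_div_mul_eq_div, div_le_one (by positivity)]
            exact h.2
          have h4 : Real.exp (-1) ≤ Real.exp (-(1 / y ^ 2 * t)) := Real.exp_le_exp.2 (by linarith)
          have h5 : 1 ≤ 3 * Real.exp (-1) := by
            rw [Real.exp_neg, ← div_eq_mul_inv, one_le_div (Real.exp_pos _)]
            linarith [Real.exp_one_lt_d9]
          linarith
        calc _ ≤ 2 / y * (Real.exp (-((x - y) ^ 2 / (24 * t))) * 1 * 1) := by gcongr
          _ ≤ 2 / y * (Real.exp (-((x - y) ^ 2 / (24 * t))) * 1 * 1) *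
              (3 * Real.exp (-(1 / y ^ 2 * t))) := le_mul_of_one_le_right (by positivity) h2
          _ = _ := by ring
    calc _ = t⁻¹ * (x * (Real.exp (-((x - y) ^ 2 / (12 * t))) *
        Real.exp (-((x ^ 2 + y ^ 2) * t / 4)) * min 1 ((x * y / t) ^ β)) +
        1 / x * (Real.exp (-((x - y) ^ 2 / (12 * t))) *
        Real.exp (-((x ^ 2 + y ^ 2) * t / 4)) * min 1 ((x * y / t) ^ β))) := by ring
      _ ≤ t⁻¹ * ((y * Real.exp (-(y ^ 2 / 4 * t)) + 3 * √t) *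
          Real.exp (-((x - y) ^ 2 / (24 * t))) +
          (6 / y * Real.exp (-(1 / y ^ 2 * t)) * Real.exp (-((x - y) ^ 2 / (24 * t))) +
        2 * (y / t) ^ β * Real.exp (-(y ^ 2 / 96 / t)) *
          (x ^ (β - 1) * Real.exp (-(x ^ 2 / (96 * t)))))) := by gcongr
      _ = _ := by ring
  · intro x hx t ht ht1
    refine le_trans ?_ (hb t ht1 x hx y hy)
    have h0 := heatMajorant_nonneg (β := β) (zero_lt_one.trans ht1) hx hy
    have hS := sinh_two_mul_pos (zero_lt_one.trans ht1)
    exact div_le_div_of_nonneg_right (mul_le_mul_of_nonneg_left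
      (le_add_of_nonneg_left (div_nonneg (abs_nonneg _) hS.le)) h0) (Real.sqrt_nonneg _)
  -- The space integrals are `D √t` for the Gaussian about `y` and a multiple of `t^(β/2)` for the
  -- term with `x^(β-1)`.
  · have hspace : ∀ t ∈ Ioi (0 : ℝ) ∩ Iic 1, ∫⁻ x in Ioi (0 : ℝ), ENNReal.ofReal
        (t⁻¹ * (y * Real.exp (-(y ^ 2 / 4 * t)) + 3 * √t +
      6 / y * Real.exp (-(1 / y ^ 2 * t))) * Real.exp (-((x - y) ^ 2 / (24 * t))) +
      t⁻¹ * (2 * (y / t) ^ β * Real.exp (-(y ^ 2 / 96 / t))) *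
        (x ^ (β - 1) * Real.exp (-(x ^ 2 / (96 * t))))) ≤ ENNReal.ofReal
        ((D * y) * (t ^ ((1 / 2 : ℝ) - 1) * Real.exp (-(y ^ 2 / 4 * t))) +
          ((D * (6 / y)) * (t ^ ((1 / 2 : ℝ) - 1) * Real.exp (-(1 / y ^ 2 * t))) +
          ((Real.Gamma (β / 2) * 96 ^ (β / 2) * y ^ β) *
            (t ^ (-1 - β / 2) * Real.exp (-(y ^ 2 / 96 / t))) + D * 3))) := by
      intro t ht
      have ht : 0 < t := ht.1
      have hst : 0 < √t := Real.sqrt_pos.2 ht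
      have hsum : 0 ≤ t⁻¹ * (y * Real.exp (-(y ^ 2 / 4 * t)) + 3 * √t +
          6 / y * Real.exp (-(1 / y ^ 2 * t))) := by positivity
      have hprod : 0 ≤ t⁻¹ * (2 * (y / t) ^ β * Real.exp (-(y ^ 2 / 96 / t))) := by positivity
      have hG' : 0 ≤ Real.Gamma ((β - 1 + 1) / 2) :=
        Real.Gamma_nonneg_of_nonneg (by linarith)
      have h := lintegral_ofReal_add_le (by fun_prop) (mul_nonneg hsum (Real.sqrt_nonneg _))
        (mul_nonneg hprod (by positivity))
        (lintegral_ofReal_mul_le hsum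
          (lintegral_ofReal_gaussian_le y (a := 24 * t) (by positivity)))
        (lintegral_ofReal_mul_le hprod
          (lintegral_ofReal_rpow_mul_gaussian (q := β - 1) (a := 96 * t) (by linarith)
            (by positivity)).le)
      refine h.trans (le_of_eq ?_)
      congr 1
      have e1 : √(Real.pi * (24 * t)) = D * √t := by
        rw [← mul_assoc, Real.sqrt_mul (by positivity)]
      have e2 : t ^ ((1 / 2 : ℝ) - 1) = t⁻¹ * √t := by
        rw [Real.rpow_sub_one ht.ne', Real.sqrt_eq_rpow]
        ring
      have e3 : t⁻¹ * √t * √t = 1 := by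
        rw [mul_assoc, Real.mul_self_sqrt ht.le, inv_mul_cancel₀ ht.ne']
      have e4 : t ^ (-1 - β / 2) = t⁻¹ * (t ^ β)⁻¹ * t ^ (β / 2) := by
        rw [← Real.rpow_neg_one, ← Real.rpow_neg ht.le, ← Real.rpow_add ht, ← Real.rpow_add ht]
        congr 1
        ring
      rw [e1, e2, e4, show (β - 1 + 1) / 2 = β / 2 by ring, Real.div_rpow hy.le ht.le,
        Real.mul_rpow (by norm_num) ht.le]
      linear_combination (3 * D) * e3
    refine (setLIntegral_mono' (measurableSet_Ioi.inter measurableSet_Iic) hspace).trans ?_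
    have hsub : ∀ f : ℝ → ℝ≥0∞, ∫⁻ t in Ioi (0 : ℝ) ∩ Iic 1, f t ≤ ∫⁻ t in Ioi (0 : ℝ), f t :=
      fun f => lintegral_mono_set inter_subset_left
    have e1 : y * ((1 / (y ^ 2 / 4)) ^ (1 / 2 : ℝ) * Real.Gamma (1 / 2)) = 2 * √Real.pi := by
      rw [show 1 / (y ^ 2 / 4) = (2 / y) ^ 2 by field_simp; norm_num, ← Real.sqrt_eq_rpow,
        Real.sqrt_sq (by positivity), Real.Gamma_one_half_eq]
      field_simp
    have e2 : 6 / y * ((1 / (1 / y ^ 2)) ^ (1 / 2 : ℝ) * Real.Gamma (1 / 2)) = 6 * √Real.pi := by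
      rw [one_div_one_div, ← Real.sqrt_eq_rpow, Real.sqrt_sq hy.le, Real.Gamma_one_half_eq]
      field_simp
    have e3 : y ^ β * ((1 / (y ^ 2 / 96)) ^ (β / 2) * Real.Gamma (β / 2)) =
        96 ^ (β / 2) * Real.Gamma (β / 2) := by
      have : (y ^ 2) ^ (β / 2) = y ^ β := by
        rw [← Real.rpow_natCast, ← Real.rpow_mul hy.le]
        congr 1
        push_cast
        ring
      rw [one_div_div, Real.div_rpow (by norm_num) (sq_nonneg y), this]
      field_simp
    rw [hI, ← e1, ← e2, ← e3, ← mul_assoc, ← mul_assoc, ← mul_assoc D (6 / y), ← mul_assoc (D * (6 / y)),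
      ← mul_assoc (Real.Gamma (β / 2) * 96 ^ (β / 2))]
    rw [mul_assoc (D * y), mul_assoc (D * (6 / y))]
    refine lintegral_ofReal_add_le (by fun_prop) (by positivity) (by positivity)
      (lintegral_ofReal_mul_le (by positivity) ((hsub _).trans
        (lintegral_ofReal_rpow_mul_exp_neg (by norm_num) (by positivity)).le))
      (lintegral_ofReal_add_le (by fun_prop) (by positivity) (by positivity)
      (lintegral_ofReal_mul_le (by positivity) ((hsub _).trans
        (lintegral_ofReal_rpow_mul_exp_neg (by norm_num) (by positivity)).le))
      (lintegral_ofReal_add_le (by fun_prop) (by positivity) (by positivity)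
      (lintegral_ofReal_mul_le (by positivity) ((hsub _).trans
        (lintegral_ofReal_rpow_mul_exp_neg_div (by positivity) (by positivity)).le)) ?_))
    rw [setLIntegral_const, Ioi_inter_Iic, Real.volume_Ioc]
    simp

/-- The bound for large times behind `(A₄)`. -/
theorem exists_lintegral_heatMajorant_mul_abs_sub_le {β c : ℝ} (hβ : 0 < β) (hc : 0 < c) :
    ∃ C ≥ 0, ∀ y > 0, ∀ δ > 0, (c / y ≤ δ ∨ c * y ≤ δ) →
      ∫⁻ x in Ioi (0 : ℝ), ∫⁻ t in Ioi (δ ^ 2),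
        ENNReal.ofReal (heatMajorant β t x y * (|x - y| / Real.sinh (2 * t)) / √t) ≤
          ENNReal.ofReal C := by
  obtain ⟨b, hbm, ⟨J, hJ0, hJ⟩, hb⟩ := exists_heatMajorant_le_of_one_lt hβ
  have hG := Real.Gamma_pos_of_pos (show 0 < (β + 1) / 2 by linarith)
  set D := √(Real.pi * 24) with hD
  set I₁ := 12 * D / c ^ 2 with hI₁
  set B := 3 * Real.exp (1 / (24 * c ^ 2)) * (Real.Gamma ((β + 1) / 2) / 2 * 48 ^ ((β + 1) / 2))
    with hB
  set I₂ := B * (c ^ (-β) * (2 / β)) with hI₂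
  have hI₁0 : 0 ≤ I₁ := by positivity
  have hI₂0 : 0 ≤ I₂ := by positivity
  refine ⟨(I₁ + I₂) + J, by positivity, fun y hy δ hδ hδy => ?_⟩
  have hδ2 : 0 < δ ^ 2 := by positivity
  have hlarge : ∀ x > 0, ∀ t ∈ Ioi (δ ^ 2), 1 < t →
      heatMajorant β t x y * (|x - y| / Real.sinh (2 * t)) / √t ≤ t ^ (-2 : ℝ) * b x := by
    intro x hx t ht ht1
    refine le_trans ?_ (hb t ht1 x hx y hy)
    have h0 := heatMajorant_nonneg (β := β) (zero_lt_one.trans ht1) hx hy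
    gcongr
    exact le_add_of_nonneg_right (by positivity)
  have hsmall : ∀ x > 0, ∀ t ∈ Ioi (δ ^ 2), t ≤ 1 →
      heatMajorant β t x y * (|x - y| / Real.sinh (2 * t)) / √t ≤
        3 * (t⁻¹ * t⁻¹ * √t) * Real.exp (-((x - y) ^ 2 / (24 * t))) *
          (Real.exp (-(y ^ 2 * t / 4)) * min 1 ((x * y / t) ^ β)) := by
    intro x hx t ht ht1
    have ht : 0 < t := hδ2.trans ht
    have hm : 0 ≤ min 1 ((x * y / t) ^ β) := le_min zero_le_one (by positivity)
    have h1 := abs_mul_gaussian_le ht (x - y)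
    have hE2 : Real.exp (-((x ^ 2 + y ^ 2) * t / 4)) ≤ Real.exp (-(y ^ 2 * t / 4)) :=
      Real.exp_le_exp.2 (by nlinarith [mul_pos (pow_pos hx 2) ht])
    have hS : |x - y| / Real.sinh (2 * t) ≤ t⁻¹ * |x - y| := by
      rw [div_eq_inv_mul]
      have : t ≤ Real.sinh (2 * t) := by linarith [two_mul_le_sinh_two_mul ht.le]
      gcongr
    rw [mul_div_right_comm]
    calc _ ≤ (t⁻¹ * (Real.exp (-((x - y) ^ 2 / (12 * t))) *
          Real.exp (-((x ^ 2 + y ^ 2) * t / 4)) * min 1 ((x * y / t) ^ β))) * (t⁻¹ * |x - y|) := by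
          have hS0 := sinh_two_mul_pos ht
          exact mul_le_mul (heatMajorant_le_of_le_one hβ ht ht1 hx hy) hS (by positivity)
            (by positivity)
      _ = t⁻¹ * t⁻¹ * (|x - y| * Real.exp (-((x - y) ^ 2 / (12 * t)))) *
          (Real.exp (-((x ^ 2 + y ^ 2) * t / 4)) * min 1 ((x * y / t) ^ β)) := by ring
      _ ≤ t⁻¹ * t⁻¹ * (3 * √t * Real.exp (-((x - y) ^ 2 / (24 * t)))) *
          (Real.exp (-(y ^ 2 * t / 4)) * min 1 ((x * y / t) ^ β)) := by gcongr
      _ = _ := by ring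
  have hmono : ∀ I ≤ I₁ + I₂, ENNReal.ofReal (I + J) ≤ ENNReal.ofReal (I₁ + I₂ + J) :=
    fun I h => ENNReal.ofReal_le_ofReal (by linarith)
  rcases hδy with h | h
  -- Here `δ y ≥ c`. The decay `e^(-y² t/4) ≤ 4 / (y² t)` gives `∫_{δ²}^∞ t^(-2) dt / y² = 1 / (δ
  -- y)² ≤ 1 / c²`.
  · refine le_trans ?_ (hmono I₁ (by linarith))
    refine lintegral_lintegral_le_of_le measurableSet_Ioi
      (g := fun x t => 3 * (t⁻¹ * t⁻¹ * √t) * (4 / (y ^ 2 * t)) *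
        Real.exp (-((x - y) ^ 2 / (24 * t))))
      (by simp only [Function.uncurry_def]; fun_prop) hbm hI₁0 hJ0 ?_ hlarge ?_ hJ
    · intro x hx t ht ht1
      refine (hsmall x hx t ht ht1).trans ?_
      have ht : 0 < t := hδ2.trans ht
      have hm : 0 ≤ min 1 ((x * y / t) ^ β) := le_min zero_le_one (by positivity)
      have h1 : Real.exp (-(y ^ 2 * t / 4)) ≤ 4 / (y ^ 2 * t) := by
        rw [Real.exp_neg, ← one_div, div_le_div_iff₀ (Real.exp_pos _) (by positivity)]
        have := Real.add_one_le_exp (y ^ 2 * t / 4)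
        linarith
      calc _ ≤ 3 * (t⁻¹ * t⁻¹ * √t) * Real.exp (-((x - y) ^ 2 / (24 * t))) *
            (4 / (y ^ 2 * t) * 1) := by
            gcongr
            exact min_le_left _ _
        _ = _ := by ring
    · calc _ ≤ ∫⁻ t in Ioi (δ ^ 2) ∩ Iic 1,
            ENNReal.ofReal (12 * D / y ^ 2 * t ^ (-1 - 1 : ℝ)) := by
            refine setLIntegral_mono' (measurableSet_Ioi.inter measurableSet_Iic) fun t ht => ?_
            have ht : 0 < t := hδ2.trans ht.1
            refine (lintegral_ofReal_mul_le (by positivity)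
              (lintegral_ofReal_gaussian_le y (a := 24 * t) (by positivity))).trans (le_of_eq ?_)
            congr 1
            have e1 : √(Real.pi * (24 * t)) = D * √t := by
              rw [← mul_assoc, Real.sqrt_mul (by positivity)]
            have e3 : √t * √t = t := Real.mul_self_sqrt ht.le
            have e4 : t ^ (-1 - 1 : ℝ) = t⁻¹ * t⁻¹ := by
              rw [Real.rpow_sub_one ht.ne', Real.rpow_neg_one]
              ring
            rw [e1, e4]
            calc _ = 3 * (t⁻¹ * t⁻¹ * (√t * √t)) * (4 / (y ^ 2 * t)) * D := by ring
              _ = _ := by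
                rw [e3]
                field_simp
                ring
        _ ≤ ∫⁻ t in Ioi (δ ^ 2), ENNReal.ofReal (12 * D / y ^ 2 * t ^ (-1 - 1 : ℝ)) :=
            lintegral_mono_set inter_subset_left
        _ ≤ ENNReal.ofReal (12 * D / y ^ 2 * ((δ ^ 2) ^ (-1 : ℝ) / 1)) :=
            lintegral_ofReal_mul_le (by positivity) (lintegral_ofReal_rpow_Ioi one_pos hδ2).le
        _ ≤ ENNReal.ofReal I₁ := by
            refine ENNReal.ofReal_le_ofReal ?_
            rw [Real.rpow_neg_one, div_one, hI₁, div_mul_eq_mul_div, mul_div_assoc]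
            have h2 : c ≤ δ * y := by rwa [div_le_iff₀ hy] at h
            have h3 : c ^ 2 ≤ δ ^ 2 * y ^ 2 := by
              rw [← mul_pow]
              exact pow_le_pow_left₀ hc.le h2 2
            rw [mul_div_assoc 12, mul_assoc]
            have : (δ ^ 2)⁻¹ / y ^ 2 ≤ 1 / c ^ 2 := by
              rw [inv_eq_one_div, div_div]
              exact one_div_le_one_div_of_le (by positivity) h3
            calc 12 * (D * ((δ ^ 2)⁻¹ / y ^ 2)) ≤ 12 * (D * (1 / c ^ 2)) := by gcongr
              _ = _ := by ring
  -- Here `t ≥ (c y)²`. With the Gaussian recentred at the origin and the factor `(xy/t)^β`, the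
  -- space integral is of order `y^β t^(-1-β/2)`, and its time integral is of order `(y/δ)^β ≤
  -- c^(-β)`.
  · refine le_trans ?_ (hmono I₂ (by linarith))
    refine lintegral_lintegral_le_of_le measurableSet_Ioi
      (g := fun x t => 3 * (t⁻¹ * t⁻¹ * √t) * Real.exp (1 / (24 * c ^ 2)) * (y / t) ^ β *
        (x ^ β * Real.exp (-(x ^ 2 / (48 * t)))))
      (by simp only [Function.uncurry_def]; fun_prop) hbm hI₂0 hJ0 ?_ hlarge ?_ hJ
    · intro x hx t ht ht1
      refine (hsmall x hx t ht ht1).trans ?_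
      have hct : (c * y) ^ 2 ≤ t := (pow_le_pow_left₀ (by positivity) h 2).trans (le_of_lt ht)
      have ht : 0 < t := hδ2.trans ht
      have hm : 0 ≤ min 1 ((x * y / t) ^ β) := le_min zero_le_one (by positivity)
      have h1 := gaussian_le_of_sq_le (x := x) hc ht hct
      have h2 : Real.exp (-(y ^ 2 * t / 4)) ≤ 1 := Real.exp_le_one_iff.2 (by
        have : 0 ≤ y ^ 2 * t := by positivity
        linarith)
      have e1 : (x * y / t) ^ β = x ^ β * (y / t) ^ β := by
        rw [mul_div_assoc, Real.mul_rpow hx.le (by positivity)]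
      calc _ ≤ 3 * (t⁻¹ * t⁻¹ * √t) * (Real.exp (1 / (24 * c ^ 2)) *
            Real.exp (-(x ^ 2 / (48 * t)))) * (1 * (x * y / t) ^ β) := by
            gcongr
            exact min_le_right _ _
        _ = _ := by
            rw [e1]
            ring
    · calc _ ≤ ∫⁻ t in Ioi (δ ^ 2) ∩ Iic 1,
            ENNReal.ofReal (B * y ^ β * t ^ (-1 - β / 2 : ℝ)) := by
            refine setLIntegral_mono' (measurableSet_Ioi.inter measurableSet_Iic) fun t ht => ?_
            have ht : 0 < t := hδ2.trans ht.1
            refine (lintegral_ofReal_mul_le (by positivity)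
              (lintegral_ofReal_rpow_mul_gaussian (q := β) (a := 48 * t) (by linarith)
                (by positivity)).le).trans (le_of_eq ?_)
            congr 1
            have e4 : t ^ (-1 - β / 2) = t⁻¹ * t⁻¹ * √t * (t ^ β)⁻¹ * t ^ ((β + 1) / 2) := by
              rw [← Real.rpow_neg_one, ← Real.rpow_neg ht.le, Real.sqrt_eq_rpow,
                ← Real.rpow_add ht, ← Real.rpow_add ht, ← Real.rpow_add ht, ← Real.rpow_add ht]
              congr 1
              ring
            rw [e4, Real.div_rpow hy.le ht.le, Real.mul_rpow (by norm_num) ht.le, hB]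
            ring
        _ ≤ ∫⁻ t in Ioi (δ ^ 2), ENNReal.ofReal (B * y ^ β * t ^ (-1 - β / 2 : ℝ)) :=
            lintegral_mono_set inter_subset_left
        _ ≤ ENNReal.ofReal (B * y ^ β * ((δ ^ 2) ^ (-(β / 2)) / (β / 2))) :=
            lintegral_ofReal_mul_le (by positivity)
              (lintegral_ofReal_rpow_Ioi (half_pos hβ) hδ2).le
        _ ≤ ENNReal.ofReal I₂ := by
            refine ENNReal.ofReal_le_ofReal ?_
            have e1 : (δ ^ 2) ^ (-(β / 2)) = δ ^ (-β) := by
              rw [← Real.rpow_natCast, ← Real.rpow_mul hδ.le]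
              congr 1
              push_cast
              ring
            have e2 : δ ^ (-β) ≤ c ^ (-β) * y ^ (-β) := by
              rw [← Real.mul_rpow hc.le hy.le]
              exact Real.rpow_le_rpow_of_nonpos (by positivity) h (by linarith)
            have e3 : y ^ β * y ^ (-β) = 1 := by
              rw [← Real.rpow_add hy, add_neg_cancel, Real.rpow_zero]
            rw [e1]
            calc _ ≤ B * y ^ β * ((c ^ (-β) * y ^ (-β)) / (β / 2)) := by gcongr
              _ = B * (c ^ (-β) * (2 / β)) * (y ^ β * y ^ (-β)) := by
                field_simp
              _ = I₂ := by rw [e3, mul_one]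

/-! ### The covering -/

/-- `Q.1 + Q.2` is twice the centre. An interval of the first family has length `2^(-n)` and centre
between `2^n` and `2^(n+1)`; one of the second has centre `3/2` times its length. So the length is
comparable to the smaller of the centre and its inverse. -/
theorem laguerreCovering_bounds {Q : ℝ × ℝ} (hQ : Q ∈ laguerreCovering) :
    0 < diamI Q ∧ diamI Q ≤ 1 ∧ 3 * diamI Q ≤ Q.1 + Q.2 ∧ diamI Q * (Q.1 + Q.2) ≤ 4 ∧
      (2 ≤ diamI Q * (Q.1 + Q.2) ∨ Q.1 + Q.2 ≤ 3 * diamI Q) := by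
  rcases hQ with ⟨n, k, hk1, hk2, rfl⟩ | ⟨n, hn, rfl⟩
  · have hp : (1 : ℝ) ≤ 2 ^ n := one_le_pow₀ one_le_two
    have hi : (2 : ℝ) ^ n * (2 ^ n)⁻¹ = 1 := mul_inv_cancel₀ (by positivity)
    have hi0 : (0 : ℝ) < (2 ^ n)⁻¹ := by positivity
    have hi1 : ((2 : ℝ) ^ n)⁻¹ ≤ 1 := inv_le_one_of_one_le₀ hp
    have hk1' : (1 : ℝ) ≤ k := by exact_mod_cast hk1
    have hk2' : (k : ℝ) ≤ 2 ^ n * 2 ^ n := by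
      have : (k : ℝ) ≤ 2 ^ (2 * n) := by exact_mod_cast hk2
      rwa [two_mul, pow_add] at this
    set p : ℝ := 2 ^ n
    set i : ℝ := p⁻¹
    have e : p + (k : ℝ) * i - (p + ((k : ℝ) - 1) * i) = i := by ring
    have hki : (k : ℝ) * i ≤ p := by
      calc (k : ℝ) * i ≤ p * p * i := by gcongr
        _ = p * (p * i) := by ring
        _ = p := by rw [hi, mul_one]
    have hki1 : i ≤ (k : ℝ) * i := le_mul_of_one_le_left hi0.le hk1'
    simp only [diamI, e]
    refine ⟨hi0, hi1, by nlinarith, by nlinarith, Or.inl (by nlinarith)⟩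
  · have hp : (2 : ℝ) ≤ 2 ^ n := by
      calc (2 : ℝ) = 2 ^ 1 := by norm_num
        _ ≤ 2 ^ n := pow_le_pow_right₀ one_le_two hn
    have hi0 : (0 : ℝ) < (2 ^ n)⁻¹ := by positivity
    have hi1 : ((2 : ℝ) ^ n)⁻¹ ≤ 1 / 2 := by
      rw [← one_div]
      exact one_div_le_one_div_of_le two_pos hp
    set i : ℝ := (2 ^ n)⁻¹
    simp only [diamI]
    refine ⟨by linarith, by linarith, by linarith, by nlinarith, Or.inr (by linarith)⟩

/-- Tested on `[1/2, 1]`, whose centre is three times its radius: an enlargement by `3` or more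
would contain points arbitrarily close to `0 ∉ X`. -/
theorem IsEnlargementFactor.pow_three_lt {κ : ℝ}
    (hκ : IsEnlargementFactor (Ioi 0) laguerreCovering κ) : κ ^ 3 < 3 := by
  by_contra! h
  have hQ : ((1 / 2, 1) : ℝ × ℝ) ∈ laguerreCovering := Or.inr ⟨1, le_rfl, by norm_num⟩
  obtain ⟨ε, hε, hd⟩ := hκ.dist_pos _ hQ
  have hx0 : 0 < min (ε / 2) (3 / 4) := lt_min (by linarith) (by norm_num)
  have hx1 := min_le_right (ε / 2) (3 / 4)
  have hmem : |min (ε / 2) (3 / 4) - (1 / 2 + 1) / 2| ≤ κ ^ 3 * ((1 - 1 / 2) / 2) := by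
    rw [abs_le]
    constructor <;> linarith
  have h1 := hd (min (ε / 2) (3 / 4)) ⟨hx0, hmem⟩ 0 (by simp)
  rw [sub_zero, abs_of_pos hx0] at h1
  linarith [min_le_left (ε / 2) (3 / 4)]

theorem measurableSet_enlarge (κ : ℝ) (Q : ℝ × ℝ) : MeasurableSet (enlarge (Ioi 0) κ Q) :=
  measurableSet_Ioi.inter (measurableSet_le (f := fun x : ℝ => |x - (Q.1 + Q.2) / 2|)
    (g := fun _ => κ * ((Q.2 - Q.1) / 2)) (by fun_prop) measurable_const)

/-- Points of an enlarged interval are comparable to its centre. -/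
theorem mem_enlarge_bounds {κ x : ℝ} {Q : ℝ × ℝ} (hκ0 : 0 ≤ κ) (hκ : κ ≤ 3)
    (hQ : Q ∈ laguerreCovering) (hx : x ∈ enlarge (Ioi 0) κ Q) :
    (1 - κ / 3) * ((Q.1 + Q.2) / 2) ≤ x ∧ x ≤ 2 * ((Q.1 + Q.2) / 2) := by
  obtain ⟨hd0, -, hd, -, -⟩ := laguerreCovering_bounds hQ
  have h := abs_le.1 hx.2
  rw [diamI] at hd hd0
  constructor <;> nlinarith [h.1, h.2]

/-! ### Splitting double integrals -/

/-- Used to separate the singular part `f` of the derivative from the part `g` with `x + 1/x`.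
Measurability of one summand suffices for additivity of the integral. -/
theorem lintegral_lintegral_le_const_mul {A B : Set ℝ} (hA : MeasurableSet A)
    (hB : MeasurableSet B) {f g h : ℝ → ℝ → ℝ} {C I J : ℝ} (hC : 0 ≤ C) (hI0 : 0 ≤ I)
    (hJ0 : 0 ≤ J) (hg : Measurable (Function.uncurry g))
    (hle : ∀ x ∈ A, ∀ t ∈ B, h x t ≤ C * (f x t + g x t))
    (hI : ∫⁻ x in A, ∫⁻ t in B, ENNReal.ofReal (f x t) ≤ ENNReal.ofReal I)
    (hJ : ∫⁻ x in A, ∫⁻ t in B, ENNReal.ofReal (g x t) ≤ ENNReal.ofReal J) :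
    ∫⁻ x in A, ∫⁻ t in B, ENNReal.ofReal (h x t) ≤ ENNReal.ofReal (C * (I + J)) := by
  have hgx : ∀ x, Measurable fun t => ENNReal.ofReal (g x t) := fun x =>
    (hg.comp measurable_prodMk_left).ennreal_ofReal
  have hgm : Measurable fun x => ∫⁻ t in B, ENNReal.ofReal (g x t) :=
    hg.ennreal_ofReal.lintegral_prod_right'
  calc ∫⁻ x in A, ∫⁻ t in B, ENNReal.ofReal (h x t)
      ≤ ∫⁻ x in A, ENNReal.ofReal C * ((∫⁻ t in B, ENNReal.ofReal (f x t)) +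
        ∫⁻ t in B, ENNReal.ofReal (g x t)) := by
        refine setLIntegral_mono' hA fun x hx => ?_
        rw [← lintegral_add_right _ (hgx x), ← lintegral_const_mul' _ _ ENNReal.ofReal_ne_top]
        refine setLIntegral_mono' hB fun t ht => ?_
        refine (ENNReal.ofReal_le_ofReal (hle x hx t ht)).trans ?_
        rw [ENNReal.ofReal_mul hC]
        gcongr
        exact ENNReal.ofReal_add_le
    _ = ENNReal.ofReal C * ((∫⁻ x in A, ∫⁻ t in B, ENNReal.ofReal (f x t)) +
        ∫⁻ x in A, ∫⁻ t in B, ENNReal.ofReal (g x t)) := by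
        rw [lintegral_const_mul' _ _ ENNReal.ofReal_ne_top,
          lintegral_add_right _ hgm]
    _ ≤ _ := by
        rw [ENNReal.ofReal_mul hC, ENNReal.ofReal_add hI0 hJ0]
        gcongr

theorem measurable_heatMajorant (β y : ℝ) :
    Measurable (Function.uncurry fun x t => heatMajorant β t x y * (x + 1 / x) / √t) := by
  simp only [Function.uncurry_def, heatMajorant, mehlerExponent, Real.tanh_eq_sinh_div_cosh]
  fun_prop

theorem lintegral_lintegral_mono_set {A A' B B' : Set ℝ} (hA : A ⊆ A') (hB : B ⊆ B')
    (f : ℝ → ℝ → ℝ≥0∞) :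
    ∫⁻ x in A, ∫⁻ t in B, f x t ≤ ∫⁻ x in A', ∫⁻ t in B', f x t :=
  (lintegral_mono_set hA).trans (lintegral_mono fun _ => lintegral_mono_set hB)

/-! ### The conditions `(A₃)`, `(A₄)` and `(A₆)` -/

/-- Away from the diagonal, half of the Gaussian cancels the singularity `t^(-2)`, and the other
half, with `t ≤ d²`, keeps decay at scale `d`. -/
theorem heatMajorant_mul_abs_sub_le {β t x y a d : ℝ} (hβ : 0 < β) (ht : 0 < t)
    (htd : t ≤ d ^ 2) (hd : 0 < d) (hd1 : d ≤ 1) (hx : 0 < x) (hy : 0 < y) (ha : 0 < a)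
    (hxy : a ≤ |x - y|) :
    heatMajorant β t x y * (|x - y| / Real.sinh (2 * t)) / √t ≤
      1152 / a ^ 3 * Real.exp (-((x - y) ^ 2 / (24 * d ^ 2))) := by
  have ht1 : t ≤ 1 := htd.trans (pow_le_one₀ hd.le hd1)
  have hS0 := sinh_two_mul_pos ht
  have hm : 0 ≤ min 1 ((x * y / t) ^ β) := le_min zero_le_one (by positivity)
  have hE : Real.exp (-((x ^ 2 + y ^ 2) * t / 4)) ≤ 1 := Real.exp_le_one_iff.2 (by
    have : 0 ≤ (x ^ 2 + y ^ 2) * t := by positivity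
    linarith)
  have hS : |x - y| / Real.sinh (2 * t) ≤ t⁻¹ * |x - y| := by
    rw [div_eq_inv_mul]
    have : t ≤ Real.sinh (2 * t) := by linarith [two_mul_le_sinh_two_mul ht.le]
    gcongr
  set v := |x - y| with hv
  have hv0 : 0 < v := ha.trans_le hxy
  have hv2 : (x - y) ^ 2 = v ^ 2 := (sq_abs _).symm
  rw [hv2, mul_div_right_comm]
  have h1 : Real.exp (-(v ^ 2 / (12 * t))) ≤
      1152 * t ^ 2 / v ^ 4 * Real.exp (-(v ^ 2 / (24 * d ^ 2))) := by
    have e1 : Real.exp (-(v ^ 2 / (12 * t))) =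
        Real.exp (-(v ^ 2 / (24 * t))) * Real.exp (-(v ^ 2 / (24 * t))) := by
      rw [← Real.exp_add]
      congr 1
      field_simp
      ring
    -- From `e^s ≥ s²/2`, with `1152 = 2 · 24²`.
    have e2 : Real.exp (-(v ^ 2 / (24 * t))) ≤ 1152 * t ^ 2 / v ^ 4 := by
      rw [Real.exp_neg, inv_le_comm₀ (Real.exp_pos _) (by positivity), inv_div]
      have h := Real.quadratic_le_exp_of_nonneg (x := v ^ 2 / (24 * t)) (by positivity)
      have h2 : v ^ 4 / (1152 * t ^ 2) = (v ^ 2 / (24 * t)) ^ 2 / 2 := by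
        field_simp
        norm_num
      have h3 : 0 ≤ v ^ 2 / (24 * t) := by positivity
      linarith
    rw [e1]
    gcongr
  calc _ ≤ (t⁻¹ * (Real.exp (-((x - y) ^ 2 / (12 * t))) *
        Real.exp (-((x ^ 2 + y ^ 2) * t / 4)) * min 1 ((x * y / t) ^ β))) * (t⁻¹ * v) :=
        mul_le_mul (heatMajorant_le_of_le_one hβ ht ht1 hx hy) hS (by positivity) (by positivity)
    _ ≤ (t⁻¹ * (1152 * t ^ 2 / v ^ 4 * Real.exp (-(v ^ 2 / (24 * d ^ 2))) * 1 * 1)) *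
        (t⁻¹ * v) := by
        rw [hv2]
        gcongr
        exact min_le_left _ _
    _ = 1152 / v ^ 3 * Real.exp (-(v ^ 2 / (24 * d ^ 2))) := by
        field_simp
    _ ≤ _ := by gcongr

/-- The singular part is at most a multiple of `d^(-3)` times a Gaussian of width `d`; integration
over `t ≤ d²` and over `x` gives `d^(-3) · d² · d = 1`. -/
theorem exists_condA3 {β κ : ℝ} (hβ : 0 < β)
    (hκ : IsEnlargementFactor (Ioi 0) laguerreCovering κ) :
    ∃ C ≥ 0, CondA3 (Ioi 0) (laguerreHeatKernel β) laguerreCovering κ (Real.toNNReal C) := by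
  obtain ⟨C₀, hC₀, hT⟩ := exists_abs_laguerreHeatKernel_le hβ
  obtain ⟨C₁, hC₁, hK⟩ := exists_lintegral_heatMajorant_le hβ
  have hκ1 := hκ.one_lt
  -- `c d` is the gap between `Q^{**}` and the complement of `Q^{***}`: the difference of the
  -- enlarged radii `κ³ d/2` and `κ² d/2`.
  set c := (κ ^ 3 - κ ^ 2) / 2 with hc
  have hc0 : 0 < c := by
    have : 0 < κ ^ 2 * (κ - 1) := by
      have : 0 < κ - 1 := by linarith
      positivity
    rw [hc]
    nlinarith
  set I := 1152 / c ^ 3 * √(Real.pi * 24) with hI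
  refine ⟨C₀ * (I + C₁), by positivity, fun Q hQ y hy => ?_⟩
  obtain ⟨hd0, hd1, -, -, -⟩ := laguerreCovering_bounds hQ
  have hy0 : 0 < y := hy.1
  set d := diamI Q with hd
  have hA : MeasurableSet (Ioi (0 : ℝ) \ enlarge (Ioi 0) (κ ^ 3) Q) :=
    measurableSet_Ioi.diff (measurableSet_enlarge _ _)
  refine lintegral_lintegral_le_const_mul hA measurableSet_Ioc
    (f := fun x t => 1152 / (c * d) ^ 3 * Real.exp (-((x - y) ^ 2 / (24 * d ^ 2))))
    (g := fun x t => heatMajorant β t x y * (x + 1 / x) / √t) hC₀.le (by positivity) hC₁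
    (measurable_heatMajorant β y) ?_ ?_ ?_
  · intro x hx t ht
    have hx0 : 0 < x := hx.1
    have hfar : c * d ≤ |x - y| := by
      have h1 : κ ^ 3 * (d / 2) ≤ |x - (Q.1 + Q.2) / 2| := by
        by_contra! h
        exact hx.2 ⟨hx0, h.le⟩
      have h2 : |y - (Q.1 + Q.2) / 2| ≤ κ ^ 2 * (d / 2) := hy.2
      have h3 := abs_sub_abs_le_abs_sub (x - (Q.1 + Q.2) / 2) (y - (Q.1 + Q.2) / 2)
      rw [sub_sub_sub_cancel_right] at h3
      rw [hc]
      linarith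
    have h1 := heatMajorant_mul_abs_sub_le hβ ht.1 ht.2 hd0 hd1 hx0 hy0 (by positivity) hfar
    have h2 := (hT t ht.1 x hx0 y hy0).2
    calc _ ≤ C₀ * (heatMajorant β t x y * (|x - y| / Real.sinh (2 * t) + (x + 1 / x))) / √t := by
          gcongr
      _ = C₀ * (heatMajorant β t x y * (|x - y| / Real.sinh (2 * t)) / √t +
          heatMajorant β t x y * (x + 1 / x) / √t) := by ring
      _ ≤ _ := by gcongr
  · refine (lintegral_mono_set sdiff_subset).trans ?_
    have e : ∀ x : ℝ, ∫⁻ t in Ioc 0 (d ^ 2), ENNReal.ofReal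
        (1152 / (c * d) ^ 3 * Real.exp (-((x - y) ^ 2 / (24 * d ^ 2)))) =
        ENNReal.ofReal (d ^ 2 * (1152 / (c * d) ^ 3) *
          Real.exp (-((x - y) ^ 2 / (24 * d ^ 2)))) := fun x => by
      rw [setLIntegral_const, Real.volume_Ioc, sub_zero, ← ENNReal.ofReal_mul (by positivity)]
      congr 1
      ring
    simp only [e]
    refine (lintegral_ofReal_mul_le (by positivity)
      (lintegral_ofReal_gaussian_le y (a := 24 * d ^ 2) (by positivity))).trans (le_of_eq ?_)
    congr 1
    rw [← mul_assoc, Real.sqrt_mul (by positivity), Real.sqrt_sq hd0.le, hI]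
    field_simp
  · exact (lintegral_lintegral_mono_set sdiff_subset Ioc_subset_Ioi_self _).trans (hK y hy0)

/-- On `Q^{**}` the point `y` is comparable to the centre, so `d_Q` is bounded below by a multiple
of `1/y` for the intervals beyond `1` and of `y` for the dyadic ones: the two alternatives of the
large-time bound. -/
theorem exists_condA4 {β κ : ℝ} (hβ : 0 < β)
    (hκ : IsEnlargementFactor (Ioi 0) laguerreCovering κ) :
    ∃ C ≥ 0, CondA4 (Ioi 0) (laguerreHeatKernel β) laguerreCovering κ (Real.toNNReal C) := by
  obtain ⟨C₀, hC₀, hT⟩ := exists_abs_laguerreHeatKernel_le hβ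
  obtain ⟨C₁, hC₁, hK⟩ := exists_lintegral_heatMajorant_le hβ
  have hκ1 := hκ.one_lt
  have hκ3 := hκ.pow_three_lt
  have hκ2 : κ ^ 2 < 3 := (pow_lt_pow_right₀ hκ1 (by norm_num)).trans hκ3
  -- Chosen so that `y ≥ 3q` times the centre, while `q ≤ 1/3` handles the dyadic intervals, where
  -- `y ≤ 3 d`.
  set q := (1 - κ ^ 2 / 3) / 3 with hq
  have hq0 : 0 < q := by
    rw [hq]
    linarith
  have hq3 : q ≤ 1 / 3 := by
    rw [hq]
    nlinarith
  obtain ⟨C₂, hC₂, hK2⟩ := exists_lintegral_heatMajorant_mul_abs_sub_le hβ hq0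
  refine ⟨C₀ * (C₂ + C₁), by positivity, fun Q hQ y hy => ?_⟩
  obtain ⟨hd0, hd1, -, -, hd⟩ := laguerreCovering_bounds hQ
  obtain ⟨hyl, hyu⟩ := mem_enlarge_bounds (by positivity) hκ2.le hQ hy
  have hy0 : 0 < y := hy.1
  have hsub : Ioi (diamI Q ^ 2) ⊆ Ioi (0 : ℝ) := Ioi_subset_Ioi (by positivity)
  refine lintegral_lintegral_le_const_mul measurableSet_Ioi measurableSet_Ioi
    (f := fun x t => heatMajorant β t x y * (|x - y| / Real.sinh (2 * t)) / √t)
    (g := fun x t => heatMajorant β t x y * (x + 1 / x) / √t) hC₀.le hC₂ hC₁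
    (measurable_heatMajorant β y) ?_ ?_ ?_
  · intro x hx t ht
    have h2 := (hT t (hsub ht) x hx y hy0).2
    calc _ ≤ C₀ * (heatMajorant β t x y * (|x - y| / Real.sinh (2 * t) + (x + 1 / x))) / √t := by
          gcongr
      _ = _ := by ring
  · refine hK2 y hy0 _ hd0 ?_
    rcases hd with hd | hd
    · left
      rw [div_le_iff₀ hy0]
      have h1 : diamI Q * (3 * q * ((Q.1 + Q.2) / 2)) ≤ diamI Q * y := by
        refine mul_le_mul_of_nonneg_left ?_ hd0.le
        rw [hq]
        linarith
      nlinarith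
    · right
      nlinarith
  · exact (lintegral_lintegral_mono_set Subset.rfl hsub _).trans (hK y hy0)

theorem exists_condA6 {β : ℝ} (hβ : 0 < β) :
    ∃ C ≥ 0, CondA6 (Ioi 0) (laguerreHeatKernel β) (laguerreV β) (Real.toNNReal C) := by
  obtain ⟨C₀, hC₀, hT⟩ := exists_abs_laguerreHeatKernel_le hβ
  obtain ⟨C₁, hC₁, hK⟩ := exists_lintegral_heatMajorant_le hβ
  refine ⟨(1 + β) * C₀ * (0 + C₁), by positivity, fun y hy => ?_⟩
  refine lintegral_lintegral_le_const_mul measurableSet_Ioi measurableSet_Ioi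
    (f := fun _ _ => 0) (g := fun x t => heatMajorant β t x y * (x + 1 / x) / √t) (by positivity)
    le_rfl hC₁ (measurable_heatMajorant β y) ?_ (by simp) (hK y hy)
  intro x hx t ht
  have hx : 0 < x := hx
  have h1 := (hT t ht x hx y hy).1
  have hV : |laguerreV β x| ≤ (1 + β) * (x + 1 / x) := by
    have hx1 : 0 < 1 / x := by positivity
    rw [laguerreV, div_eq_mul_one_div, abs_le]
    constructor <;> nlinarith
  calc _ ≤ (1 + β) * (x + 1 / x) * (C₀ * heatMajorant β t x y) / √t := by gcongr
    _ = _ := by ring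

/-! ### Comparison with the Gauss kernel -/

/-- Isolates the factor `1/√(2π)`, the limit of the scaled Bessel function, so that the two kernels
can be compared factor by factor. -/
theorem gaussKernel_eq {t : ℝ} (ht : 0 < t) (x y : ℝ) :
    gaussKernel t x y =
      1 / √(2 * Real.pi) * ((√(2 * t))⁻¹ * Real.exp (-(x - y) ^ 2 / (4 * t))) := by
  rw [gaussKernel, Real.rpow_neg (by positivity), ← Real.sqrt_eq_rpow,
    show 4 * Real.pi * t = 2 * Real.pi * (2 * t) by ring, Real.sqrt_mul (by positivity)]
  field_simp

theorem hasDerivAt_gaussKernel {t : ℝ} (ht : 0 < t) (x y : ℝ) :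
    HasDerivAt (fun x => gaussKernel t x y)
      (1 / √(2 * Real.pi) * (-(x - y) *
        ((√(2 * t))⁻¹ / (2 * t) * Real.exp (-(x - y) ^ 2 / (4 * t))))) x := by
  simp only [gaussKernel_eq ht]
  have h1 : HasDerivAt (fun x : ℝ => -(x - y) ^ 2 / (4 * t)) (-(x - y) / (2 * t)) x := by
    have h := ((((hasDerivAt_id x).sub_const y).pow 2).fun_neg).div_const (4 * t)
    refine h.congr_deriv ?_
    simp only [id]
    field_simp
    norm_num
    ring
  refine ((h1.exp.const_mul _).const_mul _).congr_deriv ?_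
  field_simp

theorem abs_exp_sub_exp_le {a b m : ℝ} (ha : a ≤ m) (hb : b ≤ m) :
    |Real.exp a - Real.exp b| ≤ Real.exp m * |a - b| := by
  wlog h : b ≤ a generalizing a b
  · rw [abs_sub_comm, abs_sub_comm a b]
    exact this hb ha (le_of_not_ge h)
  rw [abs_of_nonneg (sub_nonneg.2 (Real.exp_le_exp.2 h)), abs_of_nonneg (sub_nonneg.2 h)]
  have h1 := Real.add_one_le_exp (b - a)
  have h2 : Real.exp b = Real.exp a * Real.exp (b - a) := by
    rw [← Real.exp_add]
    ring_nf
  calc Real.exp a - Real.exp b = Real.exp a * (1 - Real.exp (b - a)) := by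
        rw [h2]
        ring
    _ ≤ Real.exp a * (a - b) := by
        refine mul_le_mul_of_nonneg_left ?_ (Real.exp_pos a).le
        linarith
    _ ≤ _ := by gcongr

/-- With `w = 1 + 2t²` one has `2t ≤ sinh 2t ≤ 2t w`, hence `(sinh 2t)^(-3/2) ≥ (2t)^(-3/2) w^(-2)`,
and `w^(-2) ≥ 1 - 4t²`. The relative error `O(t²)` is what the comparison of Gaussians needs. -/
theorem abs_inv_sqrt_div_sub_le {t : ℝ} (ht : 0 < t) (ht1 : t ≤ 1) :
    |(√(2 * t))⁻¹ / (2 * t) - (√(Real.sinh (2 * t)))⁻¹ / Real.sinh (2 * t)| ≤ 4 * (√t)⁻¹ * t ∧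
      (√(Real.sinh (2 * t)))⁻¹ / Real.sinh (2 * t) ≤ (√t)⁻¹ / t := by
  have hS := sinh_two_mul_pos ht
  have h1 := two_mul_le_sinh_two_mul ht.le
  have h2 := sinh_two_mul_le ht.le ht1
  set S := Real.sinh (2 * t)
  have hst : 0 < √t := Real.sqrt_pos.2 ht
  have hs2 : √t ≤ √(2 * t) := Real.sqrt_le_sqrt (by linarith)
  have hsS : √(2 * t) ≤ √S := Real.sqrt_le_sqrt h1
  have hs2t : 0 < √(2 * t) := hst.trans_le hs2
  have hsSp : 0 < √S := hs2t.trans_le hsS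
  set w := 1 + 2 * t ^ 2 with hw
  have hw1 : 1 ≤ w := by nlinarith
  have hsu : √S ≤ √(2 * t) * w := by
    refine Real.sqrt_le_iff.2 ⟨by positivity, ?_⟩
    rw [mul_pow, Real.sq_sqrt (by positivity)]
    refine h2.trans ?_
    gcongr
    nlinarith
  have hle : (√S)⁻¹ / S ≤ (√(2 * t))⁻¹ / (2 * t) := by gcongr
  have hlow : (√(2 * t))⁻¹ / (2 * t) * (1 - 4 * t ^ 2) ≤ (√S)⁻¹ / S := by
    calc (√(2 * t))⁻¹ / (2 * t) * (1 - 4 * t ^ 2) ≤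
          (√(2 * t))⁻¹ / (2 * t) * (1 / w ^ 2) := by
          refine mul_le_mul_of_nonneg_left ?_ (by positivity)
          rw [le_div_iff₀ (by positivity), hw]
          have : 0 ≤ t ^ 4 := by positivity
          have : 0 ≤ t ^ 6 := by positivity
          nlinarith
      _ = (√(2 * t) * w)⁻¹ / (2 * t * w) := by field_simp
      _ ≤ _ := by gcongr
  have hp : (√(2 * t))⁻¹ / (2 * t) ≤ (√t)⁻¹ / t := by
    gcongr
    linarith
  refine ⟨?_, hle.trans hp⟩
  rw [abs_of_nonneg (sub_nonneg.2 hle)]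
  calc _ ≤ (√(2 * t))⁻¹ / (2 * t) * (4 * t ^ 2) := by linarith
    _ ≤ (√t)⁻¹ / t * (4 * t ^ 2) := by gcongr
    _ = _ := by field_simp

/-- The prefactors differ by `O(t^(1/2))` and the exponents by `O(t (x² + y²))`. A common Gaussian
absorbs `|x - y|` at a cost of `√t`, which balances the remaining `t^(-1/2)`. -/
theorem abs_mul_gaussian_sub_le {t : ℝ} (ht : 0 < t) (ht1 : t ≤ 1) (x y : ℝ) :
    |x - y| * |(√(2 * t))⁻¹ / (2 * t) * Real.exp (-(x - y) ^ 2 / (4 * t)) -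
      (√(Real.sinh (2 * t)))⁻¹ / Real.sinh (2 * t) * Real.exp (mehlerExponent t x y)| ≤
      12 * (1 + x ^ 2 + y ^ 2) := by
  have hS := sinh_two_mul_pos ht
  have h1 := two_mul_le_sinh_two_mul ht.le
  have h2 := sinh_two_mul_le ht.le ht1
  have h6 := sinh_two_mul_le_six_mul ht.le ht1
  have hT0 := tanh_pos_of_pos ht
  have hT1 := tanh_le_self ht.le
  obtain ⟨hp, hp'⟩ := abs_inv_sqrt_div_sub_le ht ht1
  have hst : 0 < √t := Real.sqrt_pos.2 ht
  have hv : |x - y| * Real.exp (-((x - y) ^ 2 / (12 * t))) ≤ 3 * √t := by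
    refine (abs_mul_gaussian_le ht (x - y)).trans (mul_le_of_le_one_right (by positivity) ?_)
    exact Real.exp_le_one_iff.2 (neg_nonpos.2 (by positivity))
  have ha : -(x - y) ^ 2 / (4 * t) ≤ -((x - y) ^ 2 / (12 * t)) := by
    rw [neg_div]
    gcongr
    linarith
  have hb0 : -(x - y) ^ 2 / (2 * Real.sinh (2 * t)) ≤ -((x - y) ^ 2 / (12 * t)) := by
    rw [neg_div]
    refine neg_le_neg (div_le_div_of_nonneg_left (sq_nonneg _) (by positivity) ?_)
    linarith
  have hb : mehlerExponent t x y ≤ -((x - y) ^ 2 / (12 * t)) := by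
    have : 0 ≤ (x ^ 2 + y ^ 2) * Real.tanh t := by positivity
    rw [mehlerExponent]
    linarith
  have hxy : (x - y) ^ 2 ≤ 2 * (x ^ 2 + y ^ 2) := by nlinarith [sq_nonneg (x + y)]
  -- Both contributions are nonnegative and enter with opposite signs: `tanh t ≤ t` for the first,
  -- and `sinh 2t - 2t ≤ 4t³` for the second.
  have hab : |-(x - y) ^ 2 / (4 * t) - mehlerExponent t x y| ≤ t * (x ^ 2 + y ^ 2) := by
    have e : -(x - y) ^ 2 / (4 * t) - mehlerExponent t x y =
        (x ^ 2 + y ^ 2) * Real.tanh t / 2 -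
          (x - y) ^ 2 * ((Real.sinh (2 * t) - 2 * t) / (4 * t * Real.sinh (2 * t))) := by
      rw [mehlerExponent]
      field_simp
      ring
    have hq0 : 0 ≤ (Real.sinh (2 * t) - 2 * t) / (4 * t * Real.sinh (2 * t)) :=
      div_nonneg (by linarith) (by positivity)
    have hq : (Real.sinh (2 * t) - 2 * t) / (4 * t * Real.sinh (2 * t)) ≤ t / 2 := by
      rw [div_le_iff₀ (by positivity)]
      nlinarith [sq_nonneg t, pow_pos ht 2, mul_le_mul_of_nonneg_left h1 (sq_nonneg t)]
    have hr : (x - y) ^ 2 * ((Real.sinh (2 * t) - 2 * t) / (4 * t * Real.sinh (2 * t))) ≤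
        2 * (x ^ 2 + y ^ 2) * (t / 2) := by gcongr
    have hr0 : 0 ≤ (x - y) ^ 2 *
        ((Real.sinh (2 * t) - 2 * t) / (4 * t * Real.sinh (2 * t))) := by positivity
    have hs : (x ^ 2 + y ^ 2) * Real.tanh t ≤ (x ^ 2 + y ^ 2) * t := by gcongr
    have hs0 : 0 ≤ (x ^ 2 + y ^ 2) * Real.tanh t := by positivity
    rw [e, abs_le]
    constructor <;> linarith
  set a := -(x - y) ^ 2 / (4 * t)
  set b := mehlerExponent t x y
  set m := -((x - y) ^ 2 / (12 * t))
  set p := (√(2 * t))⁻¹ / (2 * t)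
  set p' := (√(Real.sinh (2 * t)))⁻¹ / Real.sinh (2 * t) with hp'd
  have hp0 : 0 ≤ p' := by positivity
  have e : p * Real.exp a - p' * Real.exp b =
      (p - p') * Real.exp a + p' * (Real.exp a - Real.exp b) := by ring
  calc |x - y| * |p * Real.exp a - p' * Real.exp b|
      ≤ |x - y| * (4 * (√t)⁻¹ * t * Real.exp m +
        (√t)⁻¹ / t * (Real.exp m * (t * (x ^ 2 + y ^ 2)))) := by
        rw [e]
        refine mul_le_mul_of_nonneg_left ((abs_add_le _ _).trans (add_le_add ?_ ?_))
          (abs_nonneg _)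
        · rw [abs_mul, Real.abs_exp]
          gcongr
        · rw [abs_mul, abs_of_nonneg hp0]
          exact mul_le_mul hp' ((abs_exp_sub_exp_le ha hb).trans (by gcongr)) (abs_nonneg _)
            (by positivity)
    _ = (|x - y| * Real.exp m) * ((√t)⁻¹ * (4 * t + (x ^ 2 + y ^ 2))) := by field_simp
    _ ≤ (3 * √t) * ((√t)⁻¹ * (4 * t + (x ^ 2 + y ^ 2))) := by gcongr
    _ = 12 * t + 3 * (x ^ 2 + y ^ 2) := by
        field_simp
        ring
    _ ≤ _ := by nlinarith [sq_nonneg x, sq_nonneg y]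

/-- The leading term of the derivative has the coefficient `F(z) ≈ 1/√(2π)`. Replacing `F` by its
limit costs `1/z`, which cancels the factor `y / sinh 2t` down to `1/x`; after that only a
difference of two Gaussians is left. -/
theorem exists_abs_deriv_sub_gaussKernel_le {β M : ℝ} (hβ : 0 < β) (hM : 0 < M) :
    ∃ C > 0, ∀ t > 0, t ≤ 1 → ∀ x > 0, ∀ y > 0, t ≤ M * (x * y) → |x - y| ≤ M * y →
      |deriv (fun x' => laguerreHeatKernel β t x' y - gaussKernel t x' y) x| ≤
        C * ((1 + x ^ 2 + y ^ 2) + heatMajorant β t x y * (x + 1 / x)) := by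
  obtain ⟨C₁, hC₁, h₁⟩ := exists_scaledBessel_le hβ
  obtain ⟨C₂, hC₂, h₂⟩ := exists_abs_scaledBessel_sub_le hβ
  -- Since `sinh 2t ≤ 6t ≤ 6M xy`, the Bessel argument is at least `1 / (6M)`. So `μ` bounds the
  -- factor `min 1 (z ^ β)` of the majorant below, and the majorant can be restored where it is
  -- absent.
  set μ := min 1 ((1 / (6 * M)) ^ β) with hμ
  have hμ0 : 0 < μ := lt_min one_pos (by positivity)
  refine ⟨12 + C₁ + C₂ * M / μ, by positivity, fun t ht ht1 x hx y hy htM hxy => ?_⟩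
  have hS := sinh_two_mul_pos ht
  have hg := abs_mul_gaussian_sub_le ht ht1 x y
  have hT0 := tanh_pos_of_pos ht
  have hT1 := (Real.tanh_lt_one t).le
  have hz6 : 1 / (6 * M) ≤ x * y / Real.sinh (2 * t) := by
    rw [div_le_div_iff₀ (by positivity) hS]
    have := sinh_two_mul_le_six_mul ht.le ht1
    nlinarith
  rw [((hasDerivAt_laguerreHeatKernel hβ ht hx hy).fun_sub
      (hasDerivAt_gaussKernel ht x y)).deriv,
    heatMajorant]
  set S := Real.sinh (2 * t)
  have hz : 0 < x * y / S := by positivity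
  obtain ⟨hF, hF'⟩ := h₁ _ hz
  have hFa := h₂ _ hz
  have hF0 := scaledBessel_nonneg hβ hz
  have hμle : μ ≤ min 1 ((x * y / S) ^ β) := min_le_min_left _ (by gcongr)
  set z := x * y / S with hzd
  set a := 1 / √(2 * Real.pi) with had
  have ha0 : 0 ≤ a := by positivity
  have ha1 : a ≤ 1 := by
    rw [had, div_le_one (by positivity)]
    exact Real.one_le_sqrt.2 (by linarith [Real.two_le_pi])
  set G := (√S)⁻¹ * Real.exp (mehlerExponent t x y) with hG
  have hG0 : 0 < G := by positivity
  set m := min 1 (z ^ β) with hm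
  have hm0 : 0 < m := hμ0.trans_le hμle
  set A := (√(2 * t))⁻¹ / (2 * t) * Real.exp (-(x - y) ^ 2 / (4 * t))
  -- Three parts: the terms already of size `x + 1/x`, the deviation of the scaled Bessel function
  -- from its limit, and the deviation of Mehler's Gaussian from the heat Gaussian.
  have e : G * ((-(x - y) / S - x * Real.tanh t) * scaledBessel β z +
      y / S * scaledBesselDeriv β z) - a * (-(x - y) * A) =
      G * (-(x * Real.tanh t * scaledBessel β z) + 1 / x * (z * scaledBesselDeriv β z)) +
      G * (-(x - y) / S * (scaledBessel β z - a)) +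
      a * ((x - y) * (A - (√S)⁻¹ / S * Real.exp (mehlerExponent t x y))) := by
    rw [hzd, hG]
    field_simp
    ring
  have b1 : |G * (-(x * Real.tanh t * scaledBessel β z) +
      1 / x * (z * scaledBesselDeriv β z))| ≤ C₁ * (G * m * (x + 1 / x)) := by
    rw [abs_mul, abs_of_pos hG0]
    calc _ ≤ G * (x * (C₁ * m) + 1 / x * (C₁ * m)) := by
          refine mul_le_mul_of_nonneg_left ((abs_add_le _ _).trans (add_le_add ?_ ?_)) hG0.le
          · rw [abs_neg, abs_of_nonneg (by positivity)]
            exact mul_le_mul (mul_le_of_le_one_right hx.le hT1) hF hF0 hx.le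
          · rw [abs_mul, abs_of_pos (by positivity : 0 < 1 / x)]
            exact mul_le_mul_of_nonneg_left hF' (by positivity)
      _ = _ := by ring
  have b2 : |G * (-(x - y) / S * (scaledBessel β z - a))| ≤
      C₂ * M / μ * (G * m * (x + 1 / x)) := by
    rw [abs_mul, abs_of_pos hG0, abs_mul, abs_div, abs_neg, abs_of_pos hS]
    calc _ ≤ G * (M * y / S * (C₂ / z)) := by gcongr
      _ = C₂ * M / μ * (G * μ * (1 / x)) := by
          rw [hzd]
          field_simp
      _ ≤ _ := by
          gcongr
          linarith
  have b3 : |a * ((x - y) * (A - (√S)⁻¹ / S * Real.exp (mehlerExponent t x y)))| ≤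
      12 * (1 + x ^ 2 + y ^ 2) := by
    rw [abs_mul, abs_mul, abs_of_nonneg ha0]
    exact (mul_le_of_le_one_left (by positivity) ha1).trans hg
  rw [e]
  refine (abs_add_three _ _ _).trans ((add_le_add_three b1 b2 b3).trans ?_)
  have hn : 0 ≤ (C₁ + C₂ * M / μ) * (1 + x ^ 2 + y ^ 2) := by positivity
  have hn2 : 0 ≤ G * m * (x + 1 / x) := by positivity
  linarith

theorem lintegral_Ioc_ofReal_div_sqrt {c d : ℝ} (hc : 0 ≤ c) (hd : 0 < d) :
    ∫⁻ t in Ioc 0 (d ^ 2), ENNReal.ofReal (c / √t) = ENNReal.ofReal (c * (2 * d)) := by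
  have h1 : ∀ t : ℝ, c / √t = c * √t⁻¹ := fun t => by rw [Real.sqrt_inv, div_eq_mul_inv]
  have hd2 : (0 : ℝ) ≤ d ^ 2 := by positivity
  have hint : IntervalIntegrable (fun t : ℝ => t ^ (-(1 / 2) : ℝ)) volume 0 (d ^ 2) :=
    intervalIntegral.intervalIntegrable_rpow' (by norm_num)
  have hval : ∫ t in (0)..(d ^ 2), t ^ (-(1 / 2) : ℝ) = 2 * d := by
    rw [integral_rpow (Or.inl (by norm_num)), Real.zero_rpow (by norm_num),
      show (-(1 / 2) + 1 : ℝ) = 1 / 2 by norm_num, ← Real.sqrt_eq_rpow, Real.sqrt_sq hd.le]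
    ring
  rw [← hval, intervalIntegral.integral_of_le hd2, ← integral_const_mul,
    ofReal_integral_eq_lintegral_ofReal
      (((intervalIntegrable_iff_integrableOn_Ioc_of_le hd2).1 hint).const_mul c)]
  · refine setLIntegral_congr_fun measurableSet_Ioc fun t ht => ?_
    rw [Real.rpow_neg ht.1.le, ← Real.sqrt_eq_rpow, div_eq_mul_inv]
  · refine (ae_restrict_iff' measurableSet_Ioc).2 (Filter.Eventually.of_forall fun t ht => ?_)
    have : 0 < t := ht.1
    simp only [Pi.zero_apply]
    positivity

theorem volume_enlarge_le {κ : ℝ} (hκ : κ ≤ 3) {Q : ℝ × ℝ} (hQ : 0 < diamI Q) :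
    volume (enlarge (Ioi 0) κ Q) ≤ ENNReal.ofReal (3 * diamI Q) := by
  have hsub : enlarge (Ioi 0) κ Q ⊆
      Icc ((Q.1 + Q.2) / 2 - 3 * (diamI Q / 2)) ((Q.1 + Q.2) / 2 + 3 * (diamI Q / 2)) := by
    intro x hx
    have h := abs_le.1 hx.2
    rw [diamI] at hQ ⊢
    constructor <;> nlinarith [h.1, h.2]
  refine (measure_mono hsub).trans (le_of_eq ?_)
  rw [Real.volume_Icc]
  congr 1
  ring

/-- On `Q^{***}` both `x` and `y` are comparable to the centre `z`, so the error `1 + x² + y²` is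
`O(1 + z²)`. Integration over `t ≤ d²` and over an interval of length at most `3d` gives `O((1 + z²)
d²)`, bounded because `d ≤ 1` and `d z ≤ 2`. -/
theorem exists_condA5 {β κ : ℝ} (hβ : 0 < β)
    (hκ : IsEnlargementFactor (Ioi 0) laguerreCovering κ) :
    ∃ C ≥ 0, CondA5 (Ioi 0) (laguerreHeatKernel β) laguerreCovering κ (Real.toNNReal C) := by
  obtain ⟨C₁, hC₁, hK⟩ := exists_lintegral_heatMajorant_le hβ
  have hκ1 := hκ.one_lt
  have hκ3 := hκ.pow_three_lt
  have hκ2 : κ ^ 2 < 3 := (pow_lt_pow_right₀ hκ1 (by norm_num)).trans hκ3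
  have hκ23 : κ ^ 2 ≤ κ ^ 3 := pow_le_pow_right₀ hκ1.le (by norm_num)
  set q := 1 - κ ^ 3 / 3 with hq
  have hq0 : 0 < q := by
    rw [hq]
    linarith
  -- The term `1/q²` serves `t ≤ d² ≤ z² ≤ xy / q²`; the term `2/q` serves `|x - y| ≤ 2z ≤ 2y / q`.
  set M := 2 / q + 1 / q ^ 2 with hM
  have hM0 : 0 < M := by positivity
  obtain ⟨C₀, hC₀, hT⟩ := exists_abs_deriv_sub_gaussKernel_le hβ hM0
  -- `198` bounds `(1 + 8z²)(2d)(3d) = 6 d² + 48 (dz)²`, with `d ≤ 1` and `dz ≤ 2`.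
  refine ⟨C₀ * (198 + C₁), by positivity, fun Q hQ y hy => ?_⟩
  obtain ⟨hd0, hd1, hd3, hd4, -⟩ := laguerreCovering_bounds hQ
  have hyb := mem_enlarge_bounds (by positivity) hκ2.le hQ hy
  have hy0 : 0 < y := hy.1
  have hA := measurableSet_enlarge (κ ^ 3) Q
  set d := diamI Q with hd
  set z := (Q.1 + Q.2) / 2 with hz
  have hz0 : 0 < z := by linarith
  have hyl : q * z ≤ y := by
    refine le_trans ?_ hyb.1
    gcongr
    linarith
  have hd5 : d * z ≤ 2 := by
    rw [hz]
    linarith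
  refine lintegral_lintegral_le_const_mul hA measurableSet_Ioc
    (f := fun x t => (1 + 8 * z ^ 2) / √t)
    (g := fun x t => heatMajorant β t x y * (x + 1 / x) / √t) hC₀.le (by positivity) hC₁
    (measurable_heatMajorant β y) ?_ ?_ ?_
  · intro x hx t ht
    have hx0 : 0 < x := hx.1
    obtain ⟨hxl, hxu⟩ := mem_enlarge_bounds (by positivity) hκ3.le hQ hx
    have ht1 : t ≤ 1 := ht.2.trans (pow_le_one₀ hd0.le hd1)
    have htM : t ≤ M * (x * y) := by
      have h1 : q * z * (q * z) ≤ x * y := mul_le_mul hxl hyl (by positivity) hx0.le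
      have h2 : z ^ 2 ≤ 1 / q ^ 2 * (x * y) := by
        rw [one_div, inv_mul_eq_div, le_div_iff₀ (by positivity)]
        linarith
      have h3 : d ^ 2 ≤ z ^ 2 := by
        gcongr
        linarith
      have h4 : 0 ≤ 2 / q * (x * y) := by positivity
      rw [hM, add_mul]
      linarith [ht.2]
    have hxy : |x - y| ≤ M * y := by
      have h1 : z ≤ 1 / q * y := by
        rw [one_div, inv_mul_eq_div, le_div_iff₀ hq0]
        linarith
      have h2 : 0 ≤ 1 / q ^ 2 * y := by positivity
      have h3 : M * y = 2 * (1 / q * y) + 1 / q ^ 2 * y := by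
        rw [hM]
        ring
      rw [abs_le, h3]
      have := hyb.2
      constructor <;> linarith
    have h := hT t ht.1 ht1 x hx0 y hy0 htM hxy
    have hx2 : x ^ 2 ≤ (2 * z) ^ 2 := by gcongr
    have hy2 : y ^ 2 ≤ (2 * z) ^ 2 := by
      gcongr
      exact hyb.2
    calc _ ≤ C₀ * ((1 + x ^ 2 + y ^ 2) + heatMajorant β t x y * (x + 1 / x)) / √t := by gcongr
      _ ≤ C₀ * ((1 + 8 * z ^ 2) + heatMajorant β t x y * (x + 1 / x)) / √t := by
          refine div_le_div_of_nonneg_right (mul_le_mul_of_nonneg_left ?_ hC₀.le)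
            (Real.sqrt_nonneg t)
          linarith
      _ = _ := by ring
  · simp only [lintegral_Ioc_ofReal_div_sqrt (by positivity : 0 ≤ 1 + 8 * z ^ 2) hd0,
      setLIntegral_const]
    calc _ ≤ ENNReal.ofReal ((1 + 8 * z ^ 2) * (2 * d)) * ENNReal.ofReal (3 * d) := by
          gcongr
          exact volume_enlarge_le hκ3.le hd0
      _ = ENNReal.ofReal ((1 + 8 * z ^ 2) * (2 * d) * (3 * d)) :=
          (ENNReal.ofReal_mul (by positivity)).symm
      _ ≤ _ := by
          refine ENNReal.ofReal_le_ofReal ?_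
          have h1 : d ^ 2 ≤ 1 := pow_le_one₀ hd0.le hd1
          have h2 : (d * z) ^ 2 ≤ 2 ^ 2 := by gcongr
          nlinarith
  · exact (lintegral_lintegral_mono_set (fun x hx => hx.1) Ioc_subset_Ioi_self _).trans (hK y hy0)

end

/-! ### Assembly of the theorem -/

theorem mainTheorem8 (β : ℝ) (hβ : 0 < β) :
    -- the heat kernel is given by a convergent series and is differentiable in `x`
    (∀ t > 0, ∀ x > 0, ∀ y > 0,
      Summable (fun n : ℕ =>
        Real.exp (-t * laguerreEigenvalue β n) * laguerreFun β n x * laguerreFun β n y) ∧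
      DifferentiableAt ℝ (fun x' => laguerreHeatKernel β t x' y) x) ∧
    IsLaguerreSemigroupKernel β (laguerreHeatKernel β) ∧
    ∀ κ : ℝ, IsEnlargementFactor (Ioi 0) laguerreCovering κ →
      ∃ C : ℝ≥0,
        CondA3 (Ioi 0) (laguerreHeatKernel β) laguerreCovering κ C ∧
        CondA4 (Ioi 0) (laguerreHeatKernel β) laguerreCovering κ C ∧
        CondA5 (Ioi 0) (laguerreHeatKernel β) laguerreCovering κ C ∧
        CondA6 (Ioi 0) (laguerreHeatKernel β) (laguerreV β) C := by
  refine ⟨fun t ht x hx y hy => ⟨(hasSum_laguerreHeatKernel hβ ht hx hy).summable,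
    (hasDerivAt_laguerreHeatKernel hβ ht hx hy).differentiableAt⟩,
    isLaguerreSemigroupKernel hβ, fun κ hκ => ?_⟩
  obtain ⟨C₃, h₃, H₃⟩ := exists_condA3 hβ hκ
  obtain ⟨C₄, h₄, H₄⟩ := exists_condA4 hβ hκ
  obtain ⟨C₅, h₅, H₅⟩ := exists_condA5 hβ hκ
  obtain ⟨C₆, h₆, H₆⟩ := exists_condA6 hβ
  have hle : ∀ C ≤ C₃ + C₄ + C₅ + C₆,
      (Real.toNNReal C : ℝ≥0∞) ≤ Real.toNNReal (C₃ + C₄ + C₅ + C₆) := fun C hC =>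
    ENNReal.coe_le_coe.2 (Real.toNNReal_le_toNNReal hC)
  exact ⟨Real.toNNReal (C₃ + C₄ + C₅ + C₆),
    fun Q hQ y hy => (H₃ Q hQ y hy).trans (hle C₃ (by linarith)),
    fun Q hQ y hy => (H₄ Q hQ y hy).trans (hle C₄ (by linarith)),
    fun Q hQ y hy => (H₅ Q hQ y hy).trans (hle C₅ (by linarith)),
    fun y hy => (H₆ y hy).trans (hle C₆ (by linarith))⟩
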